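/- Let $C$ be a smooth projective geometrically irreducible curve over a finite field $\mathbb F$ with $q$ elements, $\infty$ a closed point of $C$, $K$ the function field of $C$, and $A\subset K$ the ring of rational functions regular outside $\infty$. Let $\mathbb C_\infty$ be the completion, at a place above $\infty$, of an algebraic closure of $K$, and let $L$ be a field with $K\subseteq L\subseteq\mathbb C_\infty$. Let $(E,\phi)$ be an Anderson $A$-module over $L$ of dimension $d\geq 1$: an $\mathbb F$-vector space scheme $E$ over $L$ isomorphic to $\mathbb G_{a,L}^d$ with a homomorphism of $\mathbb F$-algebras $\phi:A\to\operatorname{End}_{\mathbb F,L}(E)$ such that $\partial\phi_a-a$ is nilpotent on $\operatorname{Lie}_E(L)$ for all $a\in A$. We write $ae=\phi_a(e)$ for $e\in E(\mathbb C_\infty)$, $\partial a=\partial\phi_a$ and $\partial(a/b)=(\partial b)^{-1}\partial a$ on $\operatorname{Lie}_E(\mathbb C_\infty)$, the latter being an $A$-module through $\partial$. Let $\exp_E:\operatorname{Lie}_E(\mathbb C_\infty)\to E(\mathbb C_\infty)$ be the exponential function of $E$: the unique $A$-linear map which, in every coordinate system $\kappa:E\cong\mathbb G_{a,L}^d$,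 is given by an everywhere convergent series $x+e_1x^{(1)}+e_2x^{(2)}+\cdots$, where the $e_n$ are $d\times d$ matrices over $\mathbb C_\infty$ and $x^{(n)}$ is $x$ with its coordinates raised to the power $q^n$. Let $\Lambda_E=\ker\exp_E$. One calls $E$ uniformizable if $\exp_E$ is surjective, and abelian if $\operatorname{Hom}_{\mathbb F,L}(E,\mathbb G_{a,L})$ is finitely generated as an $A\otimes_{\mathbb F}L$-module. Let $\mathfrak p$ be a maximal ideal of $A$ with residue field $\mathbb F_{\mathfrak p}=A/\mathfrak p$, let $u\in\mathfrak p\setminus\mathfrak p^2$, and let $z\in\mathfrak p^{-1}$ with $uz\equiv 1\bmod\mathfrak p$. Let $\chi:(A/\mathfrak p)^\times\to\mathbb F_{\mathfrak p}^\times$ be a group homomorphism, lifted to a map $\chi:A\to\mathbb F_{\mathfrak p}$ with value $0$ on $\mathfrak p$; it is called evaluative if this lift is a homomorphism of $\mathbb F$-algebras. For $\lambda\in\Lambda_E$ let $\psi_\lambda:A/\mathfrak p\to E(\mathbb C_\infty)$, $\psi_\lambda(a)=\exp_E(\partial(az)\lambda)$, and $$g(\chi,\psi_\lambda)=-\sum_{x\in(A/\mathfrak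 p)^\times}\chi(x)^{-1}\otimes\psi_\lambda(x)\in\mathbb F_{\mathfrak p}\otimes_{\mathbb F}E(\mathbb C_\infty),$$ $$G(E,\chi)=\{g\in\mathbb F_{\mathfrak p}\otimes_{\mathbb F}E(\mathbb C_\infty)\mid (1\otimes a)g=(\chi(a)\otimes1)g\text{ for all }a\in A\}.$$ Let $S$ be any set of generators of the $A$-module $\Lambda_E$. (1) If $E$ is uniformizable, then the sums $g(\chi,\psi_\lambda)$ with $\lambda\in S$ generate the $\mathbb F_{\mathfrak p}$-vector space $G(E,\chi)$. (2) If $E$ is abelian and $\chi$ is evaluative, then $E$ is uniformizable if and only if the sums $g(\chi,\psi_\lambda)$ with $\lambda\in S$ generate the $\mathbb F_{\mathfrak p}$-vector space $G(E,\chi)$. -/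

import Mathlib

open CategoryTheory
open scoped TensorProduct

universe u

noncomputable section

/-! ### The coefficient ring -/

/-- `K` is the function field of a smooth projective geometrically irreducible curve over the finite
(hence perfect) field `F`: it is finite over `F(x)` for some `x` transcendental over `F`, and `F` is
algebraically closed in `K`. -/
def IsCurveFunctionField (F K : Type u) [Field F] [Field K] [Algebra F K] : Prop :=
  (∃ x : K, Transcendental F x ∧ FiniteDimensional (IntermediateField.adjoin F {x}) K) ∧
    ∀ x : K, IsAlgebraic F x → x ∈ (algebraMap F K).range

/-- `V` is (the local ring of) a closed point of the curve with function field `K` over `F`: a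
nontrivial valuation ring of `K` containing `F`. -/
def IsClosedPoint (F : Type u) {K : Type u} [Field F] [Field K] [Algebra F K]
    (V : ValuationSubring K) : Prop :=
  (∀ c : F, algebraMap F K c ∈ V) ∧ V ≠ ⊤

/-- The ring `A` of rational functions which are regular at every closed point other than `∞`. -/
def ringRegularAway (F : Type u) {K : Type u} [Field F] [Field K] [Algebra F K]
    (infty : ValuationSubring K) : Subalgebra F K where
  carrier := {x | ∀ V : ValuationSubring K, IsClosedPoint F V → V ≠ infty → x ∈ V}
  mul_mem' hx hy V hV hne := V.mul_mem _ _ (hx V hV hne) (hy V hV hne)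
  add_mem' hx hy V hV hne := V.add_mem _ _ (hx V hV hne) (hy V hV hne)
  algebraMap_mem' c _ hV _ := hV.1 c

/-! ### Vector space schemes, as functors of points, and their Lie algebras

An `F`-vector space scheme over `L` which is isomorphic to a power of the additive group is affine.
It is given by its functor of points `R ↦ E(R)`, from `L`-algebras to `F`-vector spaces, and
by Yoneda the morphisms of such schemes are the natural transformations. -/

/-- The `d`-th power of the additive group over `L`, as a functor to `L`-vector spaces:
`R ↦ R^d`. -/
def GaLin (L : Type u) [Field L] (d : ℕ) : CommAlgCat.{u} L ⥤ ModuleCat.{u} L where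
  obj R := ModuleCat.of L (Fin d → R)
  map f := ModuleCat.ofHom (f.hom.toLinearMap.compLeft (Fin d))

/-- The `d`-th power of the additive group over `L` with its structure of `F`-vector space
scheme. -/
def Ga (F L : Type u) [Field F] [Field L] [Algebra F L] (d : ℕ) :
    CommAlgCat.{u} L ⥤ ModuleCat.{u} F :=
  GaLin L d ⋙ ModuleCat.restrictScalars (algebraMap F L)

/-- Multiplication by `l ∈ L` on the additive group over `L`, as a morphism of functors to `L`-vector
spaces. -/
def gaLinScale {L : Type u} [Field L] (l : L) : GaLin L 1 ⟶ GaLin L 1 where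
  app R := ModuleCat.ofHom (l • (LinearMap.id : (Fin 1 → R) →ₗ[L] (Fin 1 → R)))
  naturality R S f := by
    apply ModuleCat.hom_ext
    apply LinearMap.ext
    intro x
    exact (map_smul (f.hom.toLinearMap.compLeft (Fin 1)) l x).symm

/-- Multiplication by `l ∈ L` on the additive group over `L`. -/
def gaScale (F : Type u) {L : Type u} [Field F] [Field L] [Algebra F L] (l : L) :
    Ga F L 1 ⟶ Ga F L 1 :=
  Functor.whiskerRight (gaLinScale l) (ModuleCat.restrictScalars (algebraMap F L))

section Lie

variable {F L : Type u} [Field F] [Field L] [Algebra F L]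

/-- The coordinates of an `R`-point of the `d`-th power of the additive group. -/
def gaCoord {d : ℕ} {R : CommAlgCat.{u} L} (x : (Ga F L d).obj R) : Fin d → R := x

/-- The tangent space at the neutral element, `Lie_V(R) = ker (V(R[ε]) → V(R))`. -/
def lieAlg (V : CommAlgCat.{u} L ⥤ ModuleCat.{u} F) (R : Type u) [CommRing R] [Algebra L R] :
    Submodule F (V.obj (CommAlgCat.of L (DualNumber R))) :=
  LinearMap.ker (V.map (CommAlgCat.ofHom (TrivSqZeroExt.fstHom L R R))).hom

/-- The map `∂f` induced on Lie algebras by a morphism `f`. -/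
def lieMap {V W : CommAlgCat.{u} L ⥤ ModuleCat.{u} F} (f : V ⟶ W)
    (R : Type u) [CommRing R] [Algebra L R] : lieAlg V R →ₗ[F] lieAlg W R :=
  (f.app (CommAlgCat.of L (DualNumber R))).hom.restrict (by
    intro x hx
    have h := congrArg (fun g => g.hom x)
      (f.naturality (CommAlgCat.ofHom (TrivSqZeroExt.fstHom L R R)))
    have hx' : (V.map (CommAlgCat.ofHom (TrivSqZeroExt.fstHom L R R))).hom x = 0 := hx
    simp only [ModuleCat.hom_comp, LinearMap.comp_apply, hx', map_zero] at h
    exact h.symm)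

/-- The `L`-algebra endomorphism `ε ↦ r ε` of `R[ε]`. -/
def scaleEps (L : Type u) [Field L] {R : Type u} [CommRing R] [Algebra L R] (r : R) :
    DualNumber R →ₐ[L] DualNumber R :=
  (TrivSqZeroExt.map (r • (LinearMap.id : R →ₗ[R] R))).restrictScalars L

/-- Scalar multiplication by `r ∈ R` on `Lie_V(R)`, induced by `ε ↦ r ε`. -/
def lieScale (V : CommAlgCat.{u} L ⥤ ModuleCat.{u} F) {R : Type u} [CommRing R] [Algebra L R]
    (r : R) : lieAlg V R →ₗ[F] lieAlg V R :=
  (V.map (CommAlgCat.ofHom (scaleEps L r))).hom.restrict (by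
    intro x hx
    have hx' : (V.map (CommAlgCat.ofHom (TrivSqZeroExt.fstHom L R R))).hom x = 0 := hx
    have hc : CommAlgCat.ofHom (scaleEps L r) ≫ CommAlgCat.ofHom (TrivSqZeroExt.fstHom L R R) =
        CommAlgCat.ofHom (TrivSqZeroExt.fstHom L R R) := by
      exact CommAlgCat.hom_ext (AlgHom.ext fun y => TrivSqZeroExt.fst_map _ y)
    have h := congrArg (fun g => (V.map g).hom x) hc
    simp only [Functor.map_comp, ModuleCat.hom_comp, LinearMap.comp_apply] at h
    exact h.trans hx')

/-- The identification of the Lie algebra of the `d`-th power of the additive group with `R^d`: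
the coefficients of `ε`. -/
def gaLieCoord {d : ℕ} {R : Type u} [CommRing R] [Algebra L R] (x : lieAlg (Ga F L d) R) :
    Fin d → R :=
  fun i => TrivSqZeroExt.snd (gaCoord x.1 i : DualNumber R)

end Lie

/-! ### Anderson modules -/

/-- Anderson `A`-modules of dimension `d` over the `A`-field `L`. -/
structure AndersonModule (F A L : Type u) [Field F] [CommRing A] [Algebra F A] [Field L]
    [Algebra F L] [Algebra A L] (d : ℕ) where
  /-- the functor of points of the `F`-vector space scheme `E` -/
  E : CommAlgCat.{u} L ⥤ ModuleCat.{u} F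
  iso_ga : Nonempty (E ≅ Ga F L d)
  /-- the action of `A` on `E` -/
  φ : A →ₐ[F] End E
  nilpotent : ∀ a : A,
    IsNilpotent (lieMap (φ a) L - lieScale E (algebraMap A L a) : Module.End F (lieAlg E L))

namespace AndersonModule

variable {F A L : Type u} [Field F] [CommRing A] [Algebra F A] [Field L]
  [Algebra F L] [Algebra A L] {d : ℕ} (E : AndersonModule F A L d)

/-- `Hom_{F,L}(E, G_a)` is finitely generated as an `A ⊗ L`-module, where `a ∈ A` acts by
precomposition with `φ_a` and `l ∈ L` by postcomposition with multiplication by `l`: finitely many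
elements `m` exist such that the elements `(a ⊗ l) m` generate the additive group. -/
def IsAbelian : Prop :=
  ∃ S : Set (E.E ⟶ Ga F L 1), S.Finite ∧
    AddSubgroup.closure
      {m : E.E ⟶ Ga F L 1 | ∃ (a : A) (l : L), ∃ s ∈ S, m = E.φ a ≫ s ≫ gaScale F l} = ⊤

/-- The `R`-points `E(R)`. -/
def Points (R : Type u) [CommRing R] [Algebra L R] : Type u := E.E.obj (CommAlgCat.of L R)

/-- The Lie algebra `Lie_E(R)`. -/
def Lie (R : Type u) [CommRing R] [Algebra L R] : Type u := lieAlg E.E R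

variable (R : Type u) [CommRing R] [Algebra L R]

instance : AddCommGroup (E.Points R) :=
  inferInstanceAs (AddCommGroup (E.E.obj (CommAlgCat.of L R)))

instance : Module F (E.Points R) := inferInstanceAs (Module F (E.E.obj (CommAlgCat.of L R)))

instance : AddCommGroup (E.Lie R) := inferInstanceAs (AddCommGroup (lieAlg E.E R))

instance : Module F (E.Lie R) := inferInstanceAs (Module F (lieAlg E.E R))

/-- The action `e ↦ φ_a(e)` of `A` on `E(R)`. -/
def pointsAct : A →+* Module.End F (E.Points R) where
  toFun a := ((E.φ a).app (CommAlgCat.of L R)).hom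
  map_one' := by rw [map_one]; rfl
  map_mul' a b := by rw [map_mul]; rfl
  map_zero' := by rw [map_zero]; rfl
  map_add' a b := by rw [map_add]; rfl

/-- The action `x ↦ ∂φ_a(x)` of `A` on `Lie_E(R)`. -/
def lieAct : A →+* Module.End F (E.Lie R) where
  toFun a := lieMap (E.φ a) R
  map_one' := by rw [map_one]; rfl
  map_mul' a b := by rw [map_mul]; rfl
  map_zero' := by rw [map_zero]; rfl
  map_add' a b := by rw [map_add]; rfl

instance : Module A (E.Points R) := Module.compHom _ (E.pointsAct R)

instance : Module A (E.Lie R) := Module.compHom _ (E.lieAct R)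

open Classical in
/-- The action `∂r = (∂b)⁻¹ ∂a` of `r = a / b` in the fraction field `K` of `A`, on `Lie_E(R)`. -/
def fracAct {K : Type u} [Field K] [Algebra A K] (r : K) : Module.End F (E.Lie R) :=
  if h : ∃ ab : A × A, algebraMap A K ab.2 ≠ 0 ∧ r = algebraMap A K ab.1 / algebraMap A K ab.2 then
    Ring.inverse (E.lieAct R h.choose.2) * E.lieAct R h.choose.1
  else 0

/-! ### The exponential -/

section Exponential

variable (C : Type u) [NormedField C] [Algebra L C]

/-- The characterization of the exponential function: it is `A`-linear, and in every coordinate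
system `κ` it is given by a series `x + e₁ τ(x) + e₂ τ²(x) + ⋯` converging on all of `C^d`, where
`τ` raises each coordinate to the power `q = #F`. -/
def IsExponential (f : E.Lie C →ₗ[A] E.Points C) : Prop :=
  ∀ κ : E.E ≅ Ga F L d, ∃ e : ℕ → Matrix (Fin d) (Fin d) C, e 0 = 1 ∧
    ∀ x : E.Lie C,
      HasSum
        (fun n : ℕ => (e n).mulVec (fun i => gaLieCoord (lieMap κ.hom C x) i ^ (Nat.card F ^ n)))
        (gaCoord ((κ.hom.app (CommAlgCat.of L C)).hom (f x)) : Fin d → C)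

/-- The exponential function `exp_E : Lie_E(C) → E(C)`: the function with the property
`IsExponential` (over the field `C_∞` there is exactly one). -/
def exp : E.Lie C →ₗ[A] E.Points C := Classical.epsilon (E.IsExponential C)

/-- The period lattice `Λ_E`. -/
def periodLattice : Submodule A (E.Lie C) := LinearMap.ker (E.exp C)

/-- `E` is uniformizable if its exponential function is surjective. -/
def IsUniformizable : Prop := Function.Surjective (E.exp C)

end Exponential

/-! ### Gauss-Thakur sums -/

/-- The lift of a multiplicative character `χ` of conductor `𝔭` to a map `A → A/𝔭`, with value
zero on `𝔭` (`MulChar.ofUnitHom` is the extension by zero to non-units). -/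
def _root_.charLift {A : Type u} [CommRing A] {p : Ideal A} (χ : (A ⧸ p)ˣ →* (A ⧸ p)ˣ) (a : A) :
    A ⧸ p :=
  MulChar.ofUnitHom χ (Ideal.Quotient.mk p a)

/-- `χ` is evaluative: its lift is a homomorphism of `F`-algebras. -/
def _root_.IsEvaluative (F : Type u) {A : Type u} [Field F] [CommRing A] [Algebra F A] {p : Ideal A}
    (χ : (A ⧸ p)ˣ →* (A ⧸ p)ˣ) : Prop :=
  ∃ f : A →ₐ[F] A ⧸ p, ∀ a : A, f a = charLift χ a

variable {p : Ideal A}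

/-- The Gauss-Thakur sum `g(χ,ψ) = - ∑ χ(x)⁻¹ ⊗ ψ(x)`, with `x` in the finite group `(A/𝔭)ˣ`. -/
def gaussThakurSum (χ : (A ⧸ p)ˣ →* (A ⧸ p)ˣ) (ψ : A ⧸ p → E.Points R) :
    (A ⧸ p) ⊗[F] E.Points R :=
  -∑ᶠ x : (A ⧸ p)ˣ, (((χ x)⁻¹ : (A ⧸ p)ˣ) : A ⧸ p) ⊗ₜ[F] ψ (x : A ⧸ p)

/-- The space of Gauss-Thakur sums
`G(E,χ) = {g ∈ A/𝔭 ⊗ E(R) | (1 ⊗ φ_a) g = (χ(a) ⊗ 1) g for all a ∈ A}`. -/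
def gaussSpace (χ : (A ⧸ p)ˣ →* (A ⧸ p)ˣ) : Submodule (A ⧸ p) ((A ⧸ p) ⊗[F] E.Points R) where
  carrier := {g | ∀ a : A, (E.pointsAct R a).baseChange (A ⧸ p) g = charLift χ a • g}
  add_mem' hx hy a := by rw [map_add, hx a, hy a, smul_add]
  zero_mem' a := by rw [map_zero, smul_zero]
  smul_mem' c x hx a := by rw [map_smul, hx a, smul_comm]

/-- The additive character `ψ_λ : A/𝔭 → E(C)`, `a ↦ exp_E(∂(a z) λ)`, computed on the chosen
representatives of the residue classes (for a period `λ` and `z ∈ 𝔭⁻¹` the value does not depend on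
the representative). -/
def periodChar (p : Ideal A) {K : Type u} [Field K] [Algebra A K] (z : K)
    (C : Type u) [NormedField C] [Algebra L C] (lam : E.Lie C) : A ⧸ p → E.Points C :=
  fun x => E.exp C (E.fracAct C (algebraMap A K x.out * z) lam)

/-- The Gauss-Thakur sums `g(χ,ψ_λ)`, with `λ` in the set `S`, generate `G(E,χ)` as a vector space
over the residue field `A/𝔭`. -/
def PeriodSumsGenerate (χ : (A ⧸ p)ˣ →* (A ⧸ p)ˣ) {K : Type u} [Field K] [Algebra A K] (z : K)
    (C : Type u) [NormedField C] [Algebra L C] (S : Set (E.Lie C)) : Prop :=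
  Submodule.span (A ⧸ p) ((fun lam => E.gaussThakurSum C χ (E.periodChar p z C lam)) '' S) =
    E.gaussSpace C χ

end AndersonModule

end

/-! For a $\mathfrak p$-torsion point $e$ put $T(e)=-\sum_x\chi(x)^{-1}\otimes xe$ (`torsionSum`).
Since $-|(A/\mathfrak p)^\times|=1$ in $A/\mathfrak p$, averaging over the group shows that the
$T(e)$ with $e\in E[\mathfrak p]$ always span $G(E,\chi)$ (`span_torsionSum`). On the other hand
$g(\chi,\psi_\lambda)=T(\exp_E(\partial z\,\lambda))$, and the points $\exp_E(\partial z\,\lambda)$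
run through the $\mathfrak p$-torsion in the image of $\exp_E$, so the period sums span the same
space as $T(E[\mathfrak p]\cap\operatorname{im}\exp_E)$ (`span_gaussThakurSum_periodChar`). If
$\exp_E$ is surjective both spaces agree, which is (1).

If $\chi$ is evaluative it induces an automorphism of $A/\mathfrak p$, and $e$ can be recovered from
$T(e)$ (`mem_of_torsionSum_mem_span`). Generation therefore forces $E[\mathfrak
p]\subseteq\operatorname{im}\exp_E$. Division on the Lie algebra extends this to $E[\mathfrak p^n]$
for all $n$ (`mem_range_of_pow_torsion`). By finiteness of the class group some $\mathfrak p^n$ is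
principal, say $(t)$, so all $t$-power torsion lies in the image. What remains is that this makes
$\exp_E$ surjective when $E$ is abelian (`surjective_of_torsion_subset_range`).

For this analytic core, replace $t$ by a power with $\partial t$ a scalar $\theta$, $|\theta|>1$.
The $\mathbb F$-linear polynomial functions on $E$ over $\mathbb C_\infty$ form a finite free
$\mathbb C_\infty[X]$-module $M$, with $X$ acting as $t$ and a Frobenius $\tau$. Points of $E$ are
the functionals $e$ on $M$ with $e(\tau m)=e(m)^q$. There are $r=\operatorname{rank}M$ linearly
independent $t$-torsion points, each of the form $\exp_E(x)$, with division tower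
$\exp_E(\theta^{-n}x)\to0$. Their generating series form a matrix $\Psi$ of restricted power series
with $\Psi^{(1)}=\Phi\Psi$ and $\det\Phi=c(X-\theta)^s$. Comparison with a series
$\Omega=(X-\theta)\Omega^{(1)}$ shows that $\det\Psi$ divides a nonzero polynomial $g$ over $\mathbb
F$ (`exists_mul_eq_polynomial`). Solving Artin-Schreier equations in restricted series, one finds
that $g$ times any division tower differs from an $\mathbb F$-combination of the exponential towers
by a null sequence (`exists_tower_correction`). Null sequences end up in the image because $\exp_E$
is locally surjective, and every point is $g$ times the start of some tower, so every point is in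
the image (`mem_of_torsion_towers`). -/

noncomputable section

/-! ### Separating transcendence bases inside a subring -/

open IntermediateField in
/-- A finitely generated extension of a perfect field of characteristic `p` has a separating
transcendence basis contained in a given subalgebra which generates the field and contains some
finite transcendence basis. -/
theorem exists_separating_transcendenceBasis_subset {k K : Type*} [Field k] [Field K] [Algebra k K]
    [PerfectField k] [Algebra.EssFiniteType k K] (p : ℕ) [hp : Fact p.Prime] [CharP k p]
    (A : Subalgebra k K) (hfrac : ∀ n : K, ∃ a ∈ A, ∃ b ∈ A, b ≠ 0 ∧ n * b = a)
    (s₀ : Finset K) (hs₀A : (s₀ : Set K) ⊆ A)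
    (hs₀ : IsTranscendenceBasis k ((↑) : s₀ → K)) :
    ∃ s : Finset K, (s : Set K) ⊆ A ∧ IsTranscendenceBasis k ((↑) : s → K) ∧
      Algebra.IsSeparable (adjoin k (s : Set K)) K := by
  have : ExpChar k p := .prime hp.out
  have : CharP K p := .of_ringHom_of_ne_zero (algebraMap k K) p hp.out.ne_zero
  -- MacLane's criterion: over a perfect field $p$-th powers of independent elements stay
  -- independent, the coefficients being moved by the inverse Frobenius.
  have H : ∀ s : Finset K,
      LinearIndepOn k _root_.id (s : Set K) → LinearIndepOn k (· ^ p) (s : Set K) := by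
    intro s hs
    refine LinearIndependent.map_of_injective_injective hs (frobeniusEquiv k p).symm
      (frobenius K p).toAddMonoidHom (by simp) (by simp) fun r m => ?_
    change ((frobeniusEquiv k p).symm r • m) ^ p = r • m ^ p
    rw [smul_pow, frobeniusEquiv_symm_pow_p]
  let d (s : Finset K) := Field.finInsepDegree (adjoin k (s : Set K)) K
  let X : Set (Finset K) := {s | (s : Set K) ⊆ A ∧ IsTranscendenceBasis k ((↑) : s → K)}
  have hX : X.Nonempty := ⟨s₀, hs₀A, hs₀⟩
  let s := Function.argminOn d X hX
  have hs : s ∈ X := Function.argminOn_mem d X hX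
  refine ⟨s, hs.1, hs.2, ⟨fun m ↦ of_not_not fun hm ↦ ?_⟩⟩
  have hfd : Module.Finite (adjoin k (s : Set K)) K := by
    apply +allowSynthFailures Algebra.finite_of_essFiniteType_of_isAlgebraic
    · exact .of_comp k _ _
    · convert! hs.2.isAlgebraic_field <;> simp [s]
  -- Separable elements form a field and `A` generates `K` by fractions, so an inseparable element
  -- can be found inside `A`. This keeps the exchanged basis in `A`.
  obtain ⟨n, hnA, hn⟩ : ∃ n ∈ A, ¬ IsSeparable (adjoin k (s : Set K)) n := by
    by_contra! hcon
    obtain ⟨a, ha, b, hb, hb0, hmb⟩ := hfrac m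
    apply hm
    have ha' : a ∈ separableClosure (adjoin k (s : Set K)) K := hcon a ha
    have hb' : b ∈ separableClosure (adjoin k (s : Set K)) K := hcon b hb
    have : m = a / b := by rw [eq_div_iff hb0, hmb]
    rw [this]
    exact div_mem ha' hb'
  have hns : n ∉ (s : Set K) := fun h ↦
    hn (le_restrictScalars_separableClosure (F := k) _ (subset_adjoin _ _ h))
  obtain ⟨i, hi₁, hi₂⟩ := exists_isTranscendenceBasis_and_isSeparable_of_linearIndepOn_pow'
    p hp.out (a := id) H (s : Set K) n hs.2 hns
  rw [Set.image_id] at hi₂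
  have hfin : (insert n (s : Set K) \ {i}).Finite := (s.finite_toSet.insert n).sdiff
  obtain ⟨t, ht⟩ : ∃ t : Finset K, (t : Set K) = insert n (s : Set K) \ {i} :=
    ⟨hfin.toFinset, by simp⟩
  have htX : t ∈ X := by
    refine ⟨?_, ?_⟩
    · rw [ht]
      intro x hx
      obtain rfl | hx := hx.1
      exacts [hnA, hs.1 hx]
    · change IsTranscendenceBasis k (Subtype.val : ↥(t : Set K) → K)
      rw [ht]
      exact hi₁
  rw [← ht] at hi₂
  -- Exchanging `i` for `n` strictly enlarges the separable closure, against the minimality of the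
  -- inseparable degree for `s`.
  have hlt : (separableClosure (adjoin k (s : Set K)) K).restrictScalars k <
      (separableClosure (adjoin k (t : Set K)) K).restrictScalars k := by
    refine SetLike.lt_iff_le_and_exists.mpr ⟨?_, n, ?_, hn⟩
    · rw [separableClosure_le_separableClosure_iff, adjoin_le_iff]
      intro x hx
      obtain rfl | ne := eq_or_ne x i
      · exact hi₂
      · exact le_restrictScalars_separableClosure _ (subset_adjoin _ _ (by
          rw [ht]; exact ⟨.inr hx, ne⟩))
    · obtain rfl | ne := eq_or_ne n i
      · exact hi₂
      · exact le_restrictScalars_separableClosure _ (subset_adjoin _ _ (by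
          rw [ht]; exact ⟨.inl rfl, ne⟩))
  have : Module.Finite ((separableClosure (adjoin k (s : Set K)) K).restrictScalars k) K :=
    inferInstanceAs <| Module.Finite (separableClosure (adjoin k (s : Set K)) K) K
  exact Function.not_lt_argminOn d X htX (by apply finrank_lt_of_gt hlt)

/-! ### The ring of functions regular away from a point -/

section Curve

variable {F K : Type u} [Field F] [Field K] [Algebra F K]

/-- The valuation rings containing the constants intersect in the integral closure of `F`, and the
trivial valuation ring imposes no condition. -/
theorem isAlgebraic_of_mem_all_closedPoints {x : K}
    (hx : ∀ V : ValuationSubring K, IsClosedPoint F V → x ∈ V) : IsAlgebraic F x := by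
  have h1 : x ∈ (⨅ V : {V : ValuationSubring K // (Set.range (algebraMap F K)) ⊆ V.toSubring},
      V.1.toSubring) := by
    rw [Subring.mem_iInf]
    rintro ⟨V, hV⟩
    by_cases hT : V = ⊤
    · subst hT; trivial
    · exact hx V ⟨fun c => hV ⟨c, rfl⟩, hT⟩
  rw [iInf_valuationSubring_superset] at h1
  have h2 : IsIntegral (Subring.closure (Set.range (algebraMap F K))) x := h1
  rw [← RingHom.coe_range, Subring.closure_eq] at h2
  obtain ⟨q, hq, hq0⟩ := h2
  have hl : q ∈ Polynomial.lifts (algebraMap F K).rangeRestrict := by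
    rw [Polynomial.mem_lifts]
    exact Polynomial.map_surjective _ (algebraMap F K).rangeRestrict_surjective q
  obtain ⟨r, hr, -, hrm⟩ := Polynomial.lifts_and_natDegree_eq_and_monic hl hq
  refine ⟨r, hrm.ne_zero, ?_⟩
  rw [← hr, Polynomial.eval₂_map] at hq0
  exact hq0

variable {infty : ValuationSubring K}

/-- A function without any pole is algebraic over the constants, so a transcendental element of the
ring must have its pole at infinity. -/
theorem notMem_infty_of_transcendental {x : K} (hx : Transcendental F x)
    (hxA : x ∈ ringRegularAway F infty) : x ∉ infty := by
  intro hi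
  apply hx
  apply isAlgebraic_of_mem_all_closedPoints
  intro V hV
  by_cases h : V = infty
  · exact h ▸ hi
  · exact hxA V hV h

-- Because `x` has a pole at infinity, the nontrivial valuation rings containing `F[x]` are closed
-- points other than infinity. Their intersection is the integral closure of `F[x]`.
open Polynomial in
theorem mem_ringRegularAway_iff {x : K} (hx : Transcendental F x)
    (hxA : x ∈ ringRegularAway F infty) (a : K) :
    a ∈ ringRegularAway F infty ↔ (aeval (R := F) x : F[X] →ₐ[F] K).toRingHom.IsIntegralElem a := by
  constructor
  · intro ha
    have h1 : a ∈ (⨅ V : {V : ValuationSubring K //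
        ((aeval (R := F) x : F[X] →ₐ[F] K).toRingHom.range : Set K) ⊆ V.toSubring},
        V.1.toSubring) := by
      rw [Subring.mem_iInf]
      rintro ⟨V, hV⟩
      by_cases hT : V = ⊤
      · subst hT; trivial
      · refine ha V ⟨fun c => hV ⟨C c, by simp⟩, hT⟩ ?_
        rintro rfl
        exact notMem_infty_of_transcendental hx hxA (hV ⟨X, by simp⟩)
    rw [iInf_valuationSubring_superset, Subring.closure_eq] at h1
    obtain ⟨q, hq, hq0⟩ := h1
    have hl : q ∈ Polynomial.lifts (aeval (R := F) x : F[X] →ₐ[F] K).toRingHom.rangeRestrict := by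
      rw [Polynomial.mem_lifts]
      exact Polynomial.map_surjective _ (RingHom.rangeRestrict_surjective _) q
    obtain ⟨r, hr, -, hrm⟩ := Polynomial.lifts_and_natDegree_eq_and_monic hl hq
    refine ⟨r, hrm, ?_⟩
    rw [← hr, Polynomial.eval₂_map] at hq0
    exact hq0
  · rintro ⟨q, hq, hq0⟩ V hV hne
    have hmem : ∀ g : F[X], aeval x g ∈ V := by
      intro g
      induction g using Polynomial.induction_on' with
      | add p q hp hq => rw [map_add]; exact V.add_mem _ _ hp hq
      | monomial n c =>
        rw [aeval_monomial]
        exact V.mul_mem _ _ (hV.1 c) (pow_mem (hxA V hV hne) n)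
    have hint : IsIntegral V a := by
      refine ⟨q.map ((aeval (R := F) x : F[X] →ₐ[F] K).toRingHom.codRestrict V hmem),
        hq.map _, ?_⟩
      rw [Polynomial.eval₂_map]
      exact hq0
    obtain ⟨v, rfl⟩ := IsIntegrallyClosed.isIntegral_iff.mp hint
    exact v.2

end Curve

/-! ### Integral closures of `F[x]` as Dedekind rings -/

section IntegralClosure

variable {F K : Type u} [Field F] [Field K] [Algebra F K]

open Polynomial IntermediateField

/-- The algebra structure of `K` over `F[X]` given by `X ↦ x`. -/
abbrev polyAlgebra (F : Type u) {K : Type u} [Field F] [Field K] [Algebra F K] (x : K) :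
    Algebra F[X] K := (aeval (R := F) x : F[X] →ₐ[F] K).toRingHom.toAlgebra

/-- The algebra structure of `K` over `F(X)` given by `X ↦ x` for a transcendental `x`. -/
abbrev ratFuncAlgebra {x : K} (hx : Transcendental F x) : Algebra (RatFunc F) K :=
  ((algebraMap F⟮x⟯ K).comp
    (RatFunc.algEquivOfTranscendental x hx : RatFunc F ≃ₐ[F] F⟮x⟯).toRingEquiv.toRingHom).toAlgebra

theorem ratFunc_isScalarTower {x : K} (hx : Transcendental F x) :
    letI := polyAlgebra F x
    letI := ratFuncAlgebra hx
    IsScalarTower F[X] (RatFunc F) K := by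
  let := polyAlgebra F x
  let := ratFuncAlgebra hx
  refine IsScalarTower.of_algebraMap_eq fun g => ?_
  change aeval x g = algebraMap F⟮x⟯ K
    (RatFunc.algEquivOfTranscendental x hx (algebraMap F[X] (RatFunc F) g))
  rw [RatFunc.algEquivOfTranscendental_algebraMap]
  simp

theorem ratFunc_finite {x : K} (hx : Transcendental F x) [FiniteDimensional F⟮x⟯ K] :
    letI := ratFuncAlgebra hx
    FunctionField F K := by
  let := ratFuncAlgebra hx
  exact Module.Finite.of_equiv_equiv (A₁ := F⟮x⟯) (B₁ := K)
    (RatFunc.algEquivOfTranscendental x hx).symm.toRingEquiv (RingEquiv.refl K) (by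
      ext y
      change algebraMap F⟮x⟯ K ((RatFunc.algEquivOfTranscendental x hx)
        ((RatFunc.algEquivOfTranscendental x hx).symm y)) = _
      simp)

theorem ratFunc_isSeparable {x : K} (hx : Transcendental F x) [Algebra.IsSeparable F⟮x⟯ K] :
    letI := ratFuncAlgebra hx
    Algebra.IsSeparable (RatFunc F) K := by
  let := ratFuncAlgebra hx
  exact Algebra.IsSeparable.of_equiv_equiv (A₁ := F⟮x⟯) (B₁ := K)
    (RatFunc.algEquivOfTranscendental x hx).symm.toRingEquiv (RingEquiv.refl K) (by
      ext y
      change algebraMap F⟮x⟯ K ((RatFunc.algEquivOfTranscendental x hx)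
        ((RatFunc.algEquivOfTranscendental x hx).symm y)) = _
      simp)

variable {A : Subalgebra F K} {x : K}

/-- A subalgebra which is the integral closure of `F[x]` has `K` as its field of fractions. -/
theorem exists_mul_mem_of_isIntegralElem (hx : Transcendental F x) [FiniteDimensional F⟮x⟯ K]
    (hA : ∀ a : K, a ∈ A ↔ (aeval (R := F) x : F[X] →ₐ[F] K).toRingHom.IsIntegralElem a) (n : K) :
    ∃ a ∈ A, ∃ b ∈ A, b ≠ 0 ∧ n * b = a := by
  let := polyAlgebra F x
  let := ratFuncAlgebra hx
  have := ratFunc_isScalarTower hx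
  have := ratFunc_finite hx
  have h1 : Algebra.IsAlgebraic F[X] K :=
    (IsFractionRing.comap_isAlgebraic_iff (A := F[X]) (K := RatFunc F) (C := K)).mpr inferInstance
  obtain ⟨y, hy, hi⟩ := (h1.isAlgebraic n).exists_integral_multiple
  refine ⟨_, (hA _).mpr hi, aeval x y, ?_, ?_, ?_⟩
  · exact (hA _).mpr (RingHom.isIntegralElem_map _)
  · exact fun h => hx ⟨y, hy, h⟩
  · rw [Algebra.smul_def, mul_comm]; rfl

/-- Separability makes the integral closure of `F[X]` in `K` a finite Dedekind extension; the class
group is finite because the degree absolute value of `F[X]` is admissible. -/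
theorem dedekind_of_isIntegralElem [Finite F] (hx : Transcendental F x) [FiniteDimensional F⟮x⟯ K]
    [Algebra.IsSeparable F⟮x⟯ K]
    (hA : ∀ a : K, a ∈ A ↔ (aeval (R := F) x : F[X] →ₐ[F] K).toRingHom.IsIntegralElem a) :
    IsDedekindDomain A ∧ Finite (ClassGroup A) ∧ Algebra.FiniteType F A := by
  classical
  let := Fintype.ofFinite F
  let := polyAlgebra F x
  let := ratFuncAlgebra hx
  have := ratFunc_isScalarTower hx
  have := ratFunc_finite hx
  have := ratFunc_isSeparable hx
  have hxA : x ∈ A := (hA x).mpr (by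
    have := RingHom.isIntegralElem_map (aeval (R := F) x : F[X] →ₐ[F] K).toRingHom (x := X)
    simpa using this)
  let : Algebra F[X] A := (aeval (R := F) (⟨x, hxA⟩ : A) : F[X] →ₐ[F] A).toRingHom.toAlgebra
  have : IsScalarTower F[X] A K := IsScalarTower.of_algebraMap_eq fun g => by
    change aeval x g = ((aeval (⟨x, hxA⟩ : A) g : A) : K)
    have := aeval_algHom_apply A.val (⟨x, hxA⟩ : A) g
    exact this
  have : IsScalarTower F F[X] A := IsScalarTower.of_algebraMap_eq fun c => by
    change algebraMap F A c = aeval (⟨x, hxA⟩ : A) (C c)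
    simp
  have : IsIntegralClosure A F[X] K :=
    { algebraMap_injective := Subtype.val_injective
      isIntegral_iff := fun {a} => by
        constructor
        · intro h
          exact ⟨⟨a, (hA a).mpr h⟩, rfl⟩
        · rintro ⟨y, rfl⟩
          exact (hA _).mp y.2 }
  have h1 : IsDedekindDomain A := IsIntegralClosure.isDedekindDomain F[X] (RatFunc F) K A
  have h2 : Fintype (ClassGroup A) := ClassGroup.fintypeOfAdmissibleOfFinite (RatFunc F) K
    (Polynomial.cardPowDegreeIsAdmissible :
      AbsoluteValue.IsAdmissible (Polynomial.cardPowDegree : AbsoluteValue F[X] ℤ))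
  have : IsNoetherian F[X] A := IsIntegralClosure.isNoetherian _ (RatFunc F) K _
  have h3 : Algebra.FiniteType F A := Algebra.FiniteType.trans (S := F[X]) inferInstance inferInstance
  exact ⟨h1, inferInstance, h3⟩

end IntegralClosure

/-! ### Transcendental elements and arithmetic of the ring of the curve -/

section Curve

variable {F K : Type u} [Field F] [Field K] [Algebra F K]

open IntermediateField

theorem IsCurveFunctionField.essFiniteType (hK : IsCurveFunctionField F K) :
    Algebra.EssFiniteType F K := by
  obtain ⟨⟨x, -, hx⟩, -⟩ := hK
  have h1 : Algebra.EssFiniteType F F⟮x⟯ := essFiniteType_iff.mpr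
    ⟨{x}, by simp⟩
  exact Algebra.EssFiniteType.comp F F⟮x⟯ K

theorem isTranscendenceBasis_singleton {x : K} (hx : Transcendental F x)
    [Algebra.IsAlgebraic F⟮x⟯ K] :
    IsTranscendenceBasis F ((↑) : ({x} : Set K) → K) := by
  rw [isTranscendenceBasis_iff_algebraicIndependent_isAlgebraic]
  refine ⟨algebraicIndependent_unique_type_iff.mpr hx, ?_⟩
  rw [Subtype.range_coe, ← isAlgebraic_adjoin_iff_top]
  infer_instance

theorem IsCurveFunctionField.isTranscendenceBasis (hK : IsCurveFunctionField F K) {x : K}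
    (hx : Transcendental F x) : IsTranscendenceBasis F ((↑) : ({x} : Set K) → K) := by
  obtain ⟨⟨y, hy, hy'⟩, -⟩ := hK
  have h1 := isTranscendenceBasis_singleton hy
  refine AlgebraicIndependent.isTranscendenceBasis_of_trdeg_le (algebraicIndependent_unique_type_iff.mpr hx) ?_ ?_
  · rw [← h1.cardinalMk_eq_trdeg]; simp
  · rw [← h1.cardinalMk_eq_trdeg]; simp

theorem IsCurveFunctionField.finiteDimensional (hK : IsCurveFunctionField F K) {x : K}
    (hx : Transcendental F x) : FiniteDimensional F⟮x⟯ K := by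
  have := hK.essFiniteType
  apply +allowSynthFailures Algebra.finite_of_essFiniteType_of_isAlgebraic
  · exact .of_comp F _ _
  · convert! (hK.isTranscendenceBasis hx).isAlgebraic_field <;> simp

variable {infty : ValuationSubring K}

/-- Provides the separability that the Dedekind argument needs without leaving the ring: in
transcendence degree one a separating basis is a single element. -/
theorem IsCurveFunctionField.exists_separating [Finite F] (hK : IsCurveFunctionField F K)
    {u : K} (hu : Transcendental F u) (huA : u ∈ ringRegularAway F infty) :
    ∃ x ∈ ringRegularAway F infty, Transcendental F x ∧ Algebra.IsSeparable F⟮x⟯ K := by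
  have := hK.essFiniteType
  have := hK.finiteDimensional hu
  obtain ⟨p, hp⟩ := CharP.exists F
  have : Fact p.Prime := ⟨CharP.char_is_prime F p⟩
  obtain ⟨s, hs1, hs2, hs3⟩ := exists_separating_transcendenceBasis_subset p
    (ringRegularAway F infty)
    (exists_mul_mem_of_isIntegralElem hu (mem_ringRegularAway_iff hu huA)) {u} (by simpa using huA)
    (by
      change IsTranscendenceBasis F (Subtype.val : ↥(({u} : Finset K) : Set K) → K)
      rw [Finset.coe_singleton]
      exact hK.isTranscendenceBasis hu)
  have hcard := hs2.cardinalMk_eq (hK.isTranscendenceBasis hu)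
  have : s.card = 1 := by simpa using hcard
  obtain ⟨x, rfl⟩ := Finset.card_eq_one.mp this
  refine ⟨x, hs1 (by simp), ?_, by convert! hs3 <;> simp⟩
  exact hs2.1.transcendental ⟨x, by simp⟩

theorem IsCurveFunctionField.dedekind [Finite F] (hK : IsCurveFunctionField F K)
    {u : K} (hu : Transcendental F u) (huA : u ∈ ringRegularAway F infty) :
    IsDedekindDomain (ringRegularAway F infty) ∧ Finite (ClassGroup (ringRegularAway F infty)) ∧
      Algebra.FiniteType F (ringRegularAway F infty) := by
  obtain ⟨x, hxA, hx, hxs⟩ := hK.exists_separating hu huA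
  have := hK.finiteDimensional hx
  exact dedekind_of_isIntegralElem hx (mem_ringRegularAway_iff hx hxA)

/-- Algebraic elements are constants, and nonzero constants are units, hence outside every proper
ideal. -/
theorem IsCurveFunctionField.transcendental_of_mem (hK : IsCurveFunctionField F K)
    {p : Ideal (ringRegularAway F infty)} (hp : p ≠ ⊤) {a : ringRegularAway F infty} (ha : a ∈ p)
    (ha0 : a ≠ 0) : Transcendental F (a : K) := by
  intro hal
  obtain ⟨c, hc⟩ := hK.2 _ hal
  have hac : a = algebraMap F (ringRegularAway F infty) c := Subtype.ext hc.symm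
  have hc0 : c ≠ 0 := by
    rintro rfl
    exact ha0 (by rw [hac, map_zero])
  refine hp (Ideal.eq_top_of_isUnit_mem _ ha ?_)
  rw [hac]
  exact (IsUnit.mk0 c hc0).map _

/-- The arithmetic of the ring of functions regular away from `∞` at a maximal ideal. -/
theorem IsCurveFunctionField.finite_quotient_and_exists_pow_eq_span [Finite F]
    (hK : IsCurveFunctionField F K) (p : Ideal (ringRegularAway F infty)) (hp : p.IsMaximal)
    (hp0 : p ≠ ⊥) :
    Finite (ringRegularAway F infty ⧸ p) ∧ ∃ t : ringRegularAway F infty, t ∈ p ∧ t ≠ 0 ∧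
      ∃ n : ℕ, p ^ n = Ideal.span {t} := by
  obtain ⟨u, hup, hu0⟩ := Submodule.exists_mem_ne_zero_of_ne_bot hp0
  obtain ⟨h1, h2, h3⟩ := hK.dedekind (hK.transcendental_of_mem hp.ne_top hup hu0) u.2
  refine ⟨?_, ?_⟩
  · let := Ideal.Quotient.field p
    have : Algebra.FiniteType F (ringRegularAway F infty ⧸ p) :=
      Algebra.FiniteType.of_surjective (Ideal.Quotient.mkₐ F p) (Ideal.Quotient.mkₐ_surjective F p)
    have := finite_of_finite_type_of_isJacobsonRing F (ringRegularAway F infty ⧸ p)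
    exact Module.finite_of_finite F
  · have hpm : p ∈ nonZeroDivisors (Ideal (ringRegularAway F infty)) :=
      mem_nonZeroDivisors_of_ne_zero hp0
    -- The class number annihilates the class of `p`, so that power of `p` is principal.
    have hpow : ClassGroup.mk0 ⟨p, hpm⟩ ^ Nat.card (ClassGroup (ringRegularAway F infty)) = 1 :=
      pow_card_eq_one'
    rw [← map_pow, SubmonoidClass.mk_pow, ClassGroup.mk0_eq_one_iff] at hpow
    obtain ⟨t, ht⟩ := hpow.principal
    have hn : Nat.card (ClassGroup (ringRegularAway F infty)) ≠ 0 := Nat.card_pos.ne'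
    have hts : p ^ Nat.card (ClassGroup (ringRegularAway F infty)) = Ideal.span {t} := ht
    refine ⟨t, Ideal.pow_le_self hn ?_, ?_, _, hts⟩
    · rw [hts]; exact Ideal.mem_span_singleton_self t
    · rintro rfl
      rw [Ideal.span_singleton_eq_bot.mpr rfl] at hts
      exact pow_ne_zero _ hp0 hts

end Curve

/-! ### Completions of algebraically closed valued fields -/

section Completion

open Polynomial

/-- A complete non-archimedean field with a dense algebraically closed subfield is algebraically
closed, in any characteristic. -/
theorem isAlgClosed_of_denseRange_of_isUltrametricDist {k C : Type*} [Field k]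
    [NontriviallyNormedField C] [CompleteSpace C] [IsUltrametricDist C] [Algebra k C]
    (hi : DenseRange (algebraMap k C)) [IsAlgClosed k] : IsAlgClosed C := by
  apply IsAlgClosed.of_exists_root
  intro f fmon firr
  have fnatdeg0 : f.natDegree ≠ 0 := (Irreducible.natDegree_pos firr).ne'
  let E := f.SplittingField
  let : NormedField E := spectralNorm.normedField C E
  let : NormedAlgebra C E := spectralNorm.normedAlgebra C E
  let a := rootOfSplits (SplittingField.splits f)
      (by simpa using degree_ne_of_natDegree_ne fnatdeg0)
  have fa0 : f.aeval a = 0 := by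
    rw [← eval_map_algebraMap]
    exact eval_rootOfSplits (Polynomial.SplittingField.splits f)
      (by simpa using degree_ne_of_natDegree_ne fnatdeg0)
  -- Roots move continuously with the coefficients: monic polynomials over `k` close to `f` have
  -- roots close to `a`, and those roots lie in `k`. Hence `a` is a limit of elements of the
  -- complete, so closed, subfield `C`.
  have hcl : IsClosed (Set.range (algebraMap C E)) :=
    (algebraMap_isometry C E).isClosedEmbedding.isClosed_range
  have hmem : a ∈ closure (Set.range (algebraMap C E)) := by
    rw [Metric.mem_closure_iff]
    intro δ δpos
    -- The tolerance on the coefficients which the root estimate turns into exactly `δ`.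
    have hε : (δ / (max ‖a‖ 1)) ^ f.natDegree / (f.natDegree + 1) > 0 := by positivity
    obtain ⟨g, gmon, gdeg, gcoeff⟩ :=
      exists_monic_and_natDegree_eq_and_norm_map_algebraMap_coeff_sub_lt hi fmon hε
    let ⟨b, hb, hab⟩ := exists_aroots_norm_sub_lt_of_norm_coeff_sub_lt
        hε fa0 fmon (gmon.map _) (gdeg ▸ (g.natDegree_map _)) gcoeff
        (by simpa [Polynomial.map_map] using (IsAlgClosed.splits g).map ((algebraMap C E).comp _))
    have hab : ‖a - b‖ < δ := by
      rw [← Real.rpow_natCast, ← mul_comm_div, div_self, one_mul,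
          ← Real.rpow_mul (div_pos δpos (by positivity)).le, mul_inv_cancel₀] at hab
      · simpa [mul_assoc, div_mul_cancel₀ _ (by positivity : (max ‖a‖ 1) > 0).ne'] using hab
      · simp [fnatdeg0]
      · positivity
    rw [Polynomial.aroots_def, Splits.roots_map ((IsAlgClosed.splits g).map _),
        Multiset.mem_map] at hb
    obtain ⟨c, -, hc⟩ := hb
    exact ⟨b, ⟨c, hc⟩, by rwa [dist_eq_norm]⟩
  rw [hcl.closure_eq] at hmem
  obtain ⟨c, hc⟩ := hmem
  refine ⟨c, ?_⟩
  apply (algebraMap C E).injective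
  rw [map_zero, ← fa0, ← hc, aeval_algebraMap_apply, coe_aeval_eq_eval]

variable (k : Type*) [NormedField k]

theorem isUltrametricDist_completion [IsUltrametricDist k] :
    IsUltrametricDist (UniformSpace.Completion k) := by
  refine ⟨fun x y z => ?_⟩
  induction x, y, z using UniformSpace.Completion.induction_on₃ with
  | hp => exact isClosed_le (by fun_prop) (by fun_prop)
  | ih x y z =>
    simp only [UniformSpace.Completion.dist_eq]
    exact dist_triangle_max x y z

theorem isAlgClosed_completion [IsAlgClosed k] [IsUltrametricDist k] {x : k} (hx : 1 < ‖x‖) :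
    IsAlgClosed (UniformSpace.Completion k) := by
  have := isUltrametricDist_completion k
  let inst : NontriviallyNormedField (UniformSpace.Completion k) :=
    { (inferInstance : NormedField (UniformSpace.Completion k)) with
      non_trivial := ⟨x, by rwa [UniformSpace.Completion.norm_coe]⟩ }
  let : Algebra k (UniformSpace.Completion k) :=
    (UniformSpace.Completion.coeRingHom : k →+* UniformSpace.Completion k).toAlgebra
  exact isAlgClosed_of_denseRange_of_isUltrametricDist (k := k)
    (C := UniformSpace.Completion k) UniformSpace.Completion.denseRange_coe

end Completion

/-! ### The Frobenius of a finite field on an algebra -/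

section Frob

variable (F C : Type*) [Field F] [Finite F] [CommRing C] [Algebra F C]

/-- The Frobenius `x ↦ x ^ q` of an algebra over a field with `q` elements. -/
def frob : C →ₐ[F] C :=
  letI := Fintype.ofFinite F
  FiniteField.frobeniusAlgHom F C

variable {C}

@[simp]
theorem frob_apply (x : C) : frob F C x = x ^ Nat.card F := by
  let := Fintype.ofFinite F
  rw [Nat.card_eq_fintype_card]
  rfl

theorem frob_iterate (n : ℕ) (x : C) : (frob F C ^ n) x = x ^ Nat.card F ^ n := by
  induction n with
  | zero => simp
  | succ n ih => rw [pow_succ', AlgHom.mul_apply, ih, frob_apply, ← pow_mul, pow_succ]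

theorem add_pow_card (n : ℕ) (x y : C) :
    (x + y) ^ Nat.card F ^ n = x ^ Nat.card F ^ n + y ^ Nat.card F ^ n := by
  simp only [← frob_iterate, map_add]

theorem sum_pow_card {ι : Type*} (s : Finset ι) (n : ℕ) (f : ι → C) :
    (∑ i ∈ s, f i) ^ Nat.card F ^ n = ∑ i ∈ s, f i ^ Nat.card F ^ n := by
  simp only [← frob_iterate, map_sum]

theorem smul_pow_card (n : ℕ) (c : F) (x : C) :
    (c • x) ^ Nat.card F ^ n = c • x ^ Nat.card F ^ n := by
  simp only [← frob_iterate, map_smul]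

theorem two_le_natCard : 2 ≤ Nat.card F := Finite.one_lt_card

end Frob

/-- The elements of a field extension fixed by the Frobenius are those of the finite field. -/
theorem exists_algebraMap_eq_of_pow_card_eq (F : Type*) {C : Type*} [Field F] [Finite F] [Field C]
    [Algebra F C] {x : C} (hx : x ^ Nat.card F = x) : ∃ c : F, algebraMap F C c = x := by
  classical
  obtain ⟨_⟩ := nonempty_fintype F
  by_contra! hcon
  have hq := two_le_natCard F
  have hqF : ∀ c : F, c ^ Nat.card F = c := fun c => by
    rw [Nat.card_eq_fintype_card]
    exact FiniteField.pow_card c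
  have hqu : (Finset.univ : Finset F).card = Nat.card F := by
    rw [Finset.card_univ, Nat.card_eq_fintype_card]
  generalize Nat.card F = q at *
  -- Together with the `q` elements of `F`, a further fixed element would give this polynomial `q +
  -- 1` roots.
  have hP : (Polynomial.X ^ q - Polynomial.X : Polynomial C) ≠ 0 :=
    FiniteField.X_pow_card_sub_X_ne_zero C hq
  let S : Finset C := insert x (Finset.univ.image (algebraMap F C))
  have hS : S.val ⊆ (Polynomial.X ^ q - Polynomial.X : Polynomial C).roots := by
    intro y hy
    rw [Polynomial.mem_roots hP, Polynomial.IsRoot.def]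
    simp only [Polynomial.eval_sub, Polynomial.eval_pow, Polynomial.eval_X, sub_eq_zero]
    have hy' : y ∈ S := hy
    rw [Finset.mem_insert, Finset.mem_image] at hy'
    obtain rfl | ⟨c, -, rfl⟩ := hy'
    · exact hx
    · rw [← map_pow, hqF]
  have hcard := Polynomial.card_le_degree_of_subset_roots hS
  rw [FiniteField.X_pow_card_sub_X_natDegree_eq C hq, Finset.card_insert_of_notMem,
    Finset.card_image_of_injective _ (algebraMap F C).injective, hqu] at hcard
  · omega
  · simpa using hcon

/-! ### Additive polynomials -/

/-- Lucas's theorem lets one factor `p` be cancelled from both entries at a time. -/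
theorem choose_pow_mul_pow_modEq (p : ℕ) [Fact p.Prime] (v m : ℕ) :
    (p ^ v * m).choose (p ^ v) ≡ m [MOD p] := by
  have hp : 0 < p := (Fact.out : p.Prime).pos
  induction v with
  | zero => simp [Nat.ModEq]
  | succ v ih =>
    have h := Choose.choose_modEq_choose_mod_mul_choose_div_nat (n := p ^ (v + 1) * m)
      (k := p ^ (v + 1)) (p := p)
    rw [pow_succ', mul_assoc, Nat.mul_mod_right, Nat.mul_mod_right, Nat.choose_self, one_mul,
      Nat.mul_div_cancel_left _ hp, Nat.mul_div_cancel_left _ hp] at h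
    rw [pow_succ', mul_assoc]
    exact h.trans ih

/-- If $n=p^vm$ with $p\nmid m$, then $\binom n{p^v}\equiv m\not\equiv0$, which is only allowed when
$p^v=n$. -/
theorem eq_prime_pow_of_dvd_choose {p n : ℕ} [hp : Fact p.Prime] (hn : n ≠ 0)
    (h : ∀ k, 0 < k → k < n → p ∣ n.choose k) : ∃ m, n = p ^ m := by
  obtain ⟨v, m, hm, rfl⟩ := Nat.exists_eq_pow_mul_and_not_dvd hn p hp.out.ne_one
  refine ⟨v, ?_⟩
  by_contra hne
  have hm0 : m ≠ 0 := by rintro rfl; simp at hm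
  have hm1 : m ≠ 1 := by rintro rfl; simp at hne
  have hv : 0 < p ^ v := pow_pos hp.out.pos v
  have h1 := h (p ^ v) hv (lt_mul_of_one_lt_right hv (by omega))
  exact hm ((Nat.ModEq.dvd_iff (choose_pow_mul_pow_modEq p v m) dvd_rfl).mp h1)

/-- With $|F|=p^f$, a generator of $F^\times$ has order $p^f-1$; this divides $p^m-1$, whence $f\mid
m$. -/
theorem exists_pow_card_eq_of_forall_pow_eq (F : Type*) [Field F] [Finite F] (p : ℕ)
    [hp : Fact p.Prime] [CharP F p] {m : ℕ} (h : ∀ c : F, c ^ p ^ m = c) :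
    ∃ j, p ^ m = Nat.card F ^ j := by
  obtain ⟨_⟩ := nonempty_fintype F
  obtain ⟨f, hp', hf⟩ := FiniteField.card F p
  obtain ⟨g, hg⟩ := IsCyclic.exists_generator (α := Fˣ)
  have hord : orderOf g = p ^ (f : ℕ) - 1 := by
    rw [orderOf_eq_card_of_forall_mem_zpowers hg, Nat.card_units, Nat.card_eq_fintype_card, hf]
  have hpos : 0 < p ^ m := pow_pos hp.out.pos m
  have hpow : g ^ (p ^ m - 1) = 1 := by
    have h1 : g ^ p ^ m = g := by
      ext
      simpa using h g
    refine mul_right_cancel (b := g) ?_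
    rw [← pow_succ, Nat.sub_add_cancel hpos, h1, one_mul]
  have hdvd : p ^ (f : ℕ) - 1 ∣ p ^ m - 1 := hord ▸ orderOf_dvd_of_pow_eq_one hpow
  have hgcd := Nat.pow_sub_one_gcd_pow_sub_one p f m
  rw [Nat.gcd_eq_left hdvd] at hgcd
  have h2 : p ^ (f : ℕ) = p ^ (Nat.gcd f m) := by
    have h3 : 0 < p ^ (f : ℕ) := pow_pos hp.out.pos _
    have h4 : 0 < p ^ (Nat.gcd f m) := pow_pos hp.out.pos _
    omega
  have h5 : (f : ℕ) ∣ m := by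
    rw [Nat.pow_right_injective hp.out.two_le h2]
    exact Nat.gcd_dvd_right _ _
  obtain ⟨j, rfl⟩ := h5
  exact ⟨j, by rw [Nat.card_eq_fintype_card, hf, pow_mul]⟩

open Polynomial in
/-- An additive polynomial which is linear over a finite field with `q` elements is a polynomial in
the `q`-power Frobenius. -/
theorem exists_eq_sum_of_additive (F : Type*) {L : Type*} [Field F] [Finite F] [Field L]
    [Algebra F L] (Q : L[X])
    (hadd : aeval (X + C X : L[X][X]) Q = aeval (X : L[X][X]) Q + aeval (C X : L[X][X]) Q)
    (hlin : ∀ c : F, Q.comp (C (algebraMap F L c) * X) = C (algebraMap F L c) * Q) :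
    ∀ n, Q.coeff n ≠ 0 → ∃ j, n = Nat.card F ^ j := by
  obtain ⟨p, hp⟩ := CharP.exists F
  have : Fact p.Prime := ⟨CharP.char_is_prime F p⟩
  have : CharP L p := charP_of_injective_algebraMap (algebraMap F L).injective p
  intro n hn
  have h2 : aeval (X + C X : L[X][X]) Q = taylor X (Q.map C) := by
    rw [taylor_apply, comp, eval₂_map]; rfl
  have h3 : aeval (X : L[X][X]) Q = Q.map C := rfl
  have h4 : aeval (C X : L[X][X]) Q = C Q := by
    have := aeval_algebraMap_apply L[X][X] (X : L[X]) Q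
    rwa [aeval_X_left_apply] at this
  rw [h2, h3, h4] at hadd
  -- Expand $Q(X+Y)=Q(X)+Q(Y)$ in powers of one variable: the coefficients are the Hasse
  -- derivatives, and those of positive order must be constant.
  have h1 : ∀ k, 0 < k → hasseDeriv k Q = C (Q.coeff k) := by
    intro k hk
    have h5 := congrArg (fun g => g.coeff k) hadd
    simp only [coeff_add, taylor_coeff, coeff_map, coeff_C_of_ne_zero hk.ne',
      add_zero] at h5
    have h6 : hasseDeriv k (Q.map (C : L →+* L[X])) = (hasseDeriv k Q).map C := by
      ext1 i
      simp [hasseDeriv_coeff]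
    rw [← h5, h6, Polynomial.eval_map, eval₂_C_X]
  have hn0 : n ≠ 0 := by
    rintro rfl
    apply hn
    have h5 := congrArg (fun g => g.coeff 0) hadd
    simp only [coeff_add, taylor_coeff, hasseDeriv_zero', coeff_map, coeff_C_zero,
      Polynomial.eval_map, eval₂_C_X, right_eq_add] at h5
    simpa using h5
  -- For $0<k<n$ the coefficient of degree $n-k$ of the $k$-th Hasse derivative is $\binom nk$ times
  -- the nonzero coefficient of degree $n$.
  obtain ⟨m, rfl⟩ : ∃ m, n = p ^ m := by
    refine eq_prime_pow_of_dvd_choose hn0 fun k hk hkn => ?_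
    have h2 := congrArg (fun g => g.coeff (n - k)) (h1 k hk)
    simp only [hasseDeriv_coeff, Nat.sub_add_cancel hkn.le] at h2
    rw [coeff_C_of_ne_zero (by omega)] at h2
    rw [← CharP.cast_eq_zero_iff L p]
    exact (mul_eq_zero.mp h2).resolve_right hn
  apply exists_pow_card_eq_of_forall_pow_eq F p
  intro c
  have h3 := congrArg (fun g => g.coeff (p ^ m)) (hlin c)
  simp only [comp_C_mul_X_coeff, coeff_C_mul] at h3
  rw [mul_comm] at h3
  have h4 := mul_right_cancel₀ hn h3
  apply (algebraMap F L).injective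
  rw [map_pow, h4]

/-! ### Morphisms of vector group schemes -/

section Ga

variable {F L : Type u} [Field F] [Field L] [Algebra F L]

/-- The map `(R^d → R^d')`, `x ↦ ∑_{j < N} B_j x^{(q^j)}`. -/
def frobPoly (F : Type*) {L R : Type*} [Field L] [CommRing R] [Algebra L R] {d d' : ℕ} (N : ℕ)
    (B : ℕ → Matrix (Fin d') (Fin d) L) (x : Fin d → R) : Fin d' → R :=
  fun k => ∑ j ∈ Finset.range N, ∑ i, algebraMap L R (B j k i) * x i ^ Nat.card F ^ j

theorem gaCoord_app_add {d d' : ℕ} (f : Ga F L d ⟶ Ga F L d') (R : CommAlgCat.{u} L)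
    (x y : Fin d → R) :
    gaCoord (F := F) ((f.app R).hom (x + y : Fin d → R)) =
      gaCoord (F := F) ((f.app R).hom x) + gaCoord (F := F) ((f.app R).hom y) :=
  (f.app R).hom.map_add x y

theorem gaCoord_app_smul {d d' : ℕ} (f : Ga F L d ⟶ Ga F L d') (R : CommAlgCat.{u} L)
    (c : F) (x : Fin d → R) :
    gaCoord (F := F) ((f.app R).hom (algebraMap F L c • x : Fin d → R)) =
      algebraMap F L c • gaCoord (F := F) ((f.app R).hom x) :=
  (f.app R).hom.map_smul c x

theorem gaCoord_app_map {d d' : ℕ} (f : Ga F L d ⟶ Ga F L d') {R S : CommAlgCat.{u} L}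
    (g : R ⟶ S) (x : Fin d → R) :
    gaCoord (F := F) ((f.app S).hom (fun i => g.hom (x i))) =
      fun k => g.hom (gaCoord (F := F) ((f.app R).hom x) k) :=
  congrArg (fun h => gaCoord (F := F) (h.hom x)) (f.naturality g)

theorem gaCoord_app_sum {d d' : ℕ} (f : Ga F L d ⟶ Ga F L d') (R : CommAlgCat.{u} L)
    (x : Fin d → R) :
    gaCoord (F := F) ((f.app R).hom x) =
      ∑ i, gaCoord (F := F) ((f.app R).hom (Pi.single i (x i) : Fin d → R)) := by
  let h : (Fin d → R) →+ (Fin d' → R) := AddMonoidHom.mk'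
    (fun x => gaCoord (F := F) ((f.app R).hom x)) (gaCoord_app_add f R)
  change h x = ∑ i, h (Pi.single i (x i))
  rw [← map_sum, Finset.univ_sum_single]

open Polynomial in
/-- The polynomial describing the `(i, k)` entry of a morphism of additive group schemes. -/
def gaEntry {d d' : ℕ} (f : Ga F L d ⟶ Ga F L d') (i : Fin d) (k : Fin d') : L[X] :=
  gaCoord (F := F) ((f.app (CommAlgCat.of L L[X])).hom (Pi.single i X : Fin d → L[X])) k

-- Yoneda: the point `y` is the image of the universal point `X` under evaluation at `y`.
open Polynomial in
theorem gaCoord_app_single {d d' : ℕ} (f : Ga F L d ⟶ Ga F L d') (R : Type u) [CommRing R]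
    [Algebra L R] (i : Fin d) (k : Fin d') (y : R) :
    gaCoord (F := F) ((f.app (CommAlgCat.of L R)).hom (Pi.single i y : Fin d → R)) k =
      aeval y (gaEntry f i k) := by
  have h := gaCoord_app_map f (R := CommAlgCat.of L L[X]) (S := CommAlgCat.of L R)
    (CommAlgCat.ofHom (aeval y)) (Pi.single i X : Fin d → L[X])
  have h2 : (fun j => (CommAlgCat.ofHom (aeval y) :
      CommAlgCat.of L L[X] ⟶ CommAlgCat.of L R).hom ((Pi.single i X : Fin d → L[X]) j)) =
      (Pi.single i y : Fin d → R) := by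
    funext j
    change aeval y ((Pi.single i X : Fin d → L[X]) j) = _
    rcases eq_or_ne j i with rfl | hj
    · simp
    · simp [Pi.single_eq_of_ne hj]
  rw [h2] at h
  exact congrFun h k

open Polynomial in
theorem gaEntry_coeff_ne_zero [Finite F] {d d' : ℕ} (f : Ga F L d ⟶ Ga F L d') (i : Fin d)
    (k : Fin d') {n : ℕ} (hn : (gaEntry f i k).coeff n ≠ 0) : ∃ j, n = Nat.card F ^ j := by
  refine exists_eq_sum_of_additive F _ ?_ ?_ n hn
  · have h := congrFun (gaCoord_app_add f (CommAlgCat.of L L[X][X])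
      (Pi.single i X : Fin d → L[X][X]) (Pi.single i (C X) : Fin d → L[X][X])) k
    rw [← gaCoord_app_single f, ← gaCoord_app_single f, ← gaCoord_app_single f, Pi.single_add]
    exact h
  · intro c
    have h := congrFun (gaCoord_app_smul f (CommAlgCat.of L L[X]) c
      (Pi.single i X : Fin d → L[X])) k
    have h2 : (algebraMap F L c • (Pi.single i X : Fin d → L[X]) : Fin d → L[X]) =
        Pi.single i (C (algebraMap F L c) * X) := by
      rw [← Pi.single_smul, smul_eq_C_mul]
    have h3 := gaCoord_app_single f L[X] i k (C (algebraMap F L c) * X)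
    rw [comp_eq_aeval, ← h3, ← h2]
    refine h.trans ?_
    rw [Pi.smul_apply, smul_eq_C_mul]
    rfl

open Polynomial in
/-- Morphisms between powers of the additive group are given by polynomials in the Frobenius. -/
theorem exists_frobPoly [Finite F] {d d' : ℕ} (f : Ga F L d ⟶ Ga F L d') :
    ∃ (N : ℕ) (B : ℕ → Matrix (Fin d') (Fin d) L), ∀ (R : Type u) [CommRing R] [Algebra L R]
      (x : Fin d → R), gaCoord (F := F) ((f.app (CommAlgCat.of L R)).hom x) =
        frobPoly F (N + 1) B x := by
  classical
  -- A crude common bound for the degrees, sufficient since $N<q^{N+1}$. The length `N + 1`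
  -- guarantees that the linear term `B 0` is always part of the sum.
  let N := ∑ i, ∑ k, (gaEntry f i k).natDegree
  have hN : ∀ i k, (gaEntry f i k).natDegree ≤ N := fun i k =>
    (Finset.single_le_sum (f := fun k => (gaEntry f i k).natDegree) (by simp)
      (Finset.mem_univ k)).trans (Finset.single_le_sum
        (f := fun i => ∑ k, (gaEntry f i k).natDegree) (by simp) (Finset.mem_univ i))
  refine ⟨N, fun j => Matrix.of fun k i => (gaEntry f i k).coeff (Nat.card F ^ j), ?_⟩
  intro R _ _ x
  rw [gaCoord_app_sum]
  funext k
  rw [Finset.sum_apply, frobPoly, Finset.sum_comm]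
  refine Finset.sum_congr rfl fun i _ => ?_
  have hq := two_le_natCard F
  have hlt : (gaEntry f i k).natDegree < Nat.card F ^ (N + 1) :=
    (hN i k).trans_lt ((Nat.lt_succ_self N).trans (Nat.lt_pow_self hq))
  refine (gaCoord_app_single f R i k (x i)).trans ?_
  rw [aeval_eq_sum_range' hlt]
  simp only [Matrix.of_apply]
  have hinj : Set.InjOn (fun j => Nat.card F ^ j) (Finset.range (N + 1)) :=
    (Nat.pow_right_injective hq).injOn
  rw [← Finset.sum_image (s := Finset.range (N + 1)) (g := fun j => Nat.card F ^ j)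
    (f := fun n => algebraMap L R ((gaEntry f i k).coeff n) * x i ^ n) hinj]
  symm
  simp only [Algebra.smul_def]
  refine Finset.sum_subset ?_ ?_
  · intro n hn
    obtain ⟨j, hj, rfl⟩ := Finset.mem_image.mp hn
    exact Finset.mem_range.mpr (Nat.pow_lt_pow_right hq (Finset.mem_range.mp hj))
  · intro n hn hn'
    by_contra hne
    have hc : (gaEntry f i k).coeff n ≠ 0 := by
      intro h0
      rw [h0, map_zero, zero_mul] at hne
      exact hne rfl
    obtain ⟨j, rfl⟩ := gaEntry_coeff_ne_zero f i k hc
    refine hn' (Finset.mem_image.mpr ⟨j, ?_, rfl⟩)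
    exact Finset.mem_range.mpr ((Nat.pow_lt_pow_iff_right hq).mp (Finset.mem_range.mp hn))

end Ga

/-! ### Lie algebras in coordinates -/

section Lie

variable {F L : Type u} [Field F] [Field L]
variable {U V W : CommAlgCat.{u} L ⥤ ModuleCat.{u} F} (R : Type u) [CommRing R] [Algebra L R]

theorem lieMap_comp (f : U ⟶ V) (g : V ⟶ W) :
    lieMap (f ≫ g) R = (lieMap g R).comp (lieMap f R) := rfl

theorem lieMap_lieScale (f : U ⟶ V) (r : R) (x : lieAlg U R) :
    lieMap f R (lieScale U r x) = lieScale V r (lieMap f R x) :=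
  Subtype.ext (congrArg (fun h => h.hom x.1) (f.naturality (CommAlgCat.ofHom (scaleEps L r))))

/-- The isomorphism of Lie algebras induced by an isomorphism. -/
def lieEquiv (κ : U ≅ V) : lieAlg U R ≃+ lieAlg V R where
  toFun := lieMap κ.hom R
  invFun := lieMap κ.inv R
  left_inv x := by
    rw [← LinearMap.comp_apply, ← lieMap_comp, κ.hom_inv_id]; rfl
  right_inv x := by
    rw [← LinearMap.comp_apply, ← lieMap_comp, κ.inv_hom_id]; rfl
  map_add' := map_add _

variable [Algebra F L] {d : ℕ}

theorem fst_gaCoord (x : lieAlg (Ga F L d) R) (i : Fin d) :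
    TrivSqZeroExt.fst (gaCoord x.1 i : DualNumber R) = 0 :=
  congrFun x.2 i

/-- The coordinates on the Lie algebra of a power of the additive group. -/
def gaLieEquiv : lieAlg (Ga F L d) R ≃+ (Fin d → R) where
  toFun := gaLieCoord
  invFun v := ⟨(fun i => TrivSqZeroExt.inr (v i) : Fin d → DualNumber R),
    funext fun i => TrivSqZeroExt.fst_inr R (v i)⟩
  left_inv x := by
    refine Subtype.ext (funext fun i => ?_)
    exact TrivSqZeroExt.ext (fst_gaCoord R x i).symm rfl
  right_inv v := rfl
  map_add' x y := rfl

@[simp]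
theorem gaLieCoord_lieScale (r : R) (x : lieAlg (Ga F L d) R) :
    gaLieCoord (lieScale (Ga F L d) r x) = r • gaLieCoord x :=
  funext fun i => TrivSqZeroExt.snd_map (r • (LinearMap.id : R →ₗ[R] R)) (gaCoord x.1 i)

/-- A multiple of `ε` has square zero, so its `q ^ j`-th powers vanish for `j ≥ 1` and only the
linear term of the morphism survives. -/
theorem gaLieCoord_lieMap [Finite F] {d' : ℕ} (f : Ga F L d ⟶ Ga F L d') {N : ℕ}
    {B : ℕ → Matrix (Fin d') (Fin d) L}
    (hB : ∀ (R : Type u) [CommRing R] [Algebra L R] (x : Fin d → R),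
      gaCoord (F := F) ((f.app (CommAlgCat.of L R)).hom x) = frobPoly F (N + 1) B x)
    (x : lieAlg (Ga F L d) R) :
    gaLieCoord (lieMap f R x) = ((B 0).map (algebraMap L R)).mulVec (gaLieCoord x) := by
  funext k
  have h := congrFun (hB (DualNumber R) x.1) k
  have h0 : ∀ (j : ℕ) (i : Fin d), (gaCoord x.1 i : DualNumber R) ^ Nat.card F ^ (j + 1) = 0 := by
    intro j i
    have h1 : (gaCoord x.1 i : DualNumber R) ^ 2 = 0 := by
      rw [pow_two]
      exact TrivSqZeroExt.ext (by simp [fst_gaCoord]) (by simp [fst_gaCoord])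
    refine pow_eq_zero_of_le ?_ h1
    calc 2 ≤ Nat.card F := two_le_natCard F
      _ ≤ Nat.card F ^ (j + 1) := Nat.le_self_pow (by omega) _
  have h2 : gaLieCoord (lieMap f R x) k = TrivSqZeroExt.snd
      (frobPoly F (N + 1) B (gaCoord x.1 : Fin d → DualNumber R) k) :=
    congrArg TrivSqZeroExt.snd h
  rw [h2, frobPoly, Finset.sum_range_succ', Finset.sum_eq_zero]
  · rw [zero_add, TrivSqZeroExt.snd_sum]
    refine Finset.sum_congr rfl fun i _ => ?_
    simp [TrivSqZeroExt.algebraMap_eq_inl', gaLieCoord, Matrix.map_apply]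
  · intro j _
    refine Finset.sum_eq_zero fun i _ => ?_
    have := h0 j i
    rw [gaCoord] at this
    rw [gaCoord, this, mul_zero]

end Lie

/-! ### Series in the Frobenius over a non-archimedean field -/

section FrobVec

/-- Raising all coordinates to the power `q ^ n`. -/
def frobVec (F : Type*) {C : Type*} [Monoid C] {d : ℕ} (n : ℕ) (x : Fin d → C) : Fin d → C :=
  fun i => x i ^ Nat.card F ^ n

section Monoid

variable (F : Type*) {C : Type*} [CommMonoid C] {d : ℕ}

theorem frobVec_zero_left (x : Fin d → C) : frobVec F 0 x = x := by
  funext i; simp [frobVec]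

theorem frobVec_smul (n : ℕ) (c : C) (x : Fin d → C) :
    frobVec F n (c • x) = c ^ Nat.card F ^ n • frobVec F n x := by
  funext i
  simp [frobVec, mul_pow]

theorem frobVec_frobVec (m n : ℕ) (x : Fin d → C) :
    frobVec F m (frobVec F n x) = frobVec F (n + m) x := by
  funext i
  simp [frobVec, ← pow_mul, pow_add]

end Monoid

/-- The polynomial in the Frobenius with given matrix coefficients. -/
def frobSum (F : Type*) {C : Type*} [CommRing C] {d d' : ℕ} (N : ℕ) (B : ℕ → Matrix (Fin d') (Fin d) C) (x : Fin d → C) : Fin d' → C :=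
  ∑ j ∈ Finset.range N, (B j).mulVec (frobVec F j x)

section Algebra

variable (F : Type*) {C : Type*} [Field F] [Finite F] [CommRing C] [Algebra F C] {d : ℕ}

theorem frobVec_add (n : ℕ) (x y : Fin d → C) :
    frobVec F n (x + y) = frobVec F n x + frobVec F n y :=
  funext fun i => add_pow_card F n (x i) (y i)

theorem frobVec_mulVec {d' : ℕ} (n : ℕ) (B : Matrix (Fin d') (Fin d) C) (x : Fin d → C) :
    frobVec F n (B.mulVec x) = (B.map (· ^ Nat.card F ^ n)).mulVec (frobVec F n x) := by
  funext i
  simp [frobVec, Matrix.mulVec, dotProduct, sum_pow_card, mul_pow]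

theorem frobSum_add {d' : ℕ} (N : ℕ) (B : ℕ → Matrix (Fin d') (Fin d) C) (x y : Fin d → C) :
    frobSum F N B (x + y) = frobSum F N B x + frobSum F N B y := by
  simp only [frobSum, frobVec_add, Matrix.mulVec_add, Finset.sum_add_distrib]

end Algebra

section Normed

attribute [local instance] Matrix.normedAddCommGroup

theorem continuous_frobVec (F : Type*) {C : Type*} [NormedField C] {d : ℕ} (n : ℕ) : Continuous (frobVec F n : (Fin d → C) → (Fin d → C)) := by
  unfold frobVec
  fun_prop

theorem norm_matrix_map_pow_le (F : Type*) {C : Type*} [NormedField C] {d : ℕ}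
    (B : Matrix (Fin d) (Fin d) C) (n : ℕ) :
    ‖B.map (· ^ Nat.card F ^ n)‖ ≤ ‖B‖ ^ Nat.card F ^ n := by
  refine (Matrix.norm_le_iff (by positivity)).mpr fun i k => ?_
  rw [Matrix.map_apply, norm_pow]
  exact pow_le_pow_left₀ (norm_nonneg _) (Matrix.norm_entry_le_entrywise_sup_norm B) _

variable (F : Type*) {C : Type*} [Field F] [Finite F] [NormedField C] {d d' : ℕ}

theorem norm_frobVec (n : ℕ) (x : Fin d → C) : ‖frobVec F n x‖ = ‖x‖ ^ Nat.card F ^ n := by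
  have hq : Nat.card F ^ n ≠ 0 := pow_ne_zero _ (two_le_natCard F |>.trans_lt' zero_lt_two).ne'
  apply le_antisymm
  · refine (pi_norm_le_iff_of_nonneg (by positivity)).mpr fun i => ?_
    rw [frobVec, norm_pow]
    exact pow_le_pow_left₀ (norm_nonneg _) (norm_le_pi_norm x i) _
  · rcases isEmpty_or_nonempty (Fin d) with h | h
    · rw [Subsingleton.elim x 0, norm_zero, zero_pow hq]; exact norm_nonneg _
    · obtain ⟨i, hi⟩ := Finite.exists_max fun i => ‖x i‖
      have : ‖x‖ = ‖x i‖ := le_antisymm ((pi_norm_le_iff_of_nonneg (norm_nonneg _)).mpr hi)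
        (norm_le_pi_norm x i)
      rw [this, ← norm_pow]
      exact norm_le_pi_norm (frobVec F n x) i

theorem two_le_pow_card (n : ℕ) : 2 ≤ Nat.card F ^ (n + 1) :=
  (two_le_natCard F).trans (Nat.le_self_pow (by omega) _)

theorem pow_card_le_sq {r : ℝ} (h0 : 0 ≤ r) (h1 : r ≤ 1) (n : ℕ) :
    r ^ Nat.card F ^ (n + 1) ≤ r ^ 2 :=
  pow_le_pow_of_le_one h0 h1 (two_le_pow_card F n)

variable [IsUltrametricDist C]

theorem norm_mulVec_le_of_isUltrametricDist (B : Matrix (Fin d') (Fin d) C) (x : Fin d → C) :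
    ‖B.mulVec x‖ ≤ ‖B‖ * ‖x‖ := by
  have h0 : 0 ≤ ‖B‖ * ‖x‖ := mul_nonneg (norm_nonneg _) (norm_nonneg _)
  refine (pi_norm_le_iff_of_nonneg h0).mpr fun i => ?_
  change ‖∑ j, B i j * x j‖ ≤ _
  refine IsUltrametricDist.norm_sum_le_of_forall_le_of_nonneg h0 fun j _ => ?_
  rw [norm_mul]
  exact mul_le_mul (Matrix.norm_entry_le_entrywise_sup_norm B) (norm_le_pi_norm x j)
    (norm_nonneg _) (norm_nonneg _)

theorem norm_matrix_mul_le_of_isUltrametricDist (B B' : Matrix (Fin d) (Fin d) C) :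
    ‖B * B'‖ ≤ ‖B‖ * ‖B'‖ := by
  have h0 : 0 ≤ ‖B‖ * ‖B'‖ := mul_nonneg (norm_nonneg _) (norm_nonneg _)
  refine (Matrix.norm_le_iff h0).mpr fun i k => ?_
  change ‖∑ j, B i j * B' j k‖ ≤ _
  refine IsUltrametricDist.norm_sum_le_of_forall_le_of_nonneg h0 fun j _ => ?_
  rw [norm_mul]
  exact mul_le_mul (Matrix.norm_entry_le_entrywise_sup_norm B)
    (Matrix.norm_entry_le_entrywise_sup_norm B') (norm_nonneg _) (norm_nonneg _)

/-- A polynomial in the Frobenius is approximated by its linear part to second order. -/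
theorem exists_norm_frobSum_sub_le (N : ℕ) (B : ℕ → Matrix (Fin d') (Fin d) C) :
    ∃ c : ℝ, 0 ≤ c ∧ ∀ x : Fin d → C, ‖x‖ ≤ 1 →
      ‖frobSum F (N + 1) B x - (B 0).mulVec x‖ ≤ c * ‖x‖ ^ 2 := by
  refine ⟨∑ j ∈ Finset.range N, ‖B (j + 1)‖, Finset.sum_nonneg fun _ _ => norm_nonneg _,
    fun x hx => ?_⟩
  rw [frobSum, Finset.sum_range_succ', frobVec_zero_left, add_sub_cancel_right, Finset.sum_mul]
  refine (norm_sum_le _ _).trans (Finset.sum_le_sum fun j _ => ?_)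
  refine (norm_mulVec_le_of_isUltrametricDist _ _).trans ?_
  rw [norm_frobVec]
  exact mul_le_mul_of_nonneg_left (pow_card_le_sq F (norm_nonneg _) hx j) (norm_nonneg _)

/-- An everywhere convergent series in the Frobenius is approximated by its linear part to second
order. -/
theorem exists_norm_series_sub_le {e : ℕ → Matrix (Fin d) (Fin d) C}
    {f : (Fin d → C) → (Fin d → C)}
    (hf : ∀ x, HasSum (fun n => (e n).mulVec (frobVec F n x)) (f x)) :
    ∃ c : ℝ, 0 ≤ c ∧ ∀ x : Fin d → C, ‖x‖ ≤ 1 → ‖f x - (e 0).mulVec x‖ ≤ c * ‖x‖ ^ 2 := by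
  -- The standard basis vectors are fixed by the Frobenius; convergence there makes every entry of
  -- `e n` tend to zero.
  have hbd : ∃ c : ℝ, ∀ n, ‖e n‖ ≤ c := by
    have h1 : ∀ i k, ∃ c : ℝ, ∀ n, ‖e n i k‖ ≤ c := by
      intro i k
      have h2 := (hf (Pi.single k 1)).summable.tendsto_atTop_zero
      have h3 : Filter.Tendsto (fun n => ‖e n i k‖) Filter.atTop (nhds 0) := by
        have h4 := ((continuous_apply i).tendsto _).comp h2
        have h5 := h4.norm
        simp only [Pi.zero_apply, norm_zero] at h5
        refine h5.congr fun n => ?_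
        have : frobVec F n (Pi.single k 1 : Fin d → C) = Pi.single k 1 := by
          funext l
          rcases eq_or_ne l k with rfl | hl
          · simp [frobVec]
          · simp [frobVec, Pi.single_eq_of_ne hl, (two_le_natCard F).trans_lt' zero_lt_two |>.ne']
        simp [this]
      obtain ⟨c, hc⟩ := h3.bddAbove_range
      exact ⟨c, fun n => hc ⟨n, rfl⟩⟩
    choose c hc using h1
    refine ⟨∑ i, ∑ k, |c i k|, fun n => ?_⟩
    refine (Matrix.norm_le_iff (by positivity)).mpr fun i k => ?_
    refine (hc i k n).trans ((le_abs_self _).trans ?_)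
    exact (Finset.single_le_sum (f := fun k => |c i k|) (fun _ _ => abs_nonneg _)
      (Finset.mem_univ k)).trans (Finset.single_le_sum (f := fun i => ∑ k, |c i k|)
        (fun _ _ => Finset.sum_nonneg fun _ _ => abs_nonneg _) (Finset.mem_univ i))
  obtain ⟨c, hc⟩ := hbd
  have hc0 : 0 ≤ c := (norm_nonneg _).trans (hc 0)
  refine ⟨c, hc0, fun x hx => ?_⟩
  have h1 := (hasSum_nat_add_iff' 1).mpr (hf x)
  rw [Finset.sum_range_one, frobVec_zero_left] at h1
  have hcl : IsClosed {y : Fin d → C | ‖y‖ ≤ c * ‖x‖ ^ 2} :=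
    isClosed_le continuous_norm continuous_const
  refine hcl.mem_of_tendsto h1 (Filter.Eventually.of_forall fun s => ?_)
  refine IsUltrametricDist.norm_sum_le_of_forall_le_of_nonneg (by positivity) fun n _ => ?_
  refine (norm_mulVec_le_of_isUltrametricDist _ _).trans ?_
  rw [norm_frobVec]
  exact mul_le_mul (hc _) (pow_card_le_sq F (norm_nonneg _) hx n) (by positivity) hc0

/-- A polynomial in the Frobenius with linear part `θ` expands small vectors at most by `‖θ‖`. -/
theorem exists_norm_iterate_le {θ : C} (hθ : 1 < ‖θ‖) {φ : (Fin d → C) → (Fin d → C)} {c : ℝ}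
    (hc : 0 ≤ c) (hφ : ∀ x, ‖x‖ ≤ 1 → ‖φ x - θ • x‖ ≤ c * ‖x‖ ^ 2) :
    ∃ ρ : ℝ, 0 < ρ ∧ ∀ n x, ‖θ‖ ^ n * ‖x‖ ≤ ρ → ‖φ^[n] x‖ ≤ ‖θ‖ ^ n * ‖x‖ := by
  have hθ0 : 0 < ‖θ‖ := zero_lt_one.trans hθ
  -- On this ball the quadratic error is at most `‖θ‖ * ‖x‖`, so by the ultrametric inequality it
  -- does not spoil the bound for the linear part.
  refine ⟨min 1 (‖θ‖ / (c + 1)), lt_min one_pos (by positivity), ?_⟩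
  have step : ∀ x, ‖x‖ ≤ min 1 (‖θ‖ / (c + 1)) → ‖φ x‖ ≤ ‖θ‖ * ‖x‖ := by
    intro x hx
    have h1 : ‖x‖ ≤ 1 := hx.trans (min_le_left _ _)
    have h2 : ‖x‖ * (c + 1) ≤ ‖θ‖ := (le_div_iff₀ (by positivity)).mp (hx.trans (min_le_right _ _))
    have h3 : φ x = (φ x - θ • x) + θ • x := by abel
    rw [h3]
    refine (IsUltrametricDist.norm_add_le_max _ _).trans (max_le ((hφ x h1).trans ?_) ?_)
    · nlinarith [norm_nonneg x]
    · rw [norm_smul]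
  intro n x hx
  induction n with
  | zero => simp
  | succ n ih =>
    have h1 : ‖θ‖ ^ n * ‖x‖ ≤ ‖θ‖ ^ (n + 1) * ‖x‖ :=
      mul_le_mul_of_nonneg_right (pow_le_pow_right₀ hθ.le (Nat.le_succ n)) (norm_nonneg _)
    have h2 := ih (h1.trans hx)
    rw [Function.iterate_succ_apply']
    refine (step _ (h2.trans (h1.trans hx))).trans ?_
    rw [pow_succ', mul_assoc]
    exact mul_le_mul_of_nonneg_left h2 hθ0.le

/-- A map which intertwines `θ` with `φ` and vanishes to second order at the origin is zero. -/
theorem eq_zero_of_intertwines {θ : C} (hθ : 1 < ‖θ‖) {φ : (Fin d → C) → (Fin d → C)} {c : ℝ}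
    (hc : 0 ≤ c) (hφ : ∀ x, ‖x‖ ≤ 1 → ‖φ x - θ • x‖ ≤ c * ‖x‖ ^ 2)
    {G : (Fin d → C) → (Fin d → C)} (hG : ∀ x, G (θ • x) = φ (G x)) {c' r : ℝ}
    (hr : 0 < r) (hG' : ∀ x, ‖x‖ ≤ r → ‖G x‖ ≤ c' * ‖x‖ ^ 2) (x : Fin d → C) : G x = 0 := by
  obtain ⟨ρ, hρ, hiter⟩ := exists_norm_iterate_le hθ hc hφ
  have hθ0 : 0 < ‖θ‖ := zero_lt_one.trans hθ
  have hθne : θ ≠ 0 := norm_pos_iff.mp hθ0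
  have hGn : ∀ n y, G (θ ^ n • y) = φ^[n] (G y) := by
    intro n y
    induction n generalizing y with
    | zero => simp
    | succ n ih => rw [pow_succ, mul_smul, ih, hG, Function.iterate_succ_apply]
  have hlim : Filter.Tendsto (fun n : ℕ => (‖θ‖⁻¹) ^ n) Filter.atTop (nhds 0) :=
    tendsto_pow_atTop_nhds_zero_of_lt_one (by positivity) (inv_lt_one_of_one_lt₀ hθ)
  have h1 : Filter.Tendsto (fun n : ℕ => (‖θ‖⁻¹) ^ n * ‖x‖) Filter.atTop (nhds 0) := by
    simpa using hlim.mul_const ‖x‖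
  have h2 : Filter.Tendsto (fun n : ℕ => (‖θ‖⁻¹) ^ n * (c' * ‖x‖ ^ 2)) Filter.atTop (nhds 0) := by
    simpa using hlim.mul_const (c' * ‖x‖ ^ 2)
  -- Write $G(x)=\varphi^n(G(\theta^{-n}x))$. The inner value is $O(|\theta|^{-2n})$ and $\varphi^n$
  -- expands by at most $|\theta|^n$, leaving $O(|\theta|^{-n})$.
  have h3 : ∀ᶠ n : ℕ in Filter.atTop, ‖G x‖ ≤ (‖θ‖⁻¹) ^ n * (c' * ‖x‖ ^ 2) := by
    filter_upwards [h1.eventually_le_const hr, h2.eventually_le_const hρ] with n hn1 hn2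
    have hx : x = θ ^ n • ((θ⁻¹) ^ n • x) := by
      rw [smul_smul, ← mul_pow, mul_inv_cancel₀ hθne, one_pow, one_smul]
    have hnorm : ‖(θ⁻¹) ^ n • x‖ = (‖θ‖⁻¹) ^ n * ‖x‖ := by rw [norm_smul, norm_pow, norm_inv]
    have hb := hG' ((θ⁻¹) ^ n • x) (by rw [hnorm]; exact hn1)
    have hb2 : ‖θ‖ ^ n * ‖G ((θ⁻¹) ^ n • x)‖ ≤ (‖θ‖⁻¹) ^ n * (c' * ‖x‖ ^ 2) := by
      refine (mul_le_mul_of_nonneg_left hb (by positivity)).trans (le_of_eq ?_)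
      rw [hnorm]
      have : ‖θ‖ ^ n * (‖θ‖⁻¹) ^ n = 1 := by rw [← mul_pow, mul_inv_cancel₀ hθ0.ne', one_pow]
      linear_combination ((‖θ‖⁻¹) ^ n * (c' * ‖x‖ ^ 2)) * this
    rw [hx, hGn]
    exact (hiter n _ (hb2.trans hn2)).trans (by rw [← hx]; exact hb2)
  have h4 := ge_of_tendsto h2 h3
  exact norm_le_zero_iff.mp h4

end Normed

end FrobVec

/-! ### Construction and convergence of the exponential series -/

section ExpConstruction

attribute [local instance] Matrix.normedAddCommGroup

theorem norm_matrix_smul {C : Type*} [NormedField C] {d : ℕ} (c : C) (M : Matrix (Fin d) (Fin d) C) : ‖c • M‖ = ‖c‖ * ‖M‖ := by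
  let := Matrix.normedSpace (R := C) (α := C) (m := Fin d) (n := Fin d)
  exact norm_smul c M

theorem HasSum.frobVec {F C : Type*} [Field F] [Finite F] [NormedField C] [Algebra F C] {d : ℕ}
    {f : ℕ → Fin d → C} {s : Fin d → C} (h : HasSum f s) (j : ℕ) :
    HasSum (fun n => frobVec F j (f n)) (frobVec F j s) :=
  h.map (AddMonoidHom.mk' (_root_.frobVec F j) (frobVec_add F j)) (continuous_frobVec F j)

theorem HasSum.mulVec {C : Type*} [NormedField C] {d : ℕ} {f : ℕ → Fin d → C} {s : Fin d → C} (h : HasSum f s)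
    (M : Matrix (Fin d) (Fin d) C) : HasSum (fun n => M.mulVec (f n)) (M.mulVec s) :=
  h.map (AddMonoidHom.mk' M.mulVec (M.mulVec_add)) (by
    exact Continuous.matrix_mulVec continuous_const continuous_id)

/-- Substitution of a convergent series in the Frobenius into a polynomial in the Frobenius. -/
theorem HasSum.frobSum {F C : Type*} [Field F] [Finite F] [NormedField C] [Algebra F C] {d : ℕ}
    {B e : ℕ → Matrix (Fin d) (Fin d) C} {x s : Fin d → C}
    (hs : HasSum (fun n => (e n).mulVec (_root_.frobVec F n x)) s)
    {N : ℕ} (hB : ∀ j, N < j → B j = 0) :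
    HasSum (fun n => (∑ j ∈ Finset.range (n + 1),
      B j * (e (n - j)).map (· ^ Nat.card F ^ j)).mulVec (_root_.frobVec F n x))
      (_root_.frobSum F (N + 1) B s) := by
  -- The contribution of `B j` in Frobenius degree `n`: each row is the original series transformed
  -- and shifted by `j`, hence converges on its own.
  let g : ℕ → ℕ → Fin d → C := fun j n => if j ≤ n then
    (B j * (e (n - j)).map (· ^ Nat.card F ^ j)).mulVec (_root_.frobVec F n x) else 0
  have h1 : ∀ j, HasSum (g j) ((B j).mulVec (_root_.frobVec F j s)) := by
    intro j
    have h2 := (hs.frobVec (F := F) j).mulVec (B j)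
    simp only [frobVec_mulVec, frobVec_frobVec, Matrix.mulVec_mulVec] at h2
    have hinj : Function.Injective fun n : ℕ => n + j := fun a b h => Nat.add_right_cancel h
    refine (hinj.hasSum_iff (f := g j) ?_).mp ?_
    · intro n hn
      refine if_neg fun hjn => hn ⟨n - j, by simp [Nat.sub_add_cancel hjn]⟩
    · convert! h2 using 2 with n
      simp [g]
  have h3 : HasSum (fun n => ∑ j ∈ Finset.range (N + 1), g j n)
      (_root_.frobSum F (N + 1) B s) := hasSum_sum fun j _ => h1 j
  convert! h3 using 2 with n
  have hg : ∀ M, N ≤ M → ∑ j ∈ Finset.range (N + 1), g j n = ∑ j ∈ Finset.range (M + 1), g j n := by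
    intro M hM
    refine Finset.sum_subset (Finset.range_mono (by omega)) fun j _ hj => ?_
    have : B j = 0 := hB j (by simpa using hj)
    simp [g, this]
  have hg' : ∀ M, n ≤ M → ∑ j ∈ Finset.range (n + 1), g j n = ∑ j ∈ Finset.range (M + 1), g j n := by
    intro M hM
    refine Finset.sum_subset (Finset.range_mono (by omega)) fun j _ hj => ?_
    exact if_neg (by simpa using hj)
  rw [hg (N + n) (by omega), ← hg' (N + n) (by omega), Matrix.sum_mulVec]
  exact Finset.sum_congr rfl fun j hj =>
    (if_pos (Nat.lt_succ_iff.mp (Finset.mem_range.mp hj))).symm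

/-- The coefficients of the series `exp` with `exp (θ x) = φ (exp x)`, for a polynomial `φ` in the
Frobenius with linear part `θ` and higher coefficients `B j`. -/
def expCoeff (F : Type*) {C : Type*} [NormedField C] {d : ℕ} (θ : C) (B : ℕ → Matrix (Fin d) (Fin d) C) : ℕ → Matrix (Fin d) (Fin d) C
  | 0 => 1
  | n + 1 => (θ ^ Nat.card F ^ (n + 1) - θ)⁻¹ • ∑ j : Fin (n + 1),
      B (j + 1) * (expCoeff F θ B (n - j)).map (· ^ Nat.card F ^ ((j : ℕ) + 1))
  decreasing_by omega

theorem expCoeff_zero {F C : Type*} [NormedField C] {d : ℕ} {θ : C}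
    {B : ℕ → Matrix (Fin d) (Fin d) C} : expCoeff F θ B 0 = 1 := by rw [expCoeff]

variable {F C : Type*} [Field F] [Finite F] [NormedField C] {d : ℕ}
  {θ : C} {B : ℕ → Matrix (Fin d) (Fin d) C}

variable [IsUltrametricDist C]

theorem norm_pow_card_sub (hθ : 1 < ‖θ‖) (n : ℕ) :
    ‖θ ^ Nat.card F ^ (n + 1) - θ‖ = ‖θ‖ ^ Nat.card F ^ (n + 1) := by
  have h1 : ‖θ‖ < ‖θ ^ Nat.card F ^ (n + 1)‖ := by
    rw [norm_pow]
    exact lt_self_pow₀ hθ ((two_le_pow_card F n).trans_lt' one_lt_two)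
  rw [sub_eq_add_neg, IsUltrametricDist.norm_add_eq_max_of_norm_ne_norm (by rw [norm_neg]; exact h1.ne'),
    norm_neg, max_eq_left h1.le, norm_pow]

/-- The recursion cleared of its denominator, which is nonzero because
$|\theta^{q^{n+1}}|>|\theta|$. It is the comparison of coefficients in $\exp(\theta x)=\varphi(\exp
x)$ with the term $\theta e_{n+1}$ moved to the left. -/
theorem expCoeff_succ (hθ : 1 < ‖θ‖) (n : ℕ) :
    (θ ^ Nat.card F ^ (n + 1) - θ) • expCoeff F θ B (n + 1) = ∑ j ∈ Finset.range (n + 1),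
      B (j + 1) * (expCoeff F θ B (n - j)).map (· ^ Nat.card F ^ (j + 1)) := by
  have h : θ ^ Nat.card F ^ (n + 1) - θ ≠ 0 := by
    rw [← norm_pos_iff, norm_pow_card_sub hθ]
    exact pow_pos (zero_lt_one.trans hθ) _
  rw [expCoeff, smul_smul, mul_inv_cancel₀ h, one_smul, Finset.sum_range]

/-- One pass of the recursion. The Frobenius twist turns $A^{q^{n-j}}$ into exactly $A^{q^{n+1}}$,
and only a window of coefficients reaching back to `n - N` enters since `B` vanishes beyond `N`. -/
theorem exists_eventually_expCoeff_le (hθ : 1 < ‖θ‖) {N : ℕ} (hB : ∀ j, N < j → B j = 0) :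
    ∃ b : ℝ, 1 ≤ b ∧ ∀ (A : ℝ) (_ : 0 ≤ A) (n : ℕ),
      (∀ m ≤ n, n - N ≤ m → ‖expCoeff F θ B m‖ ≤ A ^ Nat.card F ^ m) →
      ‖θ‖ ^ Nat.card F ^ (n + 1) * ‖expCoeff F θ B (n + 1)‖ ≤ b * A ^ Nat.card F ^ (n + 1) := by
  refine ⟨1 + ∑ j ∈ Finset.range (N + 1), ‖B j‖,
    le_add_of_nonneg_right (Finset.sum_nonneg fun _ _ => norm_nonneg _), fun A hA n h => ?_⟩
  have hb : ∀ j, ‖B j‖ ≤ 1 + ∑ j ∈ Finset.range (N + 1), ‖B j‖ := by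
    intro j
    have h0 : 0 ≤ ∑ j ∈ Finset.range (N + 1), ‖B j‖ := Finset.sum_nonneg fun _ _ => norm_nonneg _
    by_cases hj : j ≤ N
    · have := Finset.single_le_sum (f := fun j => ‖B j‖) (fun _ _ => norm_nonneg _)
        (Finset.mem_range.mpr (Nat.lt_succ_of_le hj))
      linarith
    · rw [hB j (not_le.mp hj), norm_zero]
      linarith
  have hb0 : 0 ≤ 1 + ∑ j ∈ Finset.range (N + 1), ‖B j‖ := (norm_nonneg _).trans (hb 0)
  have : IsUltrametricDist (Matrix (Fin d) (Fin d) C) :=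
    inferInstanceAs (IsUltrametricDist (Fin d → Fin d → C))
  rw [← norm_pow_card_sub (F := F) hθ, ← norm_matrix_smul, expCoeff_succ hθ]
  refine IsUltrametricDist.norm_sum_le_of_forall_le_of_nonneg
    (mul_nonneg hb0 (pow_nonneg hA _)) fun j hj => ?_
  have hjn : j ≤ n := Nat.lt_succ_iff.mp (Finset.mem_range.mp hj)
  by_cases hjN : j + 1 ≤ N
  · refine (norm_matrix_mul_le_of_isUltrametricDist _ _).trans ?_
    refine mul_le_mul (hb _) ?_ (norm_nonneg _) hb0
    refine (norm_matrix_map_pow_le F _ _).trans ?_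
    have := pow_le_pow_left₀ (norm_nonneg _) (h (n - j) (by omega) (by omega))
      (Nat.card F ^ (j + 1))
    rw [← pow_mul, ← pow_add] at this
    rwa [show n - j + (j + 1) = n + 1 by omega] at this
  · rw [hB _ (not_le.mp hjN), zero_mul, norm_zero]
    exact mul_nonneg hb0 (pow_nonneg hA _)

/-- Write $|\theta|=\gamma^2$. For large $n$ one factor $\gamma^{q^n}$ absorbs the constant `b` and
the other improves a bound with base `A` to one with base `A / γ`. Repetition reaches every positive
base. -/
theorem exists_expCoeff_bound (hθ : 1 < ‖θ‖) {N : ℕ} (hB : ∀ j, N < j → B j = 0) {A : ℝ}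
    (hA : 0 < A) : ∀ᶠ n in Filter.atTop, ‖expCoeff F θ B n‖ ≤ A ^ Nat.card F ^ n := by
  have hθ0 : 0 < ‖θ‖ := zero_lt_one.trans hθ
  obtain ⟨b, hb, hrec⟩ := exists_eventually_expCoeff_le (F := F) hθ hB
  set γ := Real.sqrt ‖θ‖ with hγdef
  have hγ : 1 < γ := by rw [hγdef, Real.lt_sqrt zero_le_one]; simpa using hθ
  have hγ0 : 0 < γ := zero_lt_one.trans hγ
  have hγ2 : ‖θ‖ = γ ^ 2 := (Real.sq_sqrt hθ0.le).symm
  have hq : 1 < Nat.card F := (two_le_natCard F).trans_lt' one_lt_two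
  obtain ⟨K, hK⟩ : ∃ K, ∀ n, K ≤ n → b ≤ γ ^ Nat.card F ^ n := by
    have h1 : Filter.Tendsto (fun n : ℕ => γ ^ Nat.card F ^ n) Filter.atTop Filter.atTop :=
      (tendsto_pow_atTop_atTop_of_one_lt hγ).comp (tendsto_pow_atTop_atTop_of_one_lt hq)
    exact Filter.eventually_atTop.mp (h1.eventually_ge_atTop b)
  have step : ∀ (A : ℝ), 0 ≤ A → ∀ n, K ≤ n + 1 →
      (∀ m ≤ n, n - N ≤ m → ‖expCoeff F θ B m‖ ≤ A ^ Nat.card F ^ m) →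
      ‖expCoeff F θ B (n + 1)‖ ≤ (A / γ) ^ Nat.card F ^ (n + 1) := by
    intro A hA n hn h
    have h1 := hrec A hA n h
    have h2 := hK (n + 1) hn
    rw [hγ2, ← pow_mul, mul_comm 2, pow_mul, pow_two] at h1
    rw [div_pow, le_div_iff₀ (by positivity)]
    have h3 : 0 < γ ^ Nat.card F ^ (n + 1) := by positivity
    have h4 : 0 ≤ A ^ Nat.card F ^ (n + 1) := by positivity
    have h5 := h1.trans (mul_le_mul_of_nonneg_right h2 h4)
    rw [mul_assoc] at h5
    have h6 := le_of_mul_le_mul_left h5 h3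
    linarith [mul_comm (γ ^ Nat.card F ^ (n + 1)) ‖expCoeff F θ B (n + 1)‖]
  obtain ⟨A₀, hA₀, hA₀'⟩ : ∃ A₀ : ℝ, 1 ≤ A₀ ∧ ∀ n, ‖expCoeff F θ B n‖ ≤ A₀ ^ Nat.card F ^ n := by
    refine ⟨1 + ∑ m ∈ Finset.range (K + 1), ‖expCoeff F θ B m‖,
      le_add_of_nonneg_right (Finset.sum_nonneg fun _ _ => norm_nonneg _), fun n => ?_⟩
    set A₀ := 1 + ∑ m ∈ Finset.range (K + 1), ‖expCoeff F θ B m‖ with hA₀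
    have h1 : 1 ≤ A₀ := le_add_of_nonneg_right (Finset.sum_nonneg fun _ _ => norm_nonneg _)
    induction n using Nat.strong_induction_on with
    | _ n ih =>
      by_cases hn : n ≤ K
      · have h2 : ‖expCoeff F θ B n‖ ≤ A₀ := by
          have := Finset.single_le_sum (f := fun m => ‖expCoeff F θ B m‖)
            (fun _ _ => norm_nonneg _) (Finset.mem_range.mpr (Nat.lt_succ_of_le hn))
          linarith
        exact h2.trans (le_self_pow₀ h1 (pow_pos (zero_lt_one.trans hq) n).ne')
      · obtain ⟨m, rfl⟩ : ∃ m, n = m + 1 := ⟨n - 1, by omega⟩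
        refine (step A₀ (by linarith) m (by omega) fun k hk _ => ih k (by omega)).trans ?_
        refine pow_le_pow_left₀ (by positivity) ?_ _
        exact div_le_self (by linarith) hγ.le
  have key : ∀ k : ℕ, ∀ᶠ n in Filter.atTop, ‖expCoeff F θ B n‖ ≤ (A₀ / γ ^ k) ^ Nat.card F ^ n := by
    intro k
    induction k with
    | zero => exact Filter.Eventually.of_forall fun n => by simpa using hA₀' n
    | succ k ih =>
      obtain ⟨M, hM⟩ := Filter.eventually_atTop.mp ih
      -- The threshold grows by `N`, so that the whole window already obeys the previous bound, and
      -- by `K`, beyond which `b` is absorbed.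
      refine Filter.eventually_atTop.mpr ⟨M + N + K + 1, fun n hn => ?_⟩
      obtain ⟨m, rfl⟩ : ∃ m, n = m + 1 := ⟨n - 1, by omega⟩
      have := step (A₀ / γ ^ k) (by positivity) m (by omega) fun l _ hl => hM l (by omega)
      rwa [div_div, ← pow_succ] at this
  obtain ⟨k, hk⟩ := pow_unbounded_of_one_lt (A₀ / A) hγ
  filter_upwards [key k] with n hn
  refine hn.trans (pow_le_pow_left₀ (by positivity) ?_ _)
  rw [div_le_iff₀ (by positivity)]
  rw [div_lt_iff₀ hA] at hk
  linarith

variable [CompleteSpace C]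

theorem summable_expCoeff (hθ : 1 < ‖θ‖) {N : ℕ} (hB : ∀ j, N < j → B j = 0) (x : Fin d → C) :
    Summable fun n => (expCoeff F θ B n).mulVec (frobVec F n x) := by
  -- With this base the `n`-th term is at most $(1/2)^{q^n}$.
  have h1 := exists_expCoeff_bound (F := F) hθ hB (A := (1 / 2) / (‖x‖ + 1)) (by positivity)
  refine Summable.of_norm_bounded_eventually_nat (g := fun n => (1 / 2 : ℝ) ^ n)
    (summable_geometric_of_lt_one (by norm_num) (by norm_num)) ?_
  filter_upwards [h1] with n hn
  refine (norm_mulVec_le_of_isUltrametricDist _ _).trans ?_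
  rw [norm_frobVec]
  refine (mul_le_mul_of_nonneg_right hn (by positivity)).trans ?_
  rw [← mul_pow]
  have h2 : (1 / 2) / (‖x‖ + 1) * ‖x‖ ≤ 1 / 2 := by
    rw [div_mul_eq_mul_div, div_le_iff₀ (by positivity)]
    linarith [norm_nonneg x]
  refine (pow_le_pow_left₀ (by positivity) h2 _).trans ?_
  exact pow_le_pow_of_le_one (by norm_num) (by norm_num)
    (Nat.lt_pow_self (two_le_natCard F)).le

variable (F θ B) in
/-- The exponential series attached to a polynomial in the Frobenius with linear part `θ`. -/
def expSeries (x : Fin d → C) : Fin d → C :=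
  ∑' n, (expCoeff F θ B n).mulVec (frobVec F n x)

theorem hasSum_expSeries (hθ : 1 < ‖θ‖) {N : ℕ} (hB : ∀ j, N < j → B j = 0) (x : Fin d → C) :
    HasSum (fun n => (expCoeff F θ B n).mulVec (frobVec F n x)) (expSeries F θ B x) :=
  (summable_expCoeff hθ hB x).hasSum

variable [Algebra F C]

theorem expSeries_add (hθ : 1 < ‖θ‖) {N : ℕ} (hB : ∀ j, N < j → B j = 0) (x y : Fin d → C) :
    expSeries F θ B (x + y) = expSeries F θ B x + expSeries F θ B y := by
  refine (hasSum_expSeries hθ hB (x + y)).unique ?_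
  simp only [frobVec_add, Matrix.mulVec_add]
  exact (hasSum_expSeries hθ hB x).add (hasSum_expSeries hθ hB y)

theorem expSeries_smul (hθ : 1 < ‖θ‖) {N : ℕ} (hB : ∀ j, N < j → B j = 0) (hB0 : B 0 = θ • 1)
    (x : Fin d → C) : expSeries F θ B (θ • x) = frobSum F (N + 1) B (expSeries F θ B x) := by
  refine (hasSum_expSeries hθ hB (θ • x)).unique ?_
  convert! (hasSum_expSeries (F := F) hθ hB x).frobSum hB using 2 with n
  rw [frobVec_smul, Matrix.mulVec_smul, ← Matrix.smul_mulVec]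
  congr 1
  rw [Finset.sum_range_succ', hB0]
  have hid : (expCoeff F θ B n).map (· ^ Nat.card F ^ 0) = expCoeff F θ B n := by
    ext; simp
  rw [Nat.sub_zero, hid, smul_mul_assoc, one_mul]
  cases n with
  | zero => simp
  | succ n =>
    have := expCoeff_succ (F := F) (B := B) hθ n
    simp only [Nat.add_sub_add_right]
    rw [← this, sub_smul, sub_add_cancel]

end ExpConstruction

/-! ### Anderson modules in coordinates -/

theorem frobPoly_eq_frobSum {F L : Type u} [Field L] {C : Type*} [CommRing C] [Algebra L C] {d d' : ℕ} (N : ℕ)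
    (B : ℕ → Matrix (Fin d') (Fin d) L) (x : Fin d → C) :
    frobPoly F (N + 1) B x =
      frobSum F (N + 1) (fun j => if j ≤ N then (B j).map (algebraMap L C) else 0) x := by
  funext k
  rw [frobPoly, frobSum, Finset.sum_apply]
  refine Finset.sum_congr rfl fun j hj => ?_
  rw [if_pos (Nat.lt_succ_iff.mp (Finset.mem_range.mp hj))]
  rfl

/-- A morphism of additive group schemes, over a field extension. -/
theorem exists_frobSum {F L : Type u} [Field F] [Finite F] [Field L] [Algebra F L] {d d' : ℕ} (f : Ga F L d ⟶ Ga F L d') (C : Type u) [CommRing C]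
    [Algebra L C] :
    ∃ (N : ℕ) (B : ℕ → Matrix (Fin d') (Fin d) C), (∀ j, N < j → B j = 0) ∧
      (∀ x : Fin d → C,
        gaCoord (F := F) ((f.app (CommAlgCat.of L C)).hom x) = frobSum F (N + 1) B x) ∧
      ∀ x, gaLieCoord (lieMap f C x) = (B 0).mulVec (gaLieCoord x) := by
  obtain ⟨N, B, hB⟩ := exists_frobPoly f
  refine ⟨N, fun j => if j ≤ N then (B j).map (algebraMap L C) else 0,
    fun j hj => if_neg (not_le.mpr hj), fun x => ?_, fun x => ?_⟩
  · rw [hB, frobPoly_eq_frobSum]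
  · simp only [Nat.zero_le, if_true]
    exact gaLieCoord_lieMap C f hB x

namespace AndersonModule

variable {F A L : Type u} [Field F] [CommRing A] [Algebra F A] [Field L]
  [Algebra F L] [Algebra A L] {d : ℕ} (E : AndersonModule F A L d)

section Coordinates

variable (κ : E.E ≅ Ga F L d) (R : Type u) [CommRing R] [Algebra L R]

/-- The coordinates of points. -/
def pointCoord : E.Points R ≃+ (Fin d → R) where
  toFun x := gaCoord (F := F) ((κ.hom.app (CommAlgCat.of L R)).hom x)
  invFun y := (κ.inv.app (CommAlgCat.of L R)).hom y
  left_inv x := congrArg (fun f => (f.app (CommAlgCat.of L R)).hom x) κ.hom_inv_id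
  right_inv y := congrArg (fun f => (f.app (CommAlgCat.of L R)).hom y) κ.inv_hom_id
  map_add' x y := map_add (κ.hom.app (CommAlgCat.of L R)).hom x y

/-- The coordinates of the Lie algebra. -/
def lieCoord : E.Lie R ≃+ (Fin d → R) := (lieEquiv R κ).trans (gaLieEquiv R)

theorem lieCoord_apply (x : E.Lie R) : E.lieCoord κ R x = gaLieCoord (lieMap κ.hom R x) := rfl

theorem smul_points_def (a : A) (x : E.Points R) : a • x = E.pointsAct R a x := rfl

theorem smul_lie_def (a : A) (x : E.Lie R) : a • x = E.lieAct R a x := rfl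

theorem smul_assoc_points {F A L : Type u} [Field F] [CommRing A] [Algebra F A] [Field L]
    [Algebra F L] [Algebra A L] {d : ℕ} (E : AndersonModule F A L d) (R : Type u) [CommRing R]
    [Algebra L R] (c : F) (a : A) (x : E.Points R) : (c • a) • x = c • a • x := by
  rw [smul_points_def, smul_points_def]
  change ((E.φ (c • a)).app (CommAlgCat.of L R)).hom x = _
  rw [map_smul]
  rfl

theorem lieCoord_lieScale (r : R) (x : lieAlg E.E R) :
    E.lieCoord κ R (lieScale E.E r x) = r • E.lieCoord κ R x :=
  (congrArg gaLieCoord (lieMap_lieScale R κ.hom r x)).trans (gaLieCoord_lieScale R r _)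

theorem lieCoord_smul_eq (a : A) (x : E.Lie R) :
    gaLieCoord (lieMap (κ.inv ≫ E.φ a ≫ κ.hom) R (lieMap κ.hom R x)) = E.lieCoord κ R (a • x) :=
  congrArg (fun w : lieAlg E.E R => gaLieCoord (lieMap κ.hom R (lieMap (E.φ a) R w)))
    ((lieEquiv R κ).symm_apply_apply x)

end Coordinates

/-- The action of the coefficient ring in coordinates, over a field extension. -/
theorem exists_coord [Finite F] (κ : E.E ≅ Ga F L d) (a : A) (C : Type u) [CommRing C]
    [Algebra L C] :
    ∃ (N : ℕ) (B : ℕ → Matrix (Fin d) (Fin d) C), (∀ j, N < j → B j = 0) ∧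
      (∀ x, E.pointCoord κ C (a • x) = frobSum F (N + 1) B (E.pointCoord κ C x)) ∧
      (∀ x, E.lieCoord κ C (a • x) = (B 0).mulVec (E.lieCoord κ C x)) ∧
      IsNilpotent (B 0 - algebraMap L C (algebraMap A L a) • 1) := by
  let f : Ga F L d ⟶ Ga F L d := κ.inv ≫ E.φ a ≫ κ.hom
  obtain ⟨N, B, hB⟩ := exists_frobPoly f
  refine ⟨N, fun j => if j ≤ N then (B j).map (algebraMap L C) else 0,
    fun j hj => if_neg (not_le.mpr hj), fun x => ?_, fun x => ?_, ?_⟩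
  · rw [← frobPoly_eq_frobSum, ← hB]
    change _ = E.pointCoord κ C (a • (E.pointCoord κ C).symm (E.pointCoord κ C x))
    rw [AddEquiv.symm_apply_apply]
  · simp only [Nat.zero_le, if_true]
    exact (E.lieCoord_smul_eq κ C a x).symm.trans
      (gaLieCoord_lieMap C f hB (lieMap κ.hom C x))
  · simp only [Nat.zero_le, if_true]
    -- Nilpotency is given on $\operatorname{Lie}_E(L)$ only; it is read off as a matrix identity
    -- over `L` and then carried to `C`.
    have hL : IsNilpotent (B 0 - algebraMap A L a • (1 : Matrix (Fin d) (Fin d) L)) := by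
      obtain ⟨k, hk⟩ := E.nilpotent a
      refine ⟨k, ?_⟩
      set T : Module.End F (lieAlg E.E L) := lieMap (E.φ a) L - lieScale E.E (algebraMap A L a)
      set M := B 0 - algebraMap A L a • (1 : Matrix (Fin d) (Fin d) L)
      have h1 : ∀ x : E.Lie L, E.lieCoord κ L (T x) = M.mulVec (E.lieCoord κ L x) := by
        intro x
        have h2 : T x = HSub.hSub (α := E.Lie L) (β := E.Lie L) (a • x) (lieScale E.E (algebraMap A L a) x) := rfl
        rw [h2]
        refine (map_sub (E.lieCoord κ L) (a • x) _).trans ?_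
        rw [Matrix.sub_mulVec, Matrix.smul_mulVec, Matrix.one_mulVec]
        congr 1
        · have h3 := gaLieCoord_lieMap L f hB (lieMap κ.hom L x)
          rw [show (algebraMap L L : L → L) = id from rfl, Matrix.map_id] at h3
          exact (E.lieCoord_smul_eq κ L a x).symm.trans h3
        · exact E.lieCoord_lieScale κ L _ x
      have h4 : ∀ (n : ℕ) (x : E.Lie L),
          E.lieCoord κ L ((T ^ n) x) = (M ^ n).mulVec (E.lieCoord κ L x) := by
        intro n
        induction n with
        | zero =>
            intro x
            rw [pow_zero, pow_zero, Matrix.one_mulVec]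
            rfl
        | succ n ih =>
          intro x
          rw [pow_succ', pow_succ', ← Matrix.mulVec_mulVec, ← ih]
          exact h1 _
      refine Matrix.ext_of_mulVec_single fun i => ?_
      obtain ⟨x, hx⟩ := (E.lieCoord κ L).surjective (Pi.single i 1)
      rw [← hx, ← h4, hk, Matrix.zero_mulVec]
      exact map_zero (E.lieCoord κ L)
    have h5 := hL.map (algebraMap L C).mapMatrix
    convert! h5 using 1
    simp only [RingHom.mapMatrix_apply]
    ext i j
    change algebraMap L C (B 0 i j) - algebraMap L C (algebraMap A L a) * (1 : Matrix _ _ C) i j =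
      algebraMap L C (B 0 i j - algebraMap A L a * (1 : Matrix _ _ L) i j)
    rw [map_sub, map_mul, Matrix.one_apply, Matrix.one_apply, apply_ite (algebraMap L C), map_one,
      map_zero]

end AndersonModule

/-! ### Existence of the exponential function -/

namespace AndersonModule

variable {F A L : Type u} [Field F] [Finite F] [CommRing A] [Algebra F A] [Field L]
  [Algebra F L] [Algebra A L] {d : ℕ} (E : AndersonModule F A L d)

/-- The action of `t` on the Lie algebra is a scalar plus a nilpotent. In characteristic `ℓ` an `ℓ ^
k`-th power removes the nilpotent part, so a power of `t` acts by a scalar, as the construction of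
the exponential requires. -/
theorem exists_coord_pow (hd : 0 < d) (κ : E.E ≅ Ga F L d) (t : A) (C : Type u) [Field C]
    [Algebra L C] :
    ∃ m, 0 < m ∧ ∃ (N : ℕ) (B : ℕ → Matrix (Fin d) (Fin d) C), (∀ j, N < j → B j = 0) ∧
      B 0 = algebraMap L C (algebraMap A L t) ^ m • 1 ∧
      (∀ x, E.pointCoord κ C (t ^ m • x) = frobSum F (N + 1) B (E.pointCoord κ C x)) ∧
      ∀ x, E.lieCoord κ C (t ^ m • x) =
        algebraMap L C (algebraMap A L t) ^ m • E.lieCoord κ C x := by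
  have : Nonempty (Fin d) := ⟨⟨0, hd⟩⟩
  obtain ⟨N₁, B₁, -, -, hl, k, hk⟩ := E.exists_coord κ t C
  set θ := algebraMap L C (algebraMap A L t)
  let : Algebra F C := ((algebraMap L C).comp (algebraMap F L)).toAlgebra
  obtain ⟨ℓ, hℓ⟩ := CharP.exists F
  have hp : Fact ℓ.Prime := ⟨CharP.char_is_prime F ℓ⟩
  have : CharP C ℓ := charP_of_injective_algebraMap (algebraMap F C).injective ℓ
  have hm : 0 < ℓ ^ k := pow_pos hp.out.pos k
  refine ⟨ℓ ^ k, hm, ?_⟩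
  have h1 : B₁ 0 ^ ℓ ^ k = θ ^ ℓ ^ k • 1 := by
    have h2 : B₁ 0 = θ • 1 + (B₁ 0 - θ • 1) := by abel
    rw [h2, add_pow_char_pow_of_commute ℓ k ((Commute.one_left _).smul_left θ),
      pow_eq_zero_of_le (Nat.lt_pow_self hp.out.one_lt).le hk, add_zero, smul_pow, one_pow]
  have h3 : ∀ (n : ℕ) (x : E.Lie C), E.lieCoord κ C (t ^ n • x) =
      (B₁ 0 ^ n).mulVec (E.lieCoord κ C x) := by
    intro n
    induction n with
    | zero => intro x; rw [pow_zero, pow_zero, one_smul, Matrix.one_mulVec]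
    | succ n ih =>
      intro x
      rw [pow_succ, mul_smul, ih, hl, pow_succ, Matrix.mulVec_mulVec]
  have h4 : ∀ x : E.Lie C, E.lieCoord κ C (t ^ ℓ ^ k • x) = θ ^ ℓ ^ k • E.lieCoord κ C x := by
    intro x
    rw [h3, h1, Matrix.smul_mulVec, Matrix.one_mulVec]
  obtain ⟨N, B, hB, hpt, hl', -⟩ := E.exists_coord κ (t ^ ℓ ^ k) C
  refine ⟨N, B, hB, ?_, hpt, h4⟩
  refine Matrix.ext_of_mulVec_single fun i => ?_
  obtain ⟨x, hx⟩ := (E.lieCoord κ C).surjective (Pi.single i 1)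
  rw [← hx, ← hl', h4, Matrix.smul_mulVec, Matrix.one_mulVec]

variable {C : Type u} [NormedField C] [CompleteSpace C] [IsUltrametricDist C] [Algebra L C]

/-- The exponential function exists as soon as some element of `A` has absolute value `> 1`. -/
theorem exists_isExponential (hd : 0 < d) (t : A)
    (ht : 1 < ‖algebraMap L C (algebraMap A L t)‖) : ∃ f, E.IsExponential C f := by
  let : Algebra F C := ((algebraMap L C).comp (algebraMap F L)).toAlgebra
  obtain ⟨κ⟩ := E.iso_ga
  obtain ⟨m, hm, N, B, hB, hB0, hpt, hlie⟩ := E.exists_coord_pow hd κ t C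
  set θ := algebraMap L C (algebraMap A L t) ^ m
  have hθ : 1 < ‖θ‖ := by
    rw [norm_pow]
    exact one_lt_pow₀ ht hm.ne'
  let f₀ : (Fin d → C) → Fin d → C := expSeries F θ B
  have hf₀ : ∀ x, HasSum (fun n => (expCoeff F θ B n).mulVec (frobVec F n x)) (f₀ x) :=
    hasSum_expSeries hθ hB
  have hf₀_add : ∀ x y, f₀ (x + y) = f₀ x + f₀ y := expSeries_add hθ hB
  have hf₀_smul : ∀ x, f₀ (θ • x) = frobSum F (N + 1) B (f₀ x) := expSeries_smul hθ hB hB0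
  have hsub : ∀ x y, frobSum F (N + 1) B (x - y) =
      frobSum F (N + 1) B x - frobSum F (N + 1) B y := fun x y =>
    map_sub (AddMonoidHom.mk' (frobSum F (N + 1) B) (frobSum_add F _ B)) x y
  obtain ⟨c, hc, hcB⟩ := exists_norm_frobSum_sub_le F N B
  let f : E.Lie C →ₗ[A] E.Points C :=
    { toFun := fun x => (E.pointCoord κ C).symm (f₀ (E.lieCoord κ C x))
      map_add' := fun x y => by rw [map_add, hf₀_add, map_add]
      map_smul' := fun a x => by
        obtain ⟨Na, Ba, hBa, hpa, hla, -⟩ := E.exists_coord κ a C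
        rw [AddEquiv.symm_apply_eq, RingHom.id_apply, hpa, AddEquiv.apply_symm_apply, hla]
        -- The defect $\varphi_a(\exp y)-\exp(\partial a\,y)$ is a series without linear term, and
        -- it intertwines `θ` with the action of `t ^ m` because `A` is commutative; such a map
        -- vanishes.
        refine (sub_eq_zero.mp ?_).symm
        have hser : ∀ y, HasSum (fun n => (∑ j ∈ Finset.range (n + 1),
            Ba j * (expCoeff F θ B (n - j)).map (· ^ Nat.card F ^ j) -
            expCoeff F θ B n * (Ba 0).map (· ^ Nat.card F ^ n)).mulVec (frobVec F n y))
            (frobSum F (Na + 1) Ba (f₀ y) - f₀ ((Ba 0).mulVec y)) := by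
          intro y
          have h1 := hf₀ ((Ba 0).mulVec y)
          simp only [frobVec_mulVec, Matrix.mulVec_mulVec] at h1
          simp only [Matrix.sub_mulVec]
          exact ((hf₀ y).frobSum hBa).sub h1
        obtain ⟨c', -, hc'⟩ := exists_norm_series_sub_le F hser
        refine eq_zero_of_intertwines (φ := frobSum F (N + 1) B) hθ hc ?_
          (G := fun y => frobSum F (Na + 1) Ba (f₀ y) - f₀ ((Ba 0).mulVec y)) ?_
          (c' := c') one_pos ?_ _
        · intro x hx
          have h2 := hcB x hx
          rwa [hB0, Matrix.smul_mulVec, Matrix.one_mulVec] at h2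
        · intro y
          rw [hsub, hf₀_smul, Matrix.mulVec_smul, hf₀_smul]
          congr 1
          set w := (E.pointCoord κ C).symm (f₀ y)
          have hw : f₀ y = E.pointCoord κ C w := (AddEquiv.apply_symm_apply _ _).symm
          rw [hw, ← hpt, ← hpa, ← hpa, ← hpt, smul_comm]
        · intro y hy
          have h2 := hc' y hy
          simpa [expCoeff_zero] using h2 }
  -- In other coordinates the series is composed with a polynomial in the Frobenius on the left and
  -- the inverse linear change on the right; the two linear parts cancel, so it still starts with
  -- the identity.
  refine ⟨f, fun κ' => ?_⟩
  obtain ⟨Na, Ba, hBa, hpa, hla⟩ := exists_frobSum (κ.inv ≫ κ'.hom) C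
  obtain ⟨Nb, Bb, hBb, hpb, hlb⟩ := exists_frobSum (κ'.inv ≫ κ.hom) C
  have ha : ∀ x : E.Lie C, E.lieCoord κ' C x = (Ba 0).mulVec (E.lieCoord κ C x) := fun x =>
    (congrArg (fun w : lieAlg E.E C => gaLieCoord (lieMap κ'.hom C w))
      ((lieEquiv C κ).symm_apply_apply x)).symm.trans (hla (lieMap κ.hom C x))
  have hb : ∀ x : E.Lie C, E.lieCoord κ C x = (Bb 0).mulVec (E.lieCoord κ' C x) := fun x =>
    (congrArg (fun w : lieAlg E.E C => gaLieCoord (lieMap κ.hom C w))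
      ((lieEquiv C κ').symm_apply_apply x)).symm.trans (hlb (lieMap κ'.hom C x))
  have hpt' : ∀ x : E.Points C, E.pointCoord κ' C x =
      frobSum F (Na + 1) Ba (E.pointCoord κ C x) := fun x =>
    (congrArg (E.pointCoord κ' C) ((E.pointCoord κ C).symm_apply_apply x)).symm.trans
      (hpa (E.pointCoord κ C x))
  have hab : Ba 0 * Bb 0 = 1 := by
    refine Matrix.ext_of_mulVec_single fun i => ?_
    obtain ⟨x, hx⟩ := (E.lieCoord κ' C).surjective (Pi.single i 1)
    rw [← hx, ← Matrix.mulVec_mulVec, ← hb, ← ha, Matrix.one_mulVec]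
  refine ⟨fun n => (∑ j ∈ Finset.range (n + 1),
    Ba j * (expCoeff F θ B (n - j)).map (· ^ Nat.card F ^ j)) *
      (Bb 0).map (· ^ Nat.card F ^ n), ?_, fun x => ?_⟩
  · simp [expCoeff_zero, hab]
  · have h1 := (hf₀ (E.lieCoord κ C x)).frobSum hBa
    have h2 : E.pointCoord κ' C (f x) = frobSum F (Na + 1) Ba (f₀ (E.lieCoord κ C x)) := by
      rw [hpt']
      exact congrArg _ (AddEquiv.apply_symm_apply _ _)
    rw [← h2, hb] at h1
    simp only [frobVec_mulVec, Matrix.mulVec_mulVec] at h1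
    exact h1

end AndersonModule

/-! ### Frobenius-semilinear maps -/

section FrobeniusModule

variable {F C M : Type*} [Field F] [Finite F] [Field C] [Algebra F C] [AddCommGroup M] [Module C M]
  {τ : M →+ M}

/-- A functional compatible with the Frobenius on a stable subspace of finite codimension can be
extended to any further vector; its value there has to solve an additive equation. -/
theorem exists_extend_step (hτ : ∀ (c : C) m, τ (c • m) = c ^ Nat.card F • τ m) (N : Submodule C M)
    (hN : ∀ n ∈ N, τ n ∈ N) [Module.Finite C (M ⧸ N)] {v : M} (hv : v ∉ N) :
    ∃ k, 0 < k ∧ ∃ n₀ ∈ N, ∃ c : Fin k → C, τ^[k] v = n₀ + ∑ i, c i • τ^[i] v ∧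
      ∀ f : M →ₗ[C] C, (∀ n ∈ N, f (τ n) = f n ^ Nat.card F) →
        ∀ y : C, y ^ Nat.card F ^ k = f n₀ + ∑ i, c i * y ^ Nat.card F ^ (i : ℕ) →
          ∃ (N' : Submodule C M) (f' : M →ₗ[C] C), N ≤ N' ∧ v ∈ N' ∧ (∀ n ∈ N', τ n ∈ N') ∧
            (∀ n ∈ N, f' n = f n) ∧ f' v = y ∧ ∀ n ∈ N', f' (τ n) = f' n ^ Nat.card F := by
  classical
  let u : ℕ → M ⧸ N := fun i => N.mkQ (τ^[i] v)
  -- Finite codimension makes the iterates of `v` dependent modulo `N`; `k` is the length of the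
  -- longest independent initial string.
  have hex : ∃ k, ¬ LinearIndependent C (fun i : Fin k => u i) := by
    refine ⟨Module.finrank C (M ⧸ N) + 1, fun h => ?_⟩
    have := h.fintype_card_le_finrank
    simp at this
  obtain ⟨k, hk, hk'⟩ : ∃ k, LinearIndependent C (fun i : Fin k => u i) ∧
      ¬ LinearIndependent C (fun i : Fin (k + 1) => u i) := by
    have h0 : Nat.find hex ≠ 0 := by
      intro h
      have := Nat.find_spec hex
      rw [h] at this
      exact this linearIndependent_empty_type
    obtain ⟨k, hk⟩ := Nat.exists_eq_succ_of_ne_zero h0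
    refine ⟨k, not_not.mp (Nat.find_min hex (by lia)), ?_⟩
    have := Nat.find_spec hex
    rwa [hk] at this
  have hmem : u k ∈ Submodule.span C (Set.range fun i : Fin k => u i) := by
    by_contra h
    refine hk' ?_
    have h2 := hk.finSnoc h
    convert! h2 using 1
    funext i
    refine Fin.lastCases ?_ (fun i => ?_) i
    · simp
    · simp
  have hk0 : 0 < k := by
    rcases Nat.eq_zero_or_pos k with rfl | h
    · rw [Set.range_eq_empty, Submodule.span_empty, Submodule.mem_bot] at hmem
      exact absurd ((Submodule.Quotient.mk_eq_zero N).mp hmem) hv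
    · exact h
  obtain ⟨c, hc⟩ := (Submodule.mem_span_range_iff_exists_fun C).mp hmem
  have hn₀ : τ^[k] v - ∑ i, c i • τ^[i] v ∈ N := by
    rw [← Submodule.Quotient.mk_eq_zero, ← Submodule.mkQ_apply, map_sub, map_sum]
    simp only [map_smul]
    exact sub_eq_zero.mpr hc.symm
  refine ⟨k, hk0, _, hn₀, c, (sub_add_cancel _ _).symm, fun f hf y hy => ?_⟩
  set n₀ := τ^[k] v - ∑ i, c i • τ^[i] v with hn₀_def
  -- `N` and the first `k` iterates of `v` are in direct sum. The extended functional sends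
  -- $\tau^iv$ to $y^{q^i}$, and the equation for `y` is the compatibility forced at $\tau^kv$.
  let ι : N × (Fin k → C) →ₗ[C] M :=
    N.subtype.coprod (Fintype.linearCombination C (fun i : Fin k => τ^[i] v))
  have hι : ∀ n a, ι (n, a) = n + ∑ i, a i • τ^[i] v := fun n a => rfl
  have hinj : LinearMap.ker ι = ⊥ := by
    refine LinearMap.ker_eq_bot'.mpr ?_
    rintro ⟨n, a⟩ h
    rw [hι] at h
    have h1 : ∑ i, a i • u i = 0 := by
      have h2 := congrArg N.mkQ h
      rw [map_add, map_sum, map_zero] at h2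
      simp only [map_smul] at h2
      rwa [Submodule.mkQ_apply, (Submodule.Quotient.mk_eq_zero N).mpr n.2, zero_add] at h2
    have h3 : a = 0 := funext (Fintype.linearIndependent_iff.mp hk a h1)
    subst h3
    simp only [Pi.zero_apply, zero_smul, Finset.sum_const_zero, add_zero] at h
    exact Prod.ext (Subtype.ext h) rfl
  obtain ⟨h, hh⟩ := LinearMap.exists_leftInverse_of_injective ι hinj
  let g : N × (Fin k → C) →ₗ[C] C :=
    (f.comp N.subtype).coprod (Fintype.linearCombination C (fun i : Fin k => y ^ Nat.card F ^ (i : ℕ)))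
  have hg : ∀ n a, g (n, a) = f n + ∑ i, a i * y ^ Nat.card F ^ (i : ℕ) := fun n a => rfl
  let f' : M →ₗ[C] C := g.comp h
  have hf' : ∀ z, f' (ι z) = g z := fun z => congrArg g (LinearMap.congr_fun hh z)
  have hN_le : ∀ n ∈ N, n ∈ LinearMap.range ι ∧ f' n = f n := by
    intro n hn
    have h1 : ι (⟨n, hn⟩, 0) = n := by rw [hι]; simp
    refine ⟨⟨_, h1⟩, ?_⟩
    nth_rw 1 [← h1]
    rw [hf', hg]
    simp
  have hlt : ∀ j < k, τ^[j] v ∈ LinearMap.range ι ∧ f' (τ^[j] v) = y ^ Nat.card F ^ j := by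
    intro j hj
    have h1 : ι (0, Pi.single ⟨j, hj⟩ 1) = τ^[j] v := by
      rw [hι, Finset.sum_eq_single ⟨j, hj⟩]
      · simp
      · intro b _ hb; simp [hb]
      · simp
    refine ⟨⟨_, h1⟩, ?_⟩
    rw [← h1, hf', hg, Finset.sum_eq_single ⟨j, hj⟩]
    · simp
    · intro b _ hb; simp [hb]
    · simp
  have hle : ∀ j ≤ k, τ^[j] v ∈ LinearMap.range ι ∧ f' (τ^[j] v) = y ^ Nat.card F ^ j := by
    intro j hj
    rcases hj.lt_or_eq with hj | rfl
    · exact hlt j hj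
    · have h1 : τ^[j] v = n₀ + ∑ i, c i • τ^[i] v := (sub_add_cancel _ _).symm
      constructor
      · rw [h1]
        exact add_mem (hN_le _ hn₀).1 (sum_mem fun i _ => Submodule.smul_mem _ _ (hlt i i.2).1)
      · rw [hy, h1, map_add, map_sum, (hN_le _ hn₀).2]
        congr 1
        refine Finset.sum_congr rfl fun i _ => ?_
        rw [map_smul, (hlt i i.2).2, smul_eq_mul]
  have hτι : ∀ n a, τ (ι (n, a)) = τ n + ∑ i, a i ^ Nat.card F • τ^[i + 1] v := by
    intro n a
    rw [hι, map_add, map_sum]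
    congr 1
    refine Finset.sum_congr rfl fun i _ => ?_
    rw [hτ, Function.iterate_succ_apply']
  refine ⟨LinearMap.range ι, f', fun n hn => (hN_le n hn).1, (hle 0 hk0.le).1, ?_,
    fun n hn => (hN_le n hn).2, ?_, ?_⟩
  · rintro _ ⟨⟨n, a⟩, rfl⟩
    rw [hτι]
    exact add_mem (hN_le _ (hN n n.2)).1
      (sum_mem fun i _ => Submodule.smul_mem _ _ (hle _ i.2).1)
  · simpa using (hle 0 hk0.le).2
  · rintro _ ⟨⟨n, a⟩, rfl⟩
    have hadd := add_pow_card F 1 (f n) (∑ i, a i * y ^ Nat.card F ^ (i : ℕ))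
    have hsum := sum_pow_card F Finset.univ 1 fun i : Fin k => a i * y ^ Nat.card F ^ (i : ℕ)
    simp only [pow_one] at hadd hsum
    rw [hτι, hf', hg, hadd, hsum, map_add, map_sum, (hN_le _ (hN n n.2)).2, hf n n.2]
    congr 1
    refine Finset.sum_congr rfl fun i _ => ?_
    rw [map_smul, (hle _ i.2).2, smul_eq_mul, mul_pow, ← pow_mul, pow_succ]

theorem exists_pow_eq_eval {C : Type*} [Field C] [IsAlgClosed C] {n : ℕ} (P : Polynomial C)
    (hn : n ≠ 0) (hP : P.degree < n) : ∃ y : C, y ^ n = P.eval y := by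
  have hdeg : (Polynomial.X ^ n - P).degree = (n : WithBot ℕ) := by
    rw [Polynomial.degree_sub_eq_left_of_degree_lt (by rwa [Polynomial.degree_X_pow]),
      Polynomial.degree_X_pow]
  obtain ⟨y, hy⟩ := IsAlgClosed.exists_root (Polynomial.X ^ n - P) (by
    rw [hdeg]
    exact_mod_cast hn)
  exact ⟨y, by simpa [Polynomial.IsRoot, sub_eq_zero] using hy⟩

/-- A nonconstant additive equation is solvable. -/
theorem exists_root_additive {F C : Type*} [Field F] [Finite F] [Field C] [IsAlgClosed C] {k : ℕ}
    (a : C) (c : Fin k → C) :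
    ∃ y : C, y ^ Nat.card F ^ k = a + ∑ i, c i * y ^ Nat.card F ^ (i : ℕ) := by
  have hq := two_le_natCard F
  let P : Polynomial C :=
    Polynomial.C a + ∑ i, Polynomial.C (c i) * Polynomial.X ^ Nat.card F ^ (i : ℕ)
  have hP : P.degree < (Nat.card F ^ k : ℕ) := by
    refine (Polynomial.degree_add_le _ _).trans_lt (max_lt ?_ ?_)
    · refine Polynomial.degree_C_le.trans_lt ?_
      exact_mod_cast Nat.pow_pos (by lia)
    · refine (Polynomial.degree_sum_le _ _).trans_lt ?_
      rw [Finset.sup_lt_iff (by exact WithBot.bot_lt_coe _)]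
      intro i _
      refine (Polynomial.degree_C_mul_X_pow_le _ _).trans_lt ?_
      exact_mod_cast Nat.pow_lt_pow_right (by lia) i.2
  obtain ⟨y, hy⟩ := exists_pow_eq_eval P (Nat.pow_pos (by lia)).ne' hP
  exact ⟨y, by rw [hy]; simp [P, Polynomial.eval_finsetSum]⟩

/-- Dividing by $y^{q^{i_0}}$, with $i_0$ the first index whose coefficient is nonzero, leaves a
polynomial equation with nonzero constant term, whose roots are nonzero. -/
theorem exists_root_additive_ne_zero {F C : Type*} [Field F] [Finite F] [Field C] [IsAlgClosed C]
    {k : ℕ} (c : Fin k → C) (hc : c ≠ 0) :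
    ∃ y : C, y ≠ 0 ∧ y ^ Nat.card F ^ k = ∑ i, c i * y ^ Nat.card F ^ (i : ℕ) := by
  have hq := two_le_natCard F
  obtain ⟨i₀, h₀, hmin⟩ : ∃ i₀, c i₀ ≠ 0 ∧ ∀ i < i₀, c i = 0 := by
    obtain ⟨i, hi⟩ := Function.ne_iff.mp hc
    obtain ⟨i₀, h⟩ := exists_minimal_of_wellFoundedLT (fun i => c i ≠ 0) ⟨i, hi⟩
    exact ⟨i₀, h.prop, fun j hj => by
      by_contra h'
      exact absurd (h.le_of_le h' hj.le) (not_le.mpr hj)⟩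
  -- Below `i₀` the truncated difference is zero, which is harmless since the coefficients vanish
  -- there.
  let r : ℕ → ℕ := fun i => Nat.card F ^ i - Nat.card F ^ (i₀ : ℕ)
  have hr : ∀ i, (i₀ : ℕ) ≤ i → r i + Nat.card F ^ (i₀ : ℕ) = Nat.card F ^ i := fun i hi =>
    Nat.sub_add_cancel (Nat.pow_le_pow_right (by lia) hi)
  let P : Polynomial C := ∑ i, Polynomial.C (c i) * Polynomial.X ^ r i
  have hlt : ∀ i : Fin k, r i < r k := by
    intro i
    have h1 : Nat.card F ^ (i : ℕ) < Nat.card F ^ k := Nat.pow_lt_pow_right (by lia) i.2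
    have h2 : Nat.card F ^ (i₀ : ℕ) < Nat.card F ^ k := Nat.pow_lt_pow_right (by lia) i₀.2
    simp only [r]
    lia
  have hP : P.degree < (r k : ℕ) := by
    refine (Polynomial.degree_sum_le _ _).trans_lt ?_
    rw [Finset.sup_lt_iff (by exact WithBot.bot_lt_coe _)]
    intro i _
    refine (Polynomial.degree_C_mul_X_pow_le _ _).trans_lt ?_
    exact_mod_cast hlt i
  have hrk : r k ≠ 0 := (Nat.zero_le _).trans_lt (hlt i₀) |>.ne'
  obtain ⟨y, hy⟩ := exists_pow_eq_eval P hrk hP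
  have hPy : P.eval y = ∑ i, c i * y ^ r i := by simp [P, Polynomial.eval_finsetSum]
  refine ⟨y, ?_, ?_⟩
  · rintro rfl
    rw [zero_pow hrk, hPy, Finset.sum_eq_single i₀] at hy
    · simp [r] at hy
      exact h₀ hy.symm
    · intro i _ hi
      rcases lt_or_gt_of_ne hi with h | h
      · rw [hmin i h, zero_mul]
      · have h1 : Nat.card F ^ (i₀ : ℕ) < Nat.card F ^ (i : ℕ) := Nat.pow_lt_pow_right (by lia) h
        rw [zero_pow (by simp only [r]; lia), mul_zero]
    · simp
  · rw [← hr k i₀.2.le, pow_add, hy, hPy, Finset.sum_mul]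
    refine Finset.sum_congr rfl fun i _ => ?_
    rcases lt_or_ge i i₀ with h | h
    · rw [hmin i h, zero_mul, zero_mul, zero_mul]
    · rw [← hr i h, pow_add, mul_assoc]

/-- A functional compatible with the Frobenius on a stable subspace of finite codimension extends
to a compatible functional. -/
theorem exists_extend_compatible [IsAlgClosed C] (hτ : ∀ (c : C) m, τ (c • m) = c ^ Nat.card F • τ m)
    (N : Submodule C M) (hN : ∀ n ∈ N, τ n ∈ N) [Module.Finite C (M ⧸ N)] (f : M →ₗ[C] C)
    (hf : ∀ n ∈ N, f (τ n) = f n ^ Nat.card F) :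
    ∃ f' : M →ₗ[C] C, (∀ n ∈ N, f' n = f n) ∧ ∀ m, f' (τ m) = f' m ^ Nat.card F := by
  obtain ⟨n, hn⟩ : ∃ n, Module.finrank C (M ⧸ N) = n := ⟨_, rfl⟩
  induction n using Nat.strong_induction_on generalizing N f with
  | _ n ih =>
    by_cases htop : N = ⊤
    · subst htop
      exact ⟨f, fun _ _ => rfl, fun m => hf m trivial⟩
    obtain ⟨v, -, hv⟩ := Set.exists_of_ssubset (SetLike.coe_ssubset_coe.mpr (lt_top_iff_ne_top.mpr htop))
    obtain ⟨k, -, n₀, hn₀, c, -, h⟩ := exists_extend_step hτ N hN hv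
    obtain ⟨y, hy⟩ := exists_root_additive (F := F) (f n₀) c
    obtain ⟨N', f', hle, hvN', hN', hff', -, hf'⟩ := h f hf y hy
    have hfin : Module.Finite C (M ⧸ N') :=
      Module.Finite.of_surjective (Submodule.factor hle) (Submodule.factor_surjective hle)
    have hlt : Module.finrank C (M ⧸ N') < n := by
      have h1 := (Submodule.factor hle).finrank_range_add_finrank_ker
      rw [LinearMap.range_eq_top.mpr (Submodule.factor_surjective hle), finrank_top, hn] at h1
      have h2 : N.mkQ v ∈ LinearMap.ker (Submodule.factor hle) := by
        rw [LinearMap.mem_ker]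
        exact (Submodule.Quotient.mk_eq_zero N').mpr hvN'
      have h3 : 0 < Module.finrank C (LinearMap.ker (Submodule.factor hle)) := by
        rw [Module.finrank_pos_iff_exists_ne_zero]
        refine ⟨⟨_, h2⟩, fun h => hv ?_⟩
        exact (Submodule.Quotient.mk_eq_zero N).mp (congrArg Subtype.val h)
      lia
    obtain ⟨f'', h1, h2⟩ := ih _ hlt N' hN' f' hf' rfl
    exact ⟨f'', fun n hn => (h1 n (hle hn)).trans (hff' n hn), h2⟩

/-- A vector which is not nilpotent modulo a stable subspace is detected by a functional. -/
theorem exists_compatible_apply_ne_zero [IsAlgClosed C]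
    (hτ : ∀ (c : C) m, τ (c • m) = c ^ Nat.card F • τ m)
    (N : Submodule C M) (hN : ∀ n ∈ N, τ n ∈ N) (hN' : ∀ m, τ m ∈ N → m ∈ N)
    [Module.Finite C (M ⧸ N)] {v : M} (hv : v ∉ N) :
    ∃ f : M →ₗ[C] C, (∀ n ∈ N, f n = 0) ∧ (∀ m, f (τ m) = f m ^ Nat.card F) ∧ f v ≠ 0 := by
  have hq := two_le_natCard F
  obtain ⟨k, hk, n₀, hn₀, c, hkv, h⟩ := exists_extend_step hτ N hN hv
  -- Otherwise $\tau^kv$ would lie in `N`, and `hN'` would descend this to `v`.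
  have hc : c ≠ 0 := by
    rintro rfl
    have h1 : ∀ j, τ^[j] v ∉ N := by
      intro j
      induction j with
      | zero => exact hv
      | succ j ih =>
        rw [Function.iterate_succ_apply']
        exact fun h => ih (hN' _ h)
    refine h1 k ?_
    rw [hkv]
    simpa using hn₀
  obtain ⟨y, hy0, hy⟩ := exists_root_additive_ne_zero (F := F) c hc
  obtain ⟨N', f', hle, hvN', hN', hff', hfv, hf'⟩ := h 0
    (fun n _ => by simp [show Nat.card F ≠ 0 by lia]) y (by simpa using hy)
  have hfin : Module.Finite C (M ⧸ N') :=
    Module.Finite.of_surjective (Submodule.factor hle) (Submodule.factor_surjective hle)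
  obtain ⟨f'', h1, h2⟩ := exists_extend_compatible hτ N' hN' f' hf'
  exact ⟨f'', fun n hn => (h1 n (hle hn)).trans (hff' n hn), h2, by rwa [h1 v hvN', hfv]⟩

end FrobeniusModule

/-! ### Frobenius modules over a polynomial ring -/

section FrobeniusPolynomialModule

open Polynomial

/-- A finitely generated module over `C[X]` killed by a nonzero polynomial is finite-dimensional. -/
theorem finite_of_forall_smul_eq_zero {C W : Type*} [Field C] [AddCommGroup W] [Module C W]
    [Module C[X] W] [IsScalarTower C C[X] W] [Module.Finite C[X] W] {G : C[X]} (hG : G ≠ 0)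
    (h : ∀ w : W, G • w = 0) : Module.Finite C W := by
  classical
  obtain ⟨s, hs⟩ := Module.Finite.fg_top (R := C[X]) (M := W)
  let S : Finset W := Finset.image₂ (fun (i : ℕ) (w : W) => (X ^ i : C[X]) • w)
    (Finset.range G.natDegree) s
  have key : ∀ (p : C[X]), ∀ w ∈ s, p • w ∈ Submodule.span C (S : Set W) := by
    intro p w hw
    have h1 : p • w = (p % G) • w := by
      nth_rw 1 [← EuclideanDomain.mod_add_div p G]
      rw [add_smul, mul_smul, h, add_zero]
    by_cases h0 : p % G = 0
    · rw [h1, h0, zero_smul]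
      exact zero_mem _
    have h2 : (p % G).natDegree < G.natDegree :=
      natDegree_lt_natDegree h0 (EuclideanDomain.mod_lt p hG)
    rw [h1, (p % G).as_sum_range' _ h2, Finset.sum_smul]
    refine sum_mem fun i hi => ?_
    rw [← C_mul_X_pow_eq_monomial, ← smul_eq_C_mul, smul_assoc]
    exact Submodule.smul_mem _ _ (Submodule.subset_span
      (Finset.mem_coe.mpr (Finset.mem_image₂_of_mem hi hw)))
  refine ⟨⟨S, ?_⟩⟩
  rw [eq_top_iff]
  rintro w -
  have hw : w ∈ Submodule.span C[X] (s : Set W) := hs ▸ trivial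
  induction hw using Submodule.span_induction with
  | mem w hw => simpa using key 1 w hw
  | zero => exact zero_mem _
  | add x y _ _ hx hy => exact add_mem hx hy
  | smul p x hx hx' =>
    clear hx'
    induction hx using Submodule.span_induction generalizing p with
    | mem w hw => exact key p w hw
    | zero => rw [smul_zero]; exact zero_mem _
    | add x y _ _ hx hy => rw [smul_add]; exact add_mem (hx p) (hy p)
    | smul r x _ hx => rw [← mul_smul]; exact hx _

variable {F C M : Type*} [Field F] [Finite F] [Field C] [Algebra F C] [AddCommGroup M] [Module C M]
  [Module C[X] M] [IsScalarTower C C[X] M] {τ : M →+ M}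

theorem frobenius_smul (hτ : ∀ (c : C) m, τ (c • m) = c ^ Nat.card F • τ m)
    (hX : ∀ m, τ ((X : C[X]) • m) = (X : C[X]) • τ m) (p : C[X]) (m : M) :
    τ (p • m) = p.map (frob F C : C →+* C) • τ m := by
  induction p using Polynomial.induction_on' generalizing m with
  | add p q hp hq => rw [add_smul, map_add, hp, hq, Polynomial.map_add, add_smul]
  | monomial n a =>
    have hXn : ∀ m, τ ((X ^ n : C[X]) • m) = (X ^ n : C[X]) • τ m := by
      intro m
      induction n with
      | zero => simp
      | succ n ih => rw [pow_succ', mul_smul, hX, ih, ← mul_smul]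
    rw [Polynomial.map_monomial, ← C_mul_X_pow_eq_monomial, ← C_mul_X_pow_eq_monomial,
      ← smul_eq_C_mul, ← smul_eq_C_mul, smul_assoc, smul_assoc, hτ, hXn,
      RingHom.coe_coe, frob_apply]

theorem map_frob_map_algebraMap (g : F[X]) :
    (g.map (algebraMap F C)).map (frob F C : C →+* C) = g.map (algebraMap F C) := by
  rw [Polynomial.map_map]
  congr 1
  ext c
  simp

/-- Finitely generated Frobenius modules on which the Frobenius is far from nilpotent are
torsion-free. -/
theorem isTorsionFree_of_linearIndependent [Module.Finite C[X] M]
    (hτ : ∀ (c : C) m, τ (c • m) = c ^ Nat.card F • τ m)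
    (hX : ∀ m, τ ((X : C[X]) • m) = (X : C[X]) • τ m)
    (hind : ∀ m ≠ 0, LinearIndependent C (fun k : ℕ => τ^[k] m)) : Module.IsTorsionFree C[X] M := by
  rw [Submodule.isTorsionFree_iff_torsion_eq_bot, eq_bot_iff]
  intro m hm
  by_contra h0
  obtain ⟨G, hG, hG0⟩ := Submodule.annihilator_top_inter_nonZeroDivisors
    (Submodule.torsion_isTorsion (R := C[X]) (M := M))
  -- The torsion is finite-dimensional over `C` and stable under `τ`, so it has no room for
  -- infinitely many independent iterates.
  have hfin : Module.Finite C (Submodule.torsion C[X] M) := by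
    refine finite_of_forall_smul_eq_zero (nonZeroDivisors.ne_zero hG0) fun w => ?_
    rw [SetLike.mem_coe, Submodule.mem_annihilator] at hG
    exact hG w trivial
  have hmem : ∀ k : ℕ, τ^[k] m ∈ Submodule.torsion C[X] M := by
    intro k
    induction k with
    | zero => exact hm
    | succ k ih =>
      rw [Function.iterate_succ_apply']
      obtain ⟨p, hp⟩ := (Submodule.mem_torsion_iff _).mp ih
      refine (Submodule.mem_torsion_iff (R := C[X]) _).mpr
        ⟨⟨(p : C[X]).map (frob F C : C →+* C), mem_nonZeroDivisors_of_ne_zero ?_⟩, ?_⟩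
      · rw [Polynomial.map_ne_zero_iff (RingHom.injective _)]
        exact nonZeroDivisors.ne_zero p.2
      · change (p : C[X]).map (frob F C : C →+* C) • τ (τ^[k] m) = 0
        rw [← frobenius_smul hτ hX]
        exact (congrArg τ (show (p : C[X]) • τ^[k] m = 0 from hp)).trans (map_zero τ)
  have hli : LinearIndependent C (fun k : ℕ => (⟨τ^[k] m, hmem k⟩ : Submodule.torsion C[X] M)) :=
    LinearIndependent.of_comp ((Submodule.torsion C[X] M).subtype.restrictScalars C) (hind m h0)
  exact not_finite_iff_infinite.mpr inferInstance hli.finite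

theorem finite_quotient_range_smul [Module.Finite C[X] M] {g : C[X]} (hg : g ≠ 0) :
    Module.Finite C
      (M ⧸ (LinearMap.range (LinearMap.lsmul C[X] M g)).restrictScalars C) := by
  have : Module.Finite C (M ⧸ LinearMap.range (LinearMap.lsmul C[X] M g)) := by
    refine finite_of_forall_smul_eq_zero hg fun w => ?_
    obtain ⟨m, rfl⟩ := Submodule.Quotient.mk_surjective _ w
    rw [← Submodule.Quotient.mk_smul, Submodule.Quotient.mk_eq_zero]
    exact ⟨m, rfl⟩
  exact Module.Finite.equiv (Submodule.Quotient.restrictScalarsEquiv C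
    (LinearMap.range (LinearMap.lsmul C[X] M g))).symm

/-- Divisibility of the group of compatible functionals. -/
theorem exists_compatible_smul_eq [IsAlgClosed C] [Module.Finite C[X] M]
    [Module.IsTorsionFree C[X] M]
    (hτ : ∀ (c : C) m, τ (c • m) = c ^ Nat.card F • τ m)
    (hX : ∀ m, τ ((X : C[X]) • m) = (X : C[X]) • τ m) {g : F[X]} (hg : g ≠ 0)
    (e : M →ₗ[C] C) (he : ∀ m, e (τ m) = e m ^ Nat.card F) :
    ∃ e' : M →ₗ[C] C, (∀ m, e' (τ m) = e' m ^ Nat.card F) ∧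
      ∀ m, e' (g.map (algebraMap F C) • m) = e m := by
  set G := g.map (algebraMap F C)
  have hG : G ≠ 0 := (Polynomial.map_ne_zero_iff (algebraMap F C).injective).mpr hg
  let T : M →ₗ[C] M := (LinearMap.lsmul C[X] M G).restrictScalars C
  have hT : LinearMap.ker T = ⊥ :=
    LinearMap.ker_eq_bot.mpr fun x y hxy => smul_right_injective M hG hxy
  obtain ⟨h, hh⟩ := LinearMap.exists_leftInverse_of_injective T hT
  have hh' : ∀ m, h (G • m) = m := fun m => LinearMap.congr_fun hh m
  have hτG : ∀ m, τ (G • m) = G • τ m := fun m => by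
    rw [frobenius_smul hτ hX, map_frob_map_algebraMap]
  have := finite_quotient_range_smul (M := M) hG
  -- On $GM$ the functional is forced to be $e\circ G^{-1}$; it is compatible because `G` has
  -- coefficients fixed by the Frobenius, and $M/GM$ is finite-dimensional.
  obtain ⟨e', h1, h2⟩ := exists_extend_compatible hτ
    ((LinearMap.range (LinearMap.lsmul C[X] M G)).restrictScalars C) (by
      rintro _ ⟨m, rfl⟩
      exact ⟨τ m, (hτG m).symm⟩) (e.comp h) (by
      rintro _ ⟨m, rfl⟩
      rw [LinearMap.lsmul_apply, hτG, LinearMap.comp_apply, LinearMap.comp_apply, hh', hh', he])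
  refine ⟨e', h2, fun m => ?_⟩
  exact (h1 (G • m) ⟨m, rfl⟩).trans (congrArg e (hh' m))

/-- The `X`-torsion points of a Frobenius module of rank `r` contain `r` points which are linearly
independent over `C`. -/
theorem exists_torsion_det_ne_zero [IsAlgClosed C] [Module.Finite C[X] M]
    (hτ : ∀ (c : C) m, τ (c • m) = c ^ Nat.card F • τ m)
    (hX : ∀ m, τ ((X : C[X]) • m) = (X : C[X]) • τ m)
    (hX' : ∀ m n, τ m = (X : C[X]) • n → ∃ n', m = (X : C[X]) • n') {r : ℕ}
    (b : Module.Basis (Fin r) C[X] M) :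
    ∃ e : Fin r → M →ₗ[C] C, (∀ j m, e j (τ m) = e j m ^ Nat.card F) ∧
      (∀ j m, e j ((X : C[X]) • m) = 0) ∧ (Matrix.of fun i j => e j (b i)).det ≠ 0 := by
  let S : Set (Fin r → C) := {v | ∃ e : M →ₗ[C] C, (∀ m, e (τ m) = e m ^ Nat.card F) ∧
      (∀ m, e ((X : C[X]) • m) = 0) ∧ v = fun i => e (b i)}
  have hS : Submodule.span C S = ⊤ := by
    -- A linear form `f` killing all torsion values is turned into the vector $m=\sum f_ib_i$, which
    -- every `X`-torsion point kills. Hence $m\in XM$, but its coordinates are constants, so `f`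
    -- vanishes.
    by_contra hne
    obtain ⟨f, hf0, hf⟩ := Submodule.exists_le_ker_of_lt_top _ (lt_top_iff_ne_top.mpr hne)
    refine hf0 ?_
    let m : M := ∑ i, f (Pi.single i 1) • b i
    have hfv : ∀ v, f v = ∑ i, f (Pi.single i 1) * v i := by
      intro v
      rw [f.pi_apply_eq_sum_univ v]
      refine Finset.sum_congr rfl fun i _ => ?_
      rw [smul_eq_mul, mul_comm]
      congr 2
      funext j
      simp [Pi.single_apply, eq_comm]
    have hm : m ∈ (LinearMap.range (LinearMap.lsmul C[X] M X)).restrictScalars C := by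
      by_contra hm
      have := finite_quotient_range_smul (M := M) (C := C) X_ne_zero
      obtain ⟨e, h1, h2, h3⟩ := exists_compatible_apply_ne_zero hτ _ (by
        rintro _ ⟨m, rfl⟩
        exact ⟨τ m, (hX m).symm⟩) (by
        rintro m ⟨n, hn⟩
        obtain ⟨n', hn'⟩ := hX' m n hn.symm
        exact ⟨n', hn'.symm⟩) hm
      refine h3 ?_
      have h4 : f (fun i => e (b i)) = 0 :=
        hf (Submodule.subset_span ⟨e, h2, fun m => h1 _ ⟨m, rfl⟩, rfl⟩)
      rw [hfv] at h4
      simpa only [m, map_sum, map_smul, smul_eq_mul] using h4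
    obtain ⟨n, hn⟩ := hm
    have hc : ∀ i, f (Pi.single i 1) = 0 := by
      intro i
      have h1 := congrArg (fun m => (b.repr m i).coeff 0) hn
      have h2 : b.repr m i = Polynomial.C (f (Pi.single i 1)) := by
        have h3 : m = ∑ j, Polynomial.C (f (Pi.single j 1)) • b j :=
          Finset.sum_congr rfl fun j _ => by
            rw [← algebraMap_smul C[X] (f (Pi.single j 1)) (b j)]
            rfl
        rw [h3, b.repr_sum_self]
      simp only [LinearMap.lsmul_apply, map_smul, Finsupp.smul_apply, smul_eq_mul, coeff_X_mul_zero,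
        h2, coeff_C_zero] at h1
      exact h1.symm
    ext v
    simp [hc]
  obtain ⟨B, hB, hBspan, hBli⟩ := exists_linearIndependent C S
  let bB := Module.Basis.mk hBli (by
    rw [Subtype.range_coe, hBspan, hS])
  have : Finite B := Module.Finite.finite_basis bB
  let ε : Fin r ≃ B := (Pi.basisFun C (Fin r)).indexEquiv bB
  choose e h1 h2 h3 using fun j : Fin r => hB (ε j).2
  refine ⟨e, h1, h2, ?_⟩
  have hli : LinearIndependent C (fun j : Fin r => ((ε j : B) : Fin r → C)) :=
    hBli.comp ε ε.injective
  have h4 : IsUnit (Matrix.of fun j i => e j (b i)) := by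
    rw [← Matrix.linearIndependent_rows_iff_isUnit]
    convert! hli using 1
    funext j
    exact (h3 j).symm
  rw [Matrix.isUnit_iff_isUnit_det, isUnit_iff_ne_zero, ← Matrix.det_transpose] at h4
  exact h4

end FrobeniusPolynomialModule

/-! ### Restricted power series and the Frobenius -/

section Tate

open Filter PowerSeries
open scoped Topology

/-- The ring of restricted power series. -/
abbrev tateAlgebra (C : Type*) [NormedField C] [IsUltrametricDist C] : Subring (PowerSeries C) :=
  PowerSeries.IsRestricted.subring 1

section

variable {C : Type*} [NormedField C] [IsUltrametricDist C]

theorem mem_tateAlgebra_iff {f : PowerSeries C} :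
    f ∈ tateAlgebra C ↔ Tendsto (fun n => coeff n f) atTop (𝓝 0) := by
  rw [tendsto_zero_iff_norm_tendsto_zero]
  refine (isRestricted_iff' 1 f).trans ?_
  simp

theorem C_mem_tateAlgebra (a : C) : PowerSeries.C a ∈ tateAlgebra C := isRestricted_C 1 a

theorem coe_mem_tateAlgebra (p : Polynomial C) : (p : PowerSeries C) ∈ tateAlgebra C := by
  rw [mem_tateAlgebra_iff]
  refine tendsto_const_nhds.congr' ?_
  filter_upwards [eventually_gt_atTop p.natDegree] with n hn
  rw [Polynomial.coeff_coe, Polynomial.coeff_eq_zero_of_natDegree_lt hn]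

theorem map_frob_mem_tateAlgebra {F : Type*} [Field F] [Finite F] [Algebra F C] {f : PowerSeries C}
    (hf : f ∈ tateAlgebra C) : PowerSeries.map (frob F C : C →+* C) f ∈ tateAlgebra C := by
  rw [mem_tateAlgebra_iff] at hf ⊢
  have h := hf.pow (Nat.card F)
  rw [zero_pow (by have := two_le_natCard F; lia)] at h
  simpa [frob_apply] using h

/-- The equation `β y ^ q + y = w` has a small solution. -/
theorem exists_root_norm_le [IsAlgClosed C] {q : ℕ} (hq : 2 ≤ q) {β : C} (hβ : β ≠ 0) (w : C) :
    ∃ y : C, β * y ^ q + y = w ∧ ‖y‖ ≤ ‖w‖ := by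
  -- If every root is larger than `w`, then $|\beta y^q|=|y|$ for each, so all roots have the same
  -- norm. Their product then gives $|w|=|\beta||y_1|^q=|y_1|$.
  by_contra! hcon
  let Q : Polynomial C := Polynomial.C β * Polynomial.X ^ q + (Polynomial.X - Polynomial.C w)
  have hdlt : (Polynomial.X - Polynomial.C w).degree < (Polynomial.C β * Polynomial.X ^ q).degree := by
    rw [Polynomial.degree_X_sub_C, Polynomial.degree_C_mul_X_pow _ hβ]
    exact_mod_cast (by lia : 1 < q)
  have hQ0 : Q.natDegree = q := by
    rw [Polynomial.natDegree_add_eq_left_of_degree_lt hdlt, Polynomial.natDegree_C_mul_X_pow _ _ hβ]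
  have hlead : Q.leadingCoeff = β := by
    rw [Polynomial.leadingCoeff_add_of_degree_lt' hdlt, Polynomial.leadingCoeff_C_mul_X_pow]
  have hQne : Q ≠ 0 := by
    rintro h
    rw [h, Polynomial.leadingCoeff_zero] at hlead
    exact hβ hlead.symm
  have hsp := IsAlgClosed.splits Q
  have hroot : ∀ y ∈ Q.roots, ‖β‖ * ‖y‖ ^ q = ‖y‖ := by
    intro y hy
    have h1 : β * y ^ q + y = w := by
      have := (Polynomial.mem_roots hQne).mp hy
      simp only [Q, Polynomial.IsRoot, Polynomial.eval_add, Polynomial.eval_mul, Polynomial.eval_C,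
        Polynomial.eval_pow, Polynomial.eval_X, Polynomial.eval_sub] at this
      linear_combination this
    have h2 := hcon y h1
    have h3 : β * y ^ q = w + -y := by rw [← h1]; ring
    rw [← norm_pow, ← norm_mul, h3,
      IsUltrametricDist.norm_add_eq_max_of_norm_ne_norm (by rw [norm_neg]; exact h2.ne), norm_neg,
      max_eq_right h2.le]
  have hcard : Q.roots.card = q := by rw [← hsp.natDegree_eq_card_roots, hQ0]
  obtain ⟨y₁, hy₁⟩ := Multiset.card_pos_iff_exists_mem.mp (by lia : 0 < Q.roots.card)
  have hlt : ∀ y ∈ Q.roots, ‖w‖ < ‖y‖ := by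
    intro y hy
    refine hcon y ?_
    have := (Polynomial.mem_roots hQne).mp hy
    simp only [Q, Polynomial.IsRoot, Polynomial.eval_add, Polynomial.eval_mul, Polynomial.eval_C,
      Polynomial.eval_pow, Polynomial.eval_X, Polynomial.eval_sub] at this
    linear_combination this
  have hpow : ∀ y ∈ Q.roots, ‖y‖ ^ (q - 1) = ‖β‖⁻¹ := by
    intro y hy
    have h1 := hroot y hy
    have h2 : ‖y‖ ≠ 0 := ((norm_nonneg w).trans_lt (hlt y hy)).ne'
    rw [← Nat.sub_add_cancel (by lia : 1 ≤ q), pow_succ, ← mul_assoc] at h1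
    exact eq_inv_of_mul_eq_one_right (mul_eq_right₀ h2 |>.mp h1)
  have heq : ∀ y ∈ Q.roots, ‖y‖ = ‖y₁‖ := fun y hy =>
    (pow_left_inj₀ (norm_nonneg _) (norm_nonneg _) (by lia : q - 1 ≠ 0)).mp
      ((hpow y hy).trans (hpow y₁ hy₁).symm)
  have hprod := hsp.coeff_zero_eq_leadingCoeff_mul_prod_roots
  have h0 : Q.coeff 0 = -w := by
    simp [Q, Polynomial.coeff_X_pow, (by lia : 0 ≠ q)]
  rw [h0, hlead] at hprod
  have hn := congrArg norm hprod
  have hm : ‖Q.roots.prod‖ = ‖y₁‖ ^ q := by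
    have h1 : ‖Q.roots.prod‖ = (Q.roots.map (normHom : C →*₀ ℝ)).prod :=
      map_multiset_prod (normHom : C →*₀ ℝ) _
    rw [h1, Multiset.map_congr (f := normHom) (g := fun _ => ‖y₁‖) rfl heq, Multiset.map_const', Multiset.prod_replicate, hcard]
  rw [norm_neg, norm_mul, norm_mul, norm_pow, norm_neg, norm_one, one_pow, one_mul, hm,
    hroot y₁ hy₁] at hn
  exact (hlt y₁ hy₁).ne hn

/-- Artin-Schreier equations are solved coefficient by coefficient; taking a small root each time
keeps the coefficients tending to zero. -/
theorem exists_tateAlgebra_frob_sub_eq [IsAlgClosed C] (F : Type*) [Field F] [Finite F] [Algebra F C]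
    {ρ : PowerSeries C} (hρ : ρ ∈ tateAlgebra C) :
    ∃ W ∈ tateAlgebra C, PowerSeries.map (frob F C : C →+* C) W - W = ρ := by
  have h : ∀ n, ∃ y : C, y ^ Nat.card F - y = coeff n ρ ∧ ‖y‖ ≤ ‖coeff n ρ‖ := by
    intro n
    obtain ⟨y, h1, h2⟩ := exists_root_norm_le (two_le_natCard F) (neg_ne_zero.mpr (one_ne_zero (α := C)))
      (-coeff n ρ)
    rw [norm_neg] at h2
    exact ⟨y, by linear_combination -h1, h2⟩
  choose y h1 h2 using h
  refine ⟨PowerSeries.mk y, ?_, ?_⟩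
  · rw [mem_tateAlgebra_iff] at hρ ⊢
    simp only [coeff_mk]
    exact squeeze_zero_norm h2 (tendsto_zero_iff_norm_tendsto_zero.mp hρ)
  · ext n
    simp [frob_apply, h1]

/-- A restricted power series fixed by the Frobenius is a polynomial over the finite field. -/
theorem exists_polynomial_of_map_frob_eq (F : Type*) [Field F] [Finite F] [Algebra F C]
    {G : PowerSeries C} (hG : G ∈ tateAlgebra C)
    (hfix : PowerSeries.map (frob F C : C →+* C) G = G) :
    ∃ g : Polynomial F, ((g.map (algebraMap F C) : Polynomial C) : PowerSeries C) = G := by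
  have h : ∀ n, ∃ c : F, algebraMap F C c = coeff n G := by
    intro n
    refine exists_algebraMap_eq_of_pow_card_eq F ?_
    have := congrArg (coeff n) hfix
    rwa [PowerSeries.coeff_map, RingHom.coe_coe, frob_apply] at this
  choose c hc using h
  rw [mem_tateAlgebra_iff] at hG
  obtain ⟨N, hN⟩ := ((hG.norm).eventually_lt_const (by simp : ‖(0 : C)‖ < 1)).exists_forall_of_atTop
  have hc0 : ∀ n ≥ N, c n = 0 := by
    intro n hn
    by_contra h0
    -- Nonzero constants are roots of unity, of norm one, so coefficients of norm less than one
    -- vanish.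
    have h1 : c n ^ (Nat.card F - 1) = 1 := by
      let := Fintype.ofFinite F
      rw [Nat.card_eq_fintype_card]
      exact FiniteField.pow_card_sub_one_eq_one _ h0
    have h2 := congrArg (fun x => ‖algebraMap F C x‖) h1
    simp only [map_pow, map_one, norm_one, norm_pow, hc] at h2
    have h3 := pow_lt_one₀ (norm_nonneg _) (hN n hn)
      (by have := two_le_natCard F; lia : Nat.card F - 1 ≠ 0)
    exact h3.ne h2
  refine ⟨∑ n ∈ Finset.range N, Polynomial.monomial n (c n), ?_⟩
  ext n
  rw [Polynomial.coeff_coe, Polynomial.coeff_map, Polynomial.finsetSum_coeff, ← hc]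
  congr 1
  simp only [Polynomial.coeff_monomial, Finset.sum_ite_eq', Finset.mem_range]
  split_ifs with h
  · rfl
  · exact (hc0 n (not_lt.mp h)).symm

/-- The power series `Ω` with `Ω = (X - θ) Ω^{(1)}`. -/
theorem exists_omega [IsAlgClosed C] (F : Type*) [Field F] [Finite F] [Algebra F C] {θ : C}
    (hθ : 1 < ‖θ‖) :
    ∃ Ω ∈ tateAlgebra C, constantCoeff Ω ≠ 0 ∧
      Ω = (PowerSeries.X - PowerSeries.C θ) * PowerSeries.map (frob F C : C →+* C) Ω := by
  have hq := two_le_natCard F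
  have hθ0 : θ ≠ 0 := norm_pos_iff.mp (one_pos.trans hθ)
  -- The constant coefficient must satisfy $y_0=-\theta y_0^q$, that is $y_0^{q-1}=-\theta^{-1}$.
  obtain ⟨y₀, hy₀⟩ := IsAlgClosed.exists_pow_nat_eq (-θ⁻¹) (by lia : 0 < Nat.card F - 1)
  have hn₀ : ‖y₀‖ < 1 := by
    rw [← pow_lt_one_iff_of_nonneg (norm_nonneg _) (by lia : Nat.card F - 1 ≠ 0), ← norm_pow, hy₀,
      norm_neg, norm_inv]
    exact inv_lt_one_of_one_lt₀ hθ
  have hy₀0 : y₀ ≠ 0 := by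
    rintro rfl
    rw [zero_pow (by lia)] at hy₀
    exact neg_ne_zero.mpr (inv_ne_zero hθ0) hy₀.symm
  -- The next coefficient solves $\theta y_{n+1}^q+y_{n+1}=y_n^q$; a small root gives
  -- $|y_{n+1}|\le|y_n|^q$, hence geometric decay from $|y_0|<1$.
  choose s h1 h2 using fun w : C => exists_root_norm_le hq hθ0 w
  let y : ℕ → C := fun n => Nat.rec y₀ (fun _ y => s (y ^ Nat.card F)) n
  have hsucc : ∀ n, y (n + 1) = s (y n ^ Nat.card F) := fun n => rfl
  have hbound : ∀ n, ‖y n‖ ≤ ‖y₀‖ ^ (n + 1) := by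
    intro n
    induction n with
    | zero =>
      rw [zero_add, pow_one]
      exact le_rfl
    | succ n ih =>
      rw [hsucc]
      refine (h2 _).trans ?_
      rw [norm_pow]
      refine (pow_le_pow_left₀ (norm_nonneg _) ih _).trans ?_
      rw [← pow_mul]
      refine pow_le_pow_of_le_one (norm_nonneg _) hn₀.le ?_
      nlinarith
  refine ⟨PowerSeries.mk y, ?_, hy₀0, ?_⟩
  · rw [mem_tateAlgebra_iff]
    simp only [coeff_mk]
    refine squeeze_zero_norm hbound ?_
    exact (tendsto_pow_atTop_nhds_zero_of_lt_one (norm_nonneg _) hn₀).comp (tendsto_add_atTop_nat 1)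
  · ext n
    rw [sub_mul, map_sub, coeff_C_mul, coeff_mk, PowerSeries.coeff_map, coeff_mk, RingHom.coe_coe,
      frob_apply]
    cases n with
    | zero =>
      rw [coeff_zero_X_mul, zero_sub]
      change y₀ = -(θ * y₀ ^ Nat.card F)
      rw [← Nat.sub_add_cancel (by lia : 1 ≤ Nat.card F), pow_succ, hy₀]
      field_simp
    | succ n =>
      rw [coeff_succ_X_mul, PowerSeries.coeff_map, coeff_mk, RingHom.coe_coe, frob_apply, hsucc]
      linear_combination h1 (y n ^ Nat.card F)

end

end Tate

/-! ### Generating series of division towers -/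

section DivisionTower

open Filter
open scoped Topology Polynomial PowerSeries

section Field

variable {C M : Type*} [Field C] [AddCommGroup M] [Module C M]

/-- The generating series of a sequence of functionals. -/
def genSeries (e : ℕ → M →ₗ[C] C) : M →ₗ[C] C⟦X⟧ where
  toFun m := PowerSeries.mk fun n => e n m
  map_add' m m' := by ext n; simp
  map_smul' c m := by ext n; simp

theorem coeff_genSeries (e : ℕ → M →ₗ[C] C) (n : ℕ) (m : M) :
    PowerSeries.coeff n (genSeries e m) = e n m :=
  PowerSeries.coeff_mk n fun n => e n m

theorem genSeries_frobenius {F : Type*} [Field F] [Finite F] [Algebra F C]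
    {e : ℕ → M →ₗ[C] C} {τ : M →+ M}
    (he : ∀ n m, e n (τ m) = e n m ^ Nat.card F) (m : M) :
    genSeries e (τ m) = PowerSeries.map (frob F C : C →+* C) (genSeries e m) := by
  ext n
  rw [coeff_genSeries, PowerSeries.coeff_map, coeff_genSeries, RingHom.coe_coe, frob_apply, he]

variable [Module C[X] M]

theorem genSeries_X_smul {e : ℕ → M →ₗ[C] C}
    (he : ∀ n m, e (n + 1) ((Polynomial.X : C[X]) • m) = e n m) (m : M) :
    genSeries e ((Polynomial.X : C[X]) • m) =
      PowerSeries.X * genSeries e m + PowerSeries.C (e 0 ((Polynomial.X : C[X]) • m)) := by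
  ext n
  cases n with
  | zero => simp [coeff_genSeries]
  | succ n =>
    rw [coeff_genSeries, map_add, PowerSeries.coeff_succ_X_mul, coeff_genSeries, he,
      PowerSeries.coeff_C, if_neg n.succ_ne_zero, add_zero]

variable [IsScalarTower C C[X] M]

theorem C_smul_eq_smul (a : C) (m : M) : (Polynomial.C a : C[X]) • m = a • m := by
  rw [← Polynomial.algebraMap_eq, algebraMap_smul]

theorem genSeries_C_smul (e : ℕ → M →ₗ[C] C) (a : C) (m : M) :
    genSeries e ((Polynomial.C a : C[X]) • m) = PowerSeries.C a * genSeries e m := by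
  rw [C_smul_eq_smul, map_smul, PowerSeries.smul_eq_C_mul]

/-- The generating series of a division tower of zero is linear. -/
theorem genSeries_smul {e : ℕ → M →ₗ[C] C}
    (h0 : ∀ m, e 0 ((Polynomial.X : C[X]) • m) = 0)
    (he : ∀ n m, e (n + 1) ((Polynomial.X : C[X]) • m) = e n m) (p : C[X]) (m : M) :
    genSeries e (p • m) = (p : C⟦X⟧) * genSeries e m := by
  induction p using Polynomial.induction_on generalizing m with
  | C a => rw [genSeries_C_smul, Polynomial.coe_C]
  | add p q hp hq => rw [add_smul, map_add, hp, hq, Polynomial.coe_add, add_mul]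
  | monomial n a ih =>
    rw [pow_succ, ← mul_assoc, mul_smul, ih, genSeries_X_smul he, h0, map_zero, add_zero]
    push_cast
    ring

/-- The determinant of the Frobenius is a power of `X - θ`, up to a constant. -/
theorem exists_det_frobenius_eq {F : Type*} [Field F] [Finite F] [Algebra F C] {τ : M →+ M}
    (hτ : ∀ (c : C) m, τ (c • m) = c ^ Nat.card F • τ m)
    (hX : ∀ m, τ ((Polynomial.X : C[X]) • m) = (Polynomial.X : C[X]) • τ m) {θ : C}
    (hθτ : ∀ m, ∃ m', τ m' = (Polynomial.X : C[X]) • m - θ • m) {r : ℕ}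
    (b : Module.Basis (Fin r) C[X] M) :
    ∃ (s : ℕ) (c : C), c ≠ 0 ∧ (Matrix.of fun i k => b.repr (τ (b i)) k).det =
      Polynomial.C c * (Polynomial.X - Polynomial.C θ) ^ s := by
  classical
  set Φ : Matrix (Fin r) (Fin r) C[X] := Matrix.of fun i k => b.repr (τ (b i)) k
  choose m' hm' using fun i => hθτ (b i)
  let P : Matrix (Fin r) (Fin r) C[X] :=
    Matrix.of fun i k => (b.repr (m' i) k).map (frob F C : C →+* C)
  -- Since $X-\theta$ sends `M` into the image of `τ`, the scalar matrix $X-\theta$ factors through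
  -- `Φ`. Thus $\det\Phi$ divides a power of a prime.
  have hP : P * Φ = (Polynomial.X - Polynomial.C θ) • (1 : Matrix (Fin r) (Fin r) C[X]) := by
    ext1 i k
    have h1 : τ (m' i) = ∑ j, P i j • τ (b j) := by
      conv_lhs => rw [← b.sum_repr (m' i), map_sum]
      exact Finset.sum_congr rfl fun j _ => frobenius_smul hτ hX _ _
    have h2 := congrArg (fun m => b.repr m k) (h1.symm.trans (hm' i))
    simp only [← C_smul_eq_smul, ← sub_smul, map_sum, map_smul, Finsupp.coe_finsetSum,
      Finset.sum_apply, Finsupp.smul_apply, Module.Basis.repr_self, smul_eq_mul] at h2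
    rw [Matrix.mul_apply, Matrix.smul_apply, smul_eq_mul, Matrix.one_apply]
    refine h2.trans ?_
    rw [Finsupp.single_apply]
  have hdvd : Φ.det ∣ (Polynomial.X - Polynomial.C θ) ^ r := by
    have := congrArg Matrix.det hP
    rw [Matrix.det_mul, Matrix.det_smul, Matrix.det_one, mul_one, Fintype.card_fin] at this
    exact Dvd.intro_left _ this
  obtain ⟨s, -, u, hu⟩ := (dvd_prime_pow (Polynomial.prime_X_sub_C θ) r).mp hdvd
  obtain ⟨c, hc, hc'⟩ := Polynomial.isUnit_iff.mp (u⁻¹).isUnit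
  refine ⟨s, c, hc.ne_zero, ?_⟩
  rw [hc', ← hu, mul_comm, mul_assoc, Units.mul_inv, mul_one]

end Field

variable {C M : Type*} [NormedField C] [IsUltrametricDist C] [AddCommGroup M] [Module C M]
  [Module C[X] M] [IsScalarTower C C[X] M]

/-- The generating series of a division tower is linear up to restricted series. -/
theorem genSeries_smul_sub_mem {e : ℕ → M →ₗ[C] C}
    (he : ∀ n m, e (n + 1) ((Polynomial.X : C[X]) • m) = e n m) (p : C[X]) (m : M) :
    genSeries e (p • m) - (p : C⟦X⟧) * genSeries e m ∈ tateAlgebra C := by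
  induction p using Polynomial.induction_on generalizing m with
  | C a => rw [genSeries_C_smul, Polynomial.coe_C, sub_self]; exact zero_mem _
  | add p q hp hq =>
    rw [add_smul, map_add, Polynomial.coe_add]
    convert! add_mem (hp m) (hq m) using 1
    ring
  | monomial n a ih =>
    rw [pow_succ, ← mul_assoc, mul_smul]
    have h1 := ih ((Polynomial.X : C[X]) • m)
    rw [genSeries_X_smul he m] at h1
    have h2 := mul_mem (coe_mem_tateAlgebra (Polynomial.C a * Polynomial.X ^ n))
      (C_mem_tateAlgebra (e 0 ((Polynomial.X : C[X]) • m)))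
    convert! add_mem h1 h2 using 1
    push_cast
    ring

end DivisionTower

/-! ### The comparison of an arbitrary division tower with convergent ones -/

section Comparison

open Filter
open scoped Topology Polynomial PowerSeries

variable {F C M : Type*} [Field F] [Finite F] [NormedField C] [IsUltrametricDist C] [IsAlgClosed C]
  [Algebra F C] [AddCommGroup M] [Module C M] [Module C[X] M] [IsScalarTower C C[X] M]
  {τ : M →+ M} {θ : C} {r : ℕ}

/-- Adjugates are polynomial in the entries and preserve restrictedness, whereas the inverse of a
matrix of restricted series may exist only over all power series. -/
theorem adjugate_mulVec_mem_tateAlgebra {C : Type*} [NormedField C] [IsUltrametricDist C] {r : ℕ}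
    {A : Matrix (Fin r) (Fin r) C⟦X⟧} (hA : ∀ i j, A i j ∈ tateAlgebra C) {v : Fin r → C⟦X⟧}
    (hv : ∀ i, v i ∈ tateAlgebra C) (i : Fin r) : A.adjugate.mulVec v i ∈ tateAlgebra C := by
  let A' : Matrix (Fin r) (Fin r) (tateAlgebra C) := Matrix.of fun i j => ⟨A i j, hA i j⟩
  have h1 : A = (tateAlgebra C).subtype.mapMatrix A' := rfl
  have h2 : ∀ j, A.adjugate i j ∈ tateAlgebra C := fun j => by
    rw [h1, ← RingHom.map_adjugate, RingHom.mapMatrix_apply, Matrix.map_apply]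
    exact (A'.adjugate i j).2
  rw [Matrix.mulVec, dotProduct]
  exact sum_mem fun j _ => mul_mem (h2 j) (hv j)

theorem det_mem_tateAlgebra {C : Type*} [NormedField C] [IsUltrametricDist C] {r : ℕ}
    {A : Matrix (Fin r) (Fin r) C⟦X⟧} (hA : ∀ i j, A i j ∈ tateAlgebra C) :
    A.det ∈ tateAlgebra C := by
  let A' : Matrix (Fin r) (Fin r) (tateAlgebra C) := Matrix.of fun i j => ⟨A i j, hA i j⟩
  have h1 : A = (tateAlgebra C).subtype.mapMatrix A' := rfl
  rw [h1, ← RingHom.map_det]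
  exact A'.det.2

/-- A determinant `f` of convergent towers divides a polynomial over the finite field. -/
theorem exists_mul_eq_polynomial (hθ : 1 < ‖θ‖) {f : C⟦X⟧} (hf : f ∈ tateAlgebra C)
    (hf0 : PowerSeries.constantCoeff f ≠ 0) {s : ℕ} {c : C} (hc : c ≠ 0)
    (hfs : PowerSeries.map (frob F C : C →+* C) f =
      ((Polynomial.C c * (Polynomial.X - Polynomial.C θ) ^ s : C[X]) : C⟦X⟧) * f) :
    ∃ g : F[X], g ≠ 0 ∧ ∃ k ∈ tateAlgebra C, ((g.map (algebraMap F C) : C[X]) : C⟦X⟧) = f * k := by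
  have hq := two_le_natCard F
  obtain ⟨Ω, hΩ, hΩ0, hΩeq⟩ := exists_omega F hθ
  -- With $c\,c_0^q=c_0$, the factor $c_0\Omega^s$ compensates $c(X-\theta)^s$, so $f c_0\Omega^s$
  -- is fixed by the Frobenius and is a polynomial over `F`.
  obtain ⟨c₀, hc₀⟩ := IsAlgClosed.exists_pow_nat_eq c⁻¹ (by lia : 0 < Nat.card F - 1)
  have hc₀0 : c₀ ≠ 0 := by
    rintro rfl
    rw [zero_pow (by lia)] at hc₀
    exact inv_ne_zero hc hc₀.symm
  have hc₀' : c * c₀ ^ Nat.card F = c₀ := by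
    rw [← Nat.sub_add_cancel (by lia : 1 ≤ Nat.card F), pow_succ, hc₀, mul_inv_cancel_left₀ hc]
  have hk : PowerSeries.C c₀ * Ω ^ s ∈ tateAlgebra C :=
    mul_mem (C_mem_tateAlgebra c₀) (pow_mem hΩ s)
  obtain ⟨g, hg⟩ := exists_polynomial_of_map_frob_eq F (mul_mem hf hk) (by
    rw [map_mul, map_mul, map_pow, hfs, PowerSeries.map_C, RingHom.coe_coe, frob_apply]
    push_cast
    conv_rhs => rw [hΩeq, mul_pow, ← hc₀', map_mul]
    ring)
  refine ⟨g, ?_, _, hk, hg⟩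
  rintro rfl
  have h0 := congrArg PowerSeries.constantCoeff hg
  rw [map_mul, map_mul, map_pow, PowerSeries.constantCoeff_C, Polynomial.map_zero,
    Polynomial.coe_zero, map_zero] at h0
  exact mul_ne_zero hf0 (mul_ne_zero hc₀0 (pow_ne_zero _ hΩ0)) h0.symm

/-- The sequences of functionals tending to zero which are compatible with the shift. -/
theorem tendsto_of_basis {C M : Type*} [NormedField C] [AddCommGroup M] [Module C M]
    [Module C[X] M] [IsScalarTower C C[X] M] {r : ℕ} {D : ℕ → M →ₗ[C] C}
    (hD : ∀ n m, D (n + 1) ((Polynomial.X : C[X]) • m) = D n m) (b : Module.Basis (Fin r) C[X] M)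
    (hb : ∀ i, Tendsto (fun n => D n (b i)) atTop (𝓝 0)) (m : M) :
    Tendsto (fun n => D n m) atTop (𝓝 0) := by
  have hp : ∀ (p : C[X]) (m : M), Tendsto (fun n => D n m) atTop (𝓝 0) →
      Tendsto (fun n => D n (p • m)) atTop (𝓝 0) := by
    intro p
    induction p using Polynomial.induction_on with
    | C a =>
      intro m hm
      simp only [C_smul_eq_smul, map_smul, smul_eq_mul]
      simpa using hm.const_mul a
    | add p q hp hq =>
      intro m hm
      simp only [add_smul, map_add]
      simpa using (hp m hm).add (hq m hm)
    | monomial n a ih =>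
      intro m hm
      rw [pow_succ, ← mul_assoc, mul_smul]
      refine ih _ ?_
      rw [← tendsto_add_atTop_iff_nat 1]
      simpa only [hD] using hm
  rw [← b.sum_repr m]
  simp only [map_sum]
  simpa using tendsto_finsetSum Finset.univ fun i _ => hp (b.repr m i) (b i) (hb i)

/-- Over a Frobenius module of rank `r` with `r` independent convergent division towers of zero,
any division tower becomes convergent after multiplication by a fixed polynomial over the finite
field and subtraction of a combination of the given towers. -/
theorem exists_tower_correction (hθ : 1 < ‖θ‖)
    (hτ : ∀ (c : C) m, τ (c • m) = c ^ Nat.card F • τ m)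
    (hX : ∀ m, τ ((Polynomial.X : C[X]) • m) = (Polynomial.X : C[X]) • τ m)
    (hθτ : ∀ m, ∃ m', τ m' = (Polynomial.X : C[X]) • m - θ • m)
    (b : Module.Basis (Fin r) C[X] M) {e : Fin r → ℕ → M →ₗ[C] C}
    (heτ : ∀ j n m, e j n (τ m) = e j n m ^ Nat.card F)
    (he0 : ∀ j m, e j 0 ((Polynomial.X : C[X]) • m) = 0)
    (heX : ∀ j n m, e j (n + 1) ((Polynomial.X : C[X]) • m) = e j n m)
    (hlim : ∀ j m, Tendsto (fun n => e j n m) atTop (𝓝 0))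
    (hdet : (Matrix.of fun i j => e j 0 (b i)).det ≠ 0) :
    ∃ g : F[X], g ≠ 0 ∧ ∀ t : ℕ → M →ₗ[C] C, (∀ n m, t n (τ m) = t n m ^ Nat.card F) →
      (∀ n m, t (n + 1) ((Polynomial.X : C[X]) • m) = t n m) →
      ∃ v : Fin r → ℕ → F, ∀ m, Tendsto (fun n => t n (g.map (algebraMap F C) • m) -
        ∑ j, ∑ k ∈ Finset.range (n + 1), algebraMap F C (v j k) * e j (n - k) m) atTop (𝓝 0) := by
  classical
  let φ : C⟦X⟧ →+* C⟦X⟧ := PowerSeries.map (frob F C : C →+* C)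
  let Ψ : Matrix (Fin r) (Fin r) C⟦X⟧ := Matrix.of fun i j => genSeries (e j) (b i)
  let Φ : Matrix (Fin r) (Fin r) C[X] := Matrix.of fun i k => b.repr (τ (b i)) k
  let Φ' : Matrix (Fin r) (Fin r) C⟦X⟧ := (Polynomial.coeToPowerSeries.ringHom).mapMatrix Φ
  have hΨmem : ∀ i j, Ψ i j ∈ tateAlgebra C := fun i j => by
    rw [mem_tateAlgebra_iff]
    simpa only [Ψ, Matrix.of_apply, coeff_genSeries] using hlim j (b i)
  have hτb : ∀ i, τ (b i) = ∑ k, Φ i k • b k := fun i => (b.sum_repr _).symm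
  have hΨφ : φ.mapMatrix Ψ = Φ' * Ψ := by
    ext1 i j
    rw [RingHom.mapMatrix_apply, Matrix.map_apply, Matrix.mul_apply]
    refine (genSeries_frobenius (heτ j) (b i)).symm.trans ?_
    rw [hτb, map_sum]
    exact Finset.sum_congr rfl fun k _ => genSeries_smul (he0 j) (heX j) _ _
  obtain ⟨s, c, hc, hΦdet⟩ := exists_det_frobenius_eq hτ hX hθτ b
  have hΨdet0 : PowerSeries.constantCoeff Ψ.det ≠ 0 := by
    rw [RingHom.map_det]
    convert! hdet using 2
  have hφdet : φ Ψ.det = (Φ.det : C⟦X⟧) * Ψ.det := by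
    rw [RingHom.map_det, hΨφ, Matrix.det_mul]
    congr 1
    exact (RingHom.map_det Polynomial.coeToPowerSeries.ringHom Φ).symm
  obtain ⟨g, hg, k, hk, hgk⟩ := exists_mul_eq_polynomial (F := F) hθ (det_mem_tateAlgebra hΨmem)
    hΨdet0 hc (by rw [← hΦdet]; exact hφdet)
  refine ⟨g, hg, fun t htτ htX => ?_⟩
  set G : C⟦X⟧ := ((g.map (algebraMap F C) : C[X]) : C⟦X⟧) with hG
  have hGφ : φ G = G := by
    rw [hG]
    exact (Polynomial.polynomial_map_coe ..).symm.trans (by rw [map_frob_map_algebraMap])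
  let ℓ : Fin r → C⟦X⟧ := fun i => genSeries t (b i)
  -- Invertibility holds over all formal power series; `Z` need not be restricted.
  have hunit : IsUnit Ψ.det := by
    rw [PowerSeries.isUnit_iff_constantCoeff]
    exact hΨdet0.isUnit
  let Z : Fin r → C⟦X⟧ := Ψ⁻¹.mulVec ℓ
  have hZ : Ψ.mulVec Z = ℓ := by
    rw [Matrix.mulVec_mulVec, Matrix.mul_nonsing_inv _ hunit, Matrix.one_mulVec]
  -- This equals $\ell^{(1)}-\Phi\ell$, which measures the failure of the generating series to be
  -- linear over `C[X]`; that failure is restricted.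
  let π : Fin r → C⟦X⟧ := (φ.mapMatrix Ψ).mulVec fun j => φ (Z j) - Z j
  have hπ : ∀ i, π i ∈ tateAlgebra C := by
    intro i
    have h1 : π i = genSeries t (τ (b i)) - ∑ k, (Φ i k : C⟦X⟧) * ℓ k := by
      have h2 : π = (φ.mapMatrix Ψ).mulVec (φ ∘ Z) - (φ.mapMatrix Ψ).mulVec Z :=
        Matrix.mulVec_sub _ _ _
      rw [h2, Pi.sub_apply, RingHom.mapMatrix_apply, ← RingHom.map_mulVec, hZ,
        ← RingHom.mapMatrix_apply, hΨφ, ← Matrix.mulVec_mulVec, hZ]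
      congr 1
      exact (genSeries_frobenius htτ (b i)).symm
    rw [h1, hτb, map_sum, ← Finset.sum_sub_distrib]
    exact sum_mem fun k _ => genSeries_smul_sub_mem htX _ _
  -- `G` is fixed by the Frobenius, so it is also a multiple of $\det\Psi^{(1)}$. This clears the
  -- denominator of $(\Psi^{(1)})^{-1}\pi$.
  have hρ : ∀ j, G * (φ (Z j) - Z j) ∈ tateAlgebra C := by
    intro j
    have h1 : G * (φ (Z j) - Z j) = φ k * (φ.mapMatrix Ψ).adjugate.mulVec π j := by
      rw [Matrix.mulVec_mulVec, Matrix.adjugate_mul, ← RingHom.map_det, Matrix.smul_mulVec,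
        Matrix.one_mulVec, Pi.smul_apply, smul_eq_mul, ← mul_assoc, ← map_mul, mul_comm k, ← hgk,
        hGφ]
    rw [h1]
    exact mul_mem (map_frob_mem_tateAlgebra hk)
      (adjugate_mulVec_mem_tateAlgebra (fun i j => map_frob_mem_tateAlgebra (hΨmem i j)) hπ j)
  choose W hW hWeq using fun j => exists_tateAlgebra_frob_sub_eq F (hρ j)
  -- After removing the Artin-Schreier solution `W j`, the series $GZ_j-W_j$ is fixed by the
  -- Frobenius, so its coefficients lie in `F`; they are the coefficients of the correction.
  have hfix : ∀ j n, ∃ a : F, algebraMap F C a = PowerSeries.coeff n (G * Z j - W j) := by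
    intro j n
    refine exists_algebraMap_eq_of_pow_card_eq F ?_
    have h1 : φ (G * Z j - W j) = G * Z j - W j := by
      rw [map_sub, map_mul, hGφ]
      have := hWeq j
      change φ (W j) - W j = _ at this
      linear_combination -this
    have h2 := congrArg (PowerSeries.coeff n) h1
    rwa [PowerSeries.coeff_map, RingHom.coe_coe, frob_apply] at h2
  choose v hv using hfix
  refine ⟨v, ?_⟩
  let D : ℕ → M →ₗ[C] C := fun n =>
    (t n).comp ((LinearMap.lsmul C[X] M (g.map (algebraMap F C))).restrictScalars C) -
      ∑ j, ∑ k ∈ Finset.range (n + 1), algebraMap F C (v j k) • e j (n - k)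
  have hD : ∀ n m, D n m = t n (g.map (algebraMap F C) • m) -
      ∑ j, ∑ k ∈ Finset.range (n + 1), algebraMap F C (v j k) * e j (n - k) m := by
    intro n m
    simp [D, -algebraMap_smul]
  suffices ∀ m, Tendsto (fun n => D n m) atTop (𝓝 0) by simpa only [hD] using this
  refine tendsto_of_basis (fun n m => ?_) b fun i => ?_
  · rw [hD, hD, smul_comm, htX]
    congr 1
    refine Finset.sum_congr rfl fun j _ => ?_
    rw [Finset.sum_range_succ, Nat.sub_self, he0, mul_zero, add_zero]
    refine Finset.sum_congr rfl fun k hk => ?_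
    rw [Nat.succ_sub (Nat.lt_succ_iff.mp (Finset.mem_range.mp hk)), heX]
  · have hmem : genSeries t (g.map (algebraMap F C) • b i) -
        ∑ j, (G * Z j - W j) * Ψ i j ∈ tateAlgebra C := by
      have h1 : genSeries t (g.map (algebraMap F C) • b i) - ∑ j, (G * Z j - W j) * Ψ i j =
          (genSeries t (g.map (algebraMap F C) • b i) - G * ℓ i) + ∑ j, W j * Ψ i j := by
        rw [← hZ, Matrix.mulVec, dotProduct, Finset.mul_sum, sub_add, ← Finset.sum_sub_distrib]
        congr 1
        exact Finset.sum_congr rfl fun j _ => by ring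
      rw [h1]
      exact add_mem (genSeries_smul_sub_mem htX _ _)
        (sum_mem fun j _ => mul_mem (hW j) (hΨmem i j))
    rw [mem_tateAlgebra_iff] at hmem
    refine hmem.congr fun n => ?_
    rw [hD, map_sub, coeff_genSeries, map_sum]
    congr 1
    refine Finset.sum_congr rfl fun j _ => ?_
    rw [PowerSeries.coeff_mul, Finset.Nat.sum_antidiagonal_eq_sum_range_succ
      (fun a b => PowerSeries.coeff a (G * Z j - W j) * PowerSeries.coeff b (Ψ i j))]
    refine Finset.sum_congr rfl fun k _ => ?_
    rw [hv]
    congr 1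
    exact coeff_genSeries _ _ _

end Comparison

/-! ### The subgroup of points with convergent division towers -/

section ConvergentPoints

open Filter
open scoped Topology Polynomial

/-- Let `M` be a finitely generated Frobenius module over `C[X]` on which `X` acts on
`M / τ M` as a scalar `θ` with `|θ| > 1`. A group of points of `M` stable under `X` which contains
all null sequences eventually and in which every `X`-torsion point has a convergent division tower
contains all points. -/
theorem mem_of_torsion_towers {F C M : Type*} [Field F] [Finite F] [NormedField C]
    [IsUltrametricDist C] [IsAlgClosed C] [Algebra F C] [AddCommGroup M] [Module C M]
    [Module C[X] M] [IsScalarTower C C[X] M] [Module.Finite C[X] M] {τ : M →+ M} {θ : C}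
    (hθ : 1 < ‖θ‖)
    (hτ : ∀ (c : C) m, τ (c • m) = c ^ Nat.card F • τ m)
    (hX : ∀ m, τ ((Polynomial.X : C[X]) • m) = (Polynomial.X : C[X]) • τ m)
    (hθτ : ∀ m, ∃ m', τ m' = (Polynomial.X : C[X]) • m - θ • m)
    (hind : ∀ m ≠ 0, LinearIndependent C (fun k : ℕ => τ^[k] m))
    (H : AddSubgroup (M →ₗ[C] C)) (hHF : ∀ (a : F), ∀ e ∈ H, algebraMap F C a • e ∈ H)
    (hHX : ∀ e ∈ H, e.comp ((LinearMap.lsmul C[X] M Polynomial.X).restrictScalars C) ∈ H)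
    (hHlim : ∀ e : ℕ → M →ₗ[C] C, (∀ n m, e n (τ m) = e n m ^ Nat.card F) →
      (∀ m, Tendsto (fun n => e n m) atTop (𝓝 0)) → ∃ n, e n ∈ H)
    (hHtor : ∀ e : M →ₗ[C] C, (∀ m, e (τ m) = e m ^ Nat.card F) →
      (∀ m, e ((Polynomial.X : C[X]) • m) = 0) → ∃ t : ℕ → M →ₗ[C] C, t 0 = e ∧
        (∀ n, t n ∈ H) ∧ (∀ n m, t n (τ m) = t n m ^ Nat.card F) ∧
        (∀ n m, t (n + 1) ((Polynomial.X : C[X]) • m) = t n m) ∧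
        ∀ m, Tendsto (fun n => t n m) atTop (𝓝 0))
    (e : M →ₗ[C] C) (he : ∀ m, e (τ m) = e m ^ Nat.card F) : e ∈ H := by
  have hq := two_le_natCard F
  have hθ0 : θ ≠ 0 := norm_pos_iff.mp (one_pos.trans hθ)
  have := isTorsionFree_of_linearIndependent hτ hX hind
  let n := Module.finrank C[X] M
  let b : Module.Basis (Fin n) C[X] M := Module.finBasis C[X] M
  have hτinj : Function.Injective τ := by
    rw [injective_iff_map_eq_zero]
    intro m hm
    by_contra h
    exact (hind m h).ne_zero 1 hm
  -- From $\tau m=Xn$ and $\tau m'=Xn-\theta n$ one gets $\theta n=\tau(m-m')$. So `n` is in the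
  -- image of `τ`, and injectivity allows `τ` to be cancelled.
  have hX' : ∀ m n, τ m = (Polynomial.X : C[X]) • n → ∃ n', m = (Polynomial.X : C[X]) • n' := by
    intro m n hmn
    obtain ⟨m', hm'⟩ := hθτ n
    obtain ⟨c, hc⟩ := IsAlgClosed.exists_pow_nat_eq θ⁻¹ (by lia : 0 < Nat.card F)
    refine ⟨c • (m - m'), hτinj ?_⟩
    rw [hX, hτ, map_sub, hm', hmn, sub_sub_cancel, hc, inv_smul_smul₀ hθ0]
  obtain ⟨e₀, h1, h2, hdet⟩ := exists_torsion_det_ne_zero hτ hX hX' b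
  choose t ht0 htH htτ htX htlim using fun j => hHtor (e₀ j) (h1 j) (h2 j)
  obtain ⟨g, hg, hcorr⟩ := exists_tower_correction (F := F) hθ hτ hX hθτ b htτ
    (fun j m => by rw [ht0, h2]) htX htlim (by simpa only [ht0] using hdet)
  set G := g.map (algebraMap F C)
  have hτG : ∀ m, τ (G • m) = G • τ m := fun m => by
    rw [frobenius_smul hτ hX, map_frob_map_algebraMap]
  -- Dividing by `g` beforehand offsets the multiplication by `g` in the tower correction.
  obtain ⟨e', he', hee'⟩ := exists_compatible_smul_eq hτ hX hg e he
  let V := {f : M →ₗ[C] C // ∀ m, f (τ m) = f m ^ Nat.card F}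
  have hdiv : ∀ f : V, ∃ f' : V, ∀ m, f'.1 ((Polynomial.X : C[X]) • m) = f.1 m := by
    intro f
    obtain ⟨f', h1, h2⟩ := exists_compatible_smul_eq hτ hX (Polynomial.X_ne_zero (R := F)) f.1 f.2
    rw [Polynomial.map_X] at h2
    exact ⟨⟨f', h1⟩, h2⟩
  choose next hnext using hdiv
  let T : ℕ → V := fun n => Nat.rec ⟨e', he'⟩ (fun _ f => next f) n
  have hTX : ∀ n m, (T (n + 1)).1 ((Polynomial.X : C[X]) • m) = (T n).1 m := fun n m => hnext _ m
  obtain ⟨v, hv⟩ := hcorr (fun n => (T n).1) (fun n => (T n).2) hTX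
  let TG : ℕ → M →ₗ[C] C := fun n => (T n).1.comp ((LinearMap.lsmul C[X] M G).restrictScalars C)
  let S : ℕ → M →ₗ[C] C := fun n =>
    ∑ j, ∑ k ∈ Finset.range (n + 1), algebraMap F C (v j k) • t j (n - k)
  have hS : ∀ n, S n ∈ H := fun n => sum_mem fun j _ => sum_mem fun k _ => hHF _ _ (htH _ _)
  have hTGa : ∀ n m, TG n m = (T n).1 (G • m) := fun n m => rfl
  have hSa : ∀ n m, S n m =
      ∑ j, ∑ k ∈ Finset.range (n + 1), algebraMap F C (v j k) * t j (n - k) m := fun n m => by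
    simp [S, -algebraMap_smul]
  have hsub : ∀ x y : C, (x - y) ^ Nat.card F = x ^ Nat.card F - y ^ Nat.card F := fun x y => by
    simp only [← frob_apply F, map_sub]
  have hSτ : ∀ n m, S n (τ m) = S n m ^ Nat.card F := by
    intro n m
    rw [hSa, hSa]
    simp only [← frob_apply F, map_sum, map_mul, AlgHom.commutes, htτ]
  -- The corrected tower is a null sequence, so one of its members lies in `H`; the correction
  -- itself consists of elements of `H`.
  obtain ⟨n, hn⟩ := hHlim (fun n => TG n - S n) (fun n m => by
      rw [LinearMap.sub_apply, LinearMap.sub_apply, hsub, hSτ, hTGa, hTGa, ← hτG, (T n).2])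
    (fun m => by simpa only [LinearMap.sub_apply, hTGa, hSa] using hv m)
  have hTGn : TG n ∈ H := by simpa using add_mem hn (hS n)
  -- Applying `X` moves one step down the tower, so membership of a single member passes to its
  -- start, which is `e`.
  have hdesc : ∀ n, TG n ∈ H → TG 0 ∈ H := by
    intro n
    induction n with
    | zero => exact id
    | succ n ih =>
      intro h
      refine ih ?_
      convert! hHX _ h using 1
      ext m
      change _ = (T (n + 1)).1 (G • (Polynomial.X : C[X]) • m)
      rw [smul_comm, hTX]
      rfl
  have h0 : TG 0 = e := LinearMap.ext hee'
  exact h0 ▸ hdesc n hTGn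

end ConvergentPoints

/-! ### Additive polynomials -/

section AddPoly

open scoped Polynomial

/-- The space of `F`-linear polynomial functions on `C ^ d`. -/
def addPoly (F C : Type*) [Field C] (d : ℕ) : Submodule C ((Fin d → C) → C) :=
  Submodule.span C (Set.range fun p : Fin d × ℕ => fun x => x p.1 ^ Nat.card F ^ p.2)

variable {F C : Type*} [Field F] [Finite F] [Field C] [Algebra F C] {d : ℕ}

theorem pow_mem_addPoly (F : Type*) {C : Type*} [Field C] {d : ℕ} (i : Fin d) (j : ℕ) :
    (fun x : Fin d → C => x i ^ Nat.card F ^ j) ∈ addPoly F C d :=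
  Submodule.subset_span ⟨(i, j), rfl⟩

theorem addPoly_map_add {m : (Fin d → C) → C} (hm : m ∈ addPoly F C d) (x y : Fin d → C) :
    m (x + y) = m x + m y := by
  induction hm using Submodule.span_induction with
  | mem m hm =>
    obtain ⟨⟨i, j⟩, rfl⟩ := hm
    exact add_pow_card F j (x i) (y i)
  | zero => simp
  | add m m' _ _ h h' => simp only [Pi.add_apply, h, h']; ring
  | smul c m _ h => simp only [Pi.smul_apply, h, smul_add]

theorem addPoly_map_smul {m : (Fin d → C) → C} (hm : m ∈ addPoly F C d) (a : F) (x : Fin d → C) :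
    m (algebraMap F C a • x) = algebraMap F C a * m x := by
  induction hm using Submodule.span_induction with
  | mem m hm =>
    obtain ⟨⟨i, j⟩, rfl⟩ := hm
    simp only [Pi.smul_apply, smul_eq_mul, mul_pow]
    rw [← frob_iterate F j (algebraMap F C a), AlgHom.commutes]
  | zero => simp
  | add m m' _ _ h h' => simp only [Pi.add_apply, h, h']; ring
  | smul c m _ h => simp only [Pi.smul_apply, h, smul_eq_mul]; ring

theorem frob_mem_addPoly {m : (Fin d → C) → C} (hm : m ∈ addPoly F C d) :
    (fun x => m x ^ Nat.card F) ∈ addPoly F C d := by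
  simp only [← frob_apply F]
  induction hm using Submodule.span_induction with
  | mem m hm =>
    obtain ⟨⟨i, j⟩, rfl⟩ := hm
    convert! pow_mem_addPoly F (C := C) i (j + 1) using 2 with x
    rw [frob_apply, ← pow_mul, pow_succ]
  | zero =>
    simp only [Pi.zero_apply, map_zero]
    exact zero_mem _
  | add m m' _ _ h h' =>
    simp only [Pi.add_apply, map_add]
    exact add_mem h h'
  | smul c m _ h =>
    simp only [Pi.smul_apply, smul_eq_mul, map_mul]
    exact Submodule.smul_mem _ (frob F C c) h

/-- The Frobenius of the module of additive polynomials. -/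
def addPolyFrob : addPoly F C d →+ addPoly F C d where
  toFun m := ⟨fun x => m.1 x ^ Nat.card F, frob_mem_addPoly m.2⟩
  map_zero' := by
    ext x
    exact zero_pow (by have := two_le_natCard F; lia)
  map_add' m m' := by
    ext x
    simpa using add_pow_card F 1 (m.1 x) (m'.1 x)

theorem addPolyFrob_apply (m : addPoly F C d) (x : Fin d → C) :
    (addPolyFrob m).1 x = m.1 x ^ Nat.card F := rfl

theorem addPolyFrob_smul (c : C) (m : addPoly F C d) :
    addPolyFrob (c • m) = c ^ Nat.card F • addPolyFrob m := by
  ext x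
  exact mul_pow _ _ _

theorem addPolyFrob_iterate_apply (k : ℕ) (m : addPoly F C d) (x : Fin d → C) :
    (addPolyFrob^[k] m).1 x = m.1 x ^ Nat.card F ^ k := by
  induction k with
  | zero => simp
  | succ k ih => rw [Function.iterate_succ_apply', addPolyFrob_apply, ih, ← pow_mul, pow_succ]

theorem comp_frobSum_mem_addPoly {d' : ℕ} {m : (Fin d' → C) → C} (hm : m ∈ addPoly F C d') (N : ℕ)
    (B : ℕ → Matrix (Fin d') (Fin d) C) : m ∘ frobSum F N B ∈ addPoly F C d := by
  induction hm using Submodule.span_induction with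
  | mem m hm =>
    obtain ⟨⟨i, j⟩, rfl⟩ := hm
    have h : (fun x : Fin d' → C => x i ^ Nat.card F ^ j) ∘ frobSum F N B =
        ∑ k ∈ Finset.range N, ∑ l, (B k i l) ^ Nat.card F ^ j •
          fun x : Fin d → C => x l ^ Nat.card F ^ (k + j) := by
      funext x
      simp only [Function.comp_apply, frobSum, Finset.sum_apply, sum_pow_card, Matrix.mulVec,
        dotProduct, frobVec, mul_pow, Pi.smul_apply, smul_eq_mul, ← pow_mul, pow_add]
    rw [h]
    exact sum_mem fun k _ => sum_mem fun l _ => Submodule.smul_mem _ _ (pow_mem_addPoly F l _)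
  | zero => exact zero_mem _
  | add m m' _ _ h h' => exact add_mem h h'
  | smul c m _ h => exact Submodule.smul_mem _ c h

/-- Precomposition with an additive polynomial map. -/
def addPolyComp {d' : ℕ} (N : ℕ) (B : ℕ → Matrix (Fin d') (Fin d) C) :
    addPoly F C d' →ₗ[C] addPoly F C d where
  toFun m := ⟨m.1 ∘ frobSum F N B, comp_frobSum_mem_addPoly m.2 N B⟩
  map_add' _ _ := rfl
  map_smul' _ _ := rfl

theorem addPolyComp_apply {d' : ℕ} (N : ℕ) (B : ℕ → Matrix (Fin d') (Fin d) C) (m : addPoly F C d')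
    (x : Fin d → C) : (addPolyComp N B m).1 x = m.1 (frobSum F N B x) := rfl

/-- Scalars have `q`-th roots, so the image of the semilinear Frobenius is already a subspace. -/
theorem exists_frob_eq_of_mem_span [IsAlgClosed C] {m : addPoly F C d}
    (hm : m ∈ Submodule.span C (Set.range (addPolyFrob (F := F) (C := C) (d := d)))) :
    ∃ m', addPolyFrob m' = m := by
  have hq := two_le_natCard F
  induction hm using Submodule.span_induction with
  | mem m hm => exact hm
  | zero => exact ⟨0, map_zero _⟩
  | add m m' _ _ h h' =>
    obtain ⟨n, rfl⟩ := h
    obtain ⟨n', rfl⟩ := h'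
    exact ⟨n + n', map_add _ _ _⟩
  | smul c m _ h =>
    obtain ⟨n, rfl⟩ := h
    obtain ⟨b, rfl⟩ := IsAlgClosed.exists_pow_nat_eq c (by lia : 0 < Nat.card F)
    exact ⟨b • n, addPolyFrob_smul _ _⟩

/-- Modulo the image of the Frobenius, composition is multiplication by the scalar linear part. -/
theorem exists_frob_eq_comp_sub [IsAlgClosed C] {N : ℕ} {B : ℕ → Matrix (Fin d) (Fin d) C} {θ : C}
    (hB : B 0 = θ • 1) (m : addPoly F C d) :
    ∃ m', addPolyFrob m' = addPolyComp (N + 1) B m - θ • m := by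
  refine exists_frob_eq_of_mem_span ?_
  obtain ⟨m, hm⟩ := m
  induction hm using Submodule.span_induction with
  | mem m hm =>
    obtain ⟨⟨i, j⟩, rfl⟩ := hm
    cases j with
    | zero =>
      let m' : ℕ → Fin d → addPoly F C d := fun k l => ⟨_, pow_mem_addPoly F l k⟩
      have h : addPolyComp (N + 1) B ⟨_, pow_mem_addPoly F i 0⟩ -
          θ • (⟨_, pow_mem_addPoly F i 0⟩ : addPoly F C d) =
          ∑ k ∈ Finset.range N, ∑ l, B (k + 1) i l • addPolyFrob (m' k l) := by
        ext x
        rw [AddSubgroupClass.coe_sub, Pi.sub_apply, addPolyComp_apply, frobSum,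
          Finset.sum_range_succ', hB]
        simp only [AddSubmonoidClass.coe_finsetSum, Finset.sum_apply, pow_zero, pow_one, Pi.add_apply,
          frobVec_zero_left, Matrix.smul_mulVec, Matrix.one_mulVec, Submodule.coe_smul, Pi.smul_apply,
          addPolyFrob_apply, add_sub_cancel_right, m', smul_eq_mul, Matrix.mulVec, dotProduct, frobVec,
          ← pow_mul, ← pow_succ]
      exact h ▸ sum_mem fun k _ => sum_mem fun l _ =>
        Submodule.smul_mem _ _ (Submodule.subset_span ⟨_, rfl⟩)
    | succ j =>
      let m₀ : addPoly F C d := ⟨_, pow_mem_addPoly F i j⟩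
      refine sub_mem (Submodule.subset_span ⟨addPolyComp (N + 1) B m₀, ?_⟩)
        (Submodule.smul_mem _ _ (Submodule.subset_span ⟨m₀, ?_⟩))
      · ext x
        change (frobSum F (N + 1) B x i ^ Nat.card F ^ j) ^ Nat.card F =
          frobSum F (N + 1) B x i ^ Nat.card F ^ (j + 1)
        rw [← pow_mul, pow_succ]
      · ext x
        change (x i ^ Nat.card F ^ j) ^ Nat.card F = x i ^ Nat.card F ^ (j + 1)
        rw [← pow_mul, pow_succ]
  | zero =>
    have h : (⟨0, zero_mem _⟩ : addPoly F C d) = 0 := rfl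
    rw [h, map_zero, smul_zero, sub_zero]
    exact zero_mem _
  | add m m' hm hm' h h' =>
    convert! add_mem h h' using 1
    rw [show (⟨m + m', add_mem hm hm'⟩ : addPoly F C d) = ⟨m, hm⟩ + ⟨m', hm'⟩ from rfl, map_add,
      smul_add]
    abel
  | smul c m hm h =>
    convert! Submodule.smul_mem _ c h using 1
    rw [show (⟨c • m, Submodule.smul_mem _ c hm⟩ : addPoly F C d) = c • ⟨m, hm⟩ from rfl, map_smul,
      smul_sub, smul_comm θ c]

theorem exists_polynomial_on_line {F C : Type*} [Field F] [Finite F] [Field C] {d : ℕ}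
    {m : (Fin d → C) → C} (hm : m ∈ addPoly F C d) (v : Fin d → C) :
    ∃ P : C[X], P.eval 0 = 0 ∧ ∀ y : C, P.eval y = m (y • v) := by
  have hq := two_le_natCard F
  induction hm using Submodule.span_induction with
  | mem m hm =>
    obtain ⟨⟨i, j⟩, rfl⟩ := hm
    refine ⟨Polynomial.C (v i ^ Nat.card F ^ j) * Polynomial.X ^ Nat.card F ^ j, ?_, fun y => ?_⟩
    · simp [(by lia : Nat.card F ≠ 0)]
    · simp [mul_pow, mul_comm]
  | zero => exact ⟨0, by simp, by simp⟩
  | add m m' _ _ h h' =>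
    obtain ⟨P, h1, h2⟩ := h
    obtain ⟨P', h1', h2'⟩ := h'
    exact ⟨P + P', by simp [h1, h1'], fun y => by simp [h2, h2']⟩
  | smul c m _ h =>
    obtain ⟨P, h1, h2⟩ := h
    exact ⟨Polynomial.C c * P, by simp [h1], fun y => by simp [h2]⟩

/-- On a line through the origin where it does not vanish, the function is a nonconstant polynomial
in one variable. -/
theorem addPoly_surjective {F C : Type*} [Field F] [Finite F] [Field C] [IsAlgClosed C] {d : ℕ}
    {m : (Fin d → C) → C} (hm : m ∈ addPoly F C d)
    (h0 : m ≠ 0) : Function.Surjective m := by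
  obtain ⟨v, hv⟩ := Function.ne_iff.mp h0
  obtain ⟨P, h1, h2⟩ := exists_polynomial_on_line hm v
  intro w
  obtain ⟨y, hy⟩ := IsAlgClosed.exists_root (P - Polynomial.C w) (by
    intro hdeg
    obtain ⟨c, hc⟩ : ∃ c, P = Polynomial.C c := by
      refine ⟨P.coeff 0, Polynomial.eq_C_of_degree_le_zero ?_⟩
      have h3 : P = (P - Polynomial.C w) + Polynomial.C w := by ring
      rw [h3]
      exact (Polynomial.degree_add_le _ _).trans (max_le hdeg.le Polynomial.degree_C_le)
    have h4 := h2 1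
    rw [one_smul, hc, Polynomial.eval_C] at h4
    rw [hc, Polynomial.eval_C] at h1
    exact hv (h4.symm.trans h1))
  refine ⟨y • v, ?_⟩
  rw [← h2]
  simpa [sub_eq_zero] using hy

/-- By surjectivity of `m`, a relation between iterates becomes a polynomial vanishing on all of
`C`; its exponents `q ^ k` are distinct. -/
theorem linearIndependent_frob_iterate [IsAlgClosed C] {m : addPoly F C d} (hm : m ≠ 0) :
    LinearIndependent C (fun k : ℕ => addPolyFrob^[k] m) := by
  have hq := two_le_natCard F
  rw [linearIndependent_iff']
  intro s c hc k hk
  have hsurj := addPoly_surjective m.2 (fun h => hm (Subtype.ext h))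
  let P : C[X] := ∑ k ∈ s, Polynomial.monomial (Nat.card F ^ k) (c k)
  have hP : P = 0 := by
    refine Polynomial.funext fun w => ?_
    obtain ⟨x, rfl⟩ := hsurj w
    have h1 := congrArg (fun m : addPoly F C d => m.1 x) hc
    simp only [AddSubmonoidClass.coe_finsetSum, Finset.sum_apply, Submodule.coe_smul, Pi.smul_apply,
      addPolyFrob_iterate_apply, smul_eq_mul] at h1
    simpa [P, Polynomial.eval_finsetSum] using h1
  have h2 := congrArg (fun P => P.coeff (Nat.card F ^ k)) hP
  simp only [P, Polynomial.finsetSum_coeff, Polynomial.coeff_monomial, Polynomial.coeff_zero,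
    (Nat.pow_right_injective hq).eq_iff] at h2
  simpa [hk] using h2

theorem addPoly_ext {F C : Type*} [Field C] {d : ℕ} {x y : Fin d → C} (h : ∀ m : addPoly F C d, m.1 x = m.1 y) : x = y := by
  funext i
  simpa using h ⟨_, pow_mem_addPoly F i 0⟩

/-- The functionals on additive polynomials compatible with the Frobenius are the evaluations. -/
theorem exists_eq_eval {e : addPoly F C d →ₗ[C] C}
    (he : ∀ m, e (addPolyFrob m) = e m ^ Nat.card F) :
    ∃ w : Fin d → C, ∀ m, e m = m.1 w := by
  refine ⟨fun i => e ⟨_, pow_mem_addPoly F i 0⟩, ?_⟩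
  rintro ⟨m, hm⟩
  induction hm using Submodule.span_induction with
  | mem m hm =>
    obtain ⟨⟨i, j⟩, rfl⟩ := hm
    change e ⟨_, pow_mem_addPoly F i j⟩ = e ⟨_, pow_mem_addPoly F i 0⟩ ^ Nat.card F ^ j
    induction j with
    | zero => simp
    | succ j ih =>
      refine Eq.trans ?_ ((he _).trans ((congrArg (· ^ Nat.card F) ih).trans
        (by rw [← pow_mul, ← pow_succ])))
      congr 1
      ext x
      exact (pow_succ (Nat.card F) j ▸ pow_mul (x i) _ _ :)
  | zero => exact map_zero e
  | add m m' hm hm' h h' =>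
    exact (map_add e ⟨m, hm⟩ ⟨m', hm'⟩).trans (congrArg₂ (· + ·) h h')
  | smul c m hm h => exact (map_smul e c ⟨m, hm⟩).trans (congrArg (c • ·) h)

theorem continuous_addPoly {F C : Type*} [NormedField C] {d : ℕ} {m : (Fin d → C) → C}
    (hm : m ∈ addPoly F C d) : Continuous m := by
  induction hm using Submodule.span_induction with
  | mem m hm =>
    obtain ⟨⟨i, j⟩, rfl⟩ := hm
    exact (continuous_apply i).pow _
  | zero => exact continuous_const
  | add m m' _ _ h h' => exact h.add h'
  | smul c m _ h => exact h.const_smul c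

end AddPoly

/-! ### Surjectivity of the exponential function in coordinates -/

section ExpSurjective

open Filter
open scoped Topology Polynomial

variable {C : Type*} [NormedField C] {d : ℕ}

/-- An additive map tangent to the identity is locally surjective. -/
theorem exists_ball_subset_range [CompleteSpace C] {f : (Fin d → C) →+ (Fin d → C)}
    (hf : Continuous f) {c : ℝ} (hc : 0 ≤ c) (h : ∀ x, ‖x‖ ≤ 1 → ‖f x - x‖ ≤ c * ‖x‖ ^ 2) :
    ∃ r > 0, ∀ w, ‖w‖ ≤ r → w ∈ f.range := by
  -- Chosen so that `x - f x` is at most half as large as `x` on the ball of radius `r`.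
  set r := (2 * (c + 1))⁻¹ with hr
  have hr0 : 0 < r := by positivity
  have hr1 : r ≤ 1 := inv_le_one_of_one_le₀ (by linarith)
  have hrc : c * r ≤ 1 / 2 := by
    rw [hr, ← div_eq_mul_inv, div_le_iff₀ (by positivity)]
    linarith
  refine ⟨r, hr0, fun w hw => ?_⟩
  -- Successive approximation: `s n` is the error left after `n` corrections, and the sum of all
  -- corrections is a preimage of `w`.
  let s : ℕ → Fin d → C := fun n => (fun x => x - f x)^[n] w
  have hs : ∀ n, s (n + 1) = s n - f (s n) := fun n => Function.iterate_succ_apply' _ _ _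
  have hbound : ∀ n, ‖s n‖ ≤ r * (1 / 2) ^ n := by
    intro n
    induction n with
    | zero => simpa [s] using hw
    | succ n ih =>
      have h1 : ‖s n‖ ≤ r := ih.trans (mul_le_of_le_one_right hr0.le (pow_le_one₀ (by norm_num) (by norm_num)))
      rw [hs, norm_sub_rev]
      calc ‖f (s n) - s n‖ ≤ c * ‖s n‖ ^ 2 := h _ (h1.trans hr1)
        _ = (c * ‖s n‖) * ‖s n‖ := by ring
        _ ≤ (c * r) * ‖s n‖ := by gcongr
        _ ≤ 1 / 2 * (r * (1 / 2) ^ n) := by gcongr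
        _ = r * (1 / 2) ^ (n + 1) := by ring
  have hlim : Tendsto s atTop (𝓝 0) := by
    refine squeeze_zero_norm hbound ?_
    simpa using (tendsto_pow_atTop_nhds_zero_of_lt_one (by norm_num : (0 : ℝ) ≤ 1 / 2)
      (by norm_num)).const_mul r
  have hsum : Summable s := by
    refine Summable.of_norm_bounded ?_ hbound
    exact (summable_geometric_of_lt_one (by norm_num) (by norm_num)).mul_left r
  have h1 : HasSum (fun n => f (s n)) (f (∑' n, s n)) := hsum.hasSum.map f hf
  refine ⟨∑' n, s n, tendsto_nhds_unique h1.tendsto_sum_nat ?_⟩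
  have h2 : ∀ n, ∑ k ∈ Finset.range n, f (s k) = w - s n := by
    intro n
    induction n with
    | zero => simp [s]
    | succ n ih => rw [Finset.sum_range_succ, ih, hs]; abel
  simp only [h2]
  simpa using tendsto_const_nhds.sub hlim

theorem continuous_of_norm_sub_le {f : (Fin d → C) →+ (Fin d → C)} {c : ℝ}
    (h : ∀ x, ‖x‖ ≤ 1 → ‖f x - x‖ ≤ c * ‖x‖ ^ 2) : Continuous f := by
  refine continuous_of_continuousAt_zero f ?_
  rw [ContinuousAt, map_zero]
  have h1 : Tendsto (fun x : Fin d → C => f x - x) (𝓝 0) (𝓝 0) := by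
    refine squeeze_zero_norm' (a := fun x => c * ‖x‖ ^ 2) ?_ ?_
    · filter_upwards [Metric.closedBall_mem_nhds (0 : Fin d → C) one_pos] with x hx
      exact h x (by simpa using hx)
    · have : Continuous fun x : Fin d → C => c * ‖x‖ ^ 2 := by fun_prop
      simpa using this.tendsto 0
  simpa using h1.add (continuous_id.tendsto (0 : Fin d → C))

variable {F : Type*} [Field F] [Finite F] [CompleteSpace C] [IsUltrametricDist C] [IsAlgClosed C]
  [Algebra F C]

/-- The exponential function is surjective as soon as its image contains the kernel of `φ_t`, if
the module of additive polynomials is finitely generated. -/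
theorem surjective_of_ker_subset_range {θ : C} (hθ : 1 < ‖θ‖) {N : ℕ}
    {B : ℕ → Matrix (Fin d) (Fin d) C} (hB : B 0 = θ • 1)
    (hfg : ∃ S : Set (addPoly F C d), S.Finite ∧ Submodule.span C
      {m | ∃ k : ℕ, ∃ s ∈ S, m = ((addPolyComp (F := F) (N + 1) B) ^ k) s} = ⊤)
    {e : ℕ → Matrix (Fin d) (Fin d) C} (he0 : e 0 = 1) {f : (Fin d → C) →+ (Fin d → C)}
    (hf : ∀ x, HasSum (fun n => (e n).mulVec (frobVec F n x)) (f x))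
    (hfθ : ∀ x, f (θ • x) = frobSum F (N + 1) B (f x))
    (hker : ∀ w, frobSum F (N + 1) B w = 0 → w ∈ f.range) : Function.Surjective f := by
  have hθ0 : θ ≠ 0 := norm_pos_iff.mp (one_pos.trans hθ)
  obtain ⟨c, hc, hfc⟩ := exists_norm_series_sub_le F hf
  simp only [he0, Matrix.one_mulVec] at hfc
  have hcont := continuous_of_norm_sub_le hfc
  obtain ⟨r, hr, hball⟩ := exists_ball_subset_range hcont hc hfc
  have hfF : ∀ (a : F) x, f (algebraMap F C a • x) = algebraMap F C a • f x := by
    intro a x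
    have h1 := hf (algebraMap F C a • x)
    have h2 := (hf x).const_smul (algebraMap F C a)
    refine h1.unique ?_
    convert! h2 using 2 with n
    rw [frobVec_smul, Matrix.mulVec_smul, ← frob_iterate F n (algebraMap F C a), AlgHom.commutes]
  let T : Module.End C (addPoly F C d) := addPolyComp (F := F) (N + 1) B
  -- `X` acts on additive polynomials by precomposition with $\varphi_t$; being abelian enters as
  -- finite generation of this module.
  let : Module C[X] (addPoly F C d) := Module.compHom _ (Polynomial.aeval T).toRingHom
  have hsmul : ∀ (p : C[X]) (m : addPoly F C d), p • m = Polynomial.aeval T p m := fun _ _ => rfl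
  have hXsmul : ∀ m : addPoly F C d, (Polynomial.X : C[X]) • m = T m := fun m => by
    rw [hsmul, Polynomial.aeval_X]
  have : IsScalarTower C C[X] (addPoly F C d) := ⟨fun a p m => by
    rw [hsmul, hsmul, map_smul]
    rfl⟩
  have : Module.Finite C[X] (addPoly F C d) := by
    obtain ⟨S, hS, hspan⟩ := hfg
    refine ⟨⟨hS.toFinset, ?_⟩⟩
    rw [hS.coe_toFinset, eq_top_iff]
    rintro m -
    have hm : m ∈ Submodule.span C
      {m | ∃ k : ℕ, ∃ s ∈ S, m = ((addPolyComp (F := F) (N + 1) B) ^ k) s} := hspan ▸ trivial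
    induction hm using Submodule.span_induction with
    | mem m hm =>
      obtain ⟨k, s, hs, rfl⟩ := hm
      have h1 : ((addPolyComp (F := F) (N + 1) B) ^ k) s = (Polynomial.X ^ k : C[X]) • s := by
        rw [hsmul, map_pow, Polynomial.aeval_X]
      rw [h1]
      exact Submodule.smul_mem _ _ (Submodule.subset_span hs)
    | zero => exact zero_mem _
    | add m m' _ _ h h' => exact add_mem h h'
    | smul a m _ h => rw [← C_smul_eq_smul]; exact Submodule.smul_mem _ _ h
  -- Points are identified with functionals by evaluation, and the subgroup to be shown everything
  -- is the image of `f`.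
  let ev : (Fin d → C) →+ (addPoly F C d →ₗ[C] C) :=
    { toFun := fun w =>
        { toFun := fun m => m.1 w
          map_add' := fun _ _ => rfl
          map_smul' := fun _ _ => rfl }
      map_zero' := LinearMap.ext fun m => by
        have h1 := addPoly_map_add m.2 0 0
        rw [add_zero] at h1
        exact left_eq_add.mp h1
      map_add' := fun x y => LinearMap.ext fun m => addPoly_map_add m.2 x y }
  have hev : ∀ w m, ev w m = m.1 w := fun _ _ => rfl
  have hev_inj : ∀ x y, ev x = ev y → x = y := fun x y h =>
    addPoly_ext fun m => LinearMap.congr_fun h m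
  have hevτ : ∀ w m, ev w (addPolyFrob m) = ev w m ^ Nat.card F := fun _ _ => rfl
  have hevX : ∀ w (m : addPoly F C d), ev w ((Polynomial.X : C[X]) • m) =
      ev (frobSum F (N + 1) B w) m := fun w m => by rw [hXsmul]; rfl
  intro w
  suffices ev w ∈ (ev.comp f).range by
    obtain ⟨x, hx⟩ := this
    exact ⟨x, hev_inj _ _ hx⟩
  refine mem_of_torsion_towers (F := F) hθ (τ := addPolyFrob) addPolyFrob_smul (fun m => ?_)
    (fun m => ?_) (fun m hm => linearIndependent_frob_iterate hm) (ev.comp f).range ?_ ?_ ?_ ?_ (ev w)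
    (hevτ w)
  · rw [hXsmul, hXsmul]
    rfl
  · rw [hXsmul]
    exact exists_frob_eq_comp_sub hB m
  · rintro a _ ⟨x, rfl⟩
    refine ⟨algebraMap F C a • x, LinearMap.ext fun m => ?_⟩
    rw [AddMonoidHom.comp_apply, hfF]
    exact addPoly_map_smul m.2 a (f x)
  · rintro _ ⟨x, rfl⟩
    refine ⟨θ • x, LinearMap.ext fun m => ?_⟩
    rw [AddMonoidHom.comp_apply, hfθ]
    exact (hevX (f x) m).symm
  -- Testing on the coordinate functions shows that the points tend to zero, so they enter the ball
  -- on which `f` is locally surjective.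
  · intro t ht hlim
    choose y hy using fun n => exists_eq_eval (ht n)
    have h1 : Tendsto y atTop (𝓝 0) := by
      rw [tendsto_pi_nhds]
      intro i
      refine (hlim ⟨_, pow_mem_addPoly F i 0⟩).congr fun n => ?_
      rw [hy]
      simp
    obtain ⟨n, hn⟩ := (h1.eventually (Metric.closedBall_mem_nhds 0 hr)).exists
    obtain ⟨x, hx⟩ := hball (y n) (by simpa using hn)
    refine ⟨n, x, LinearMap.ext fun m => ?_⟩
    rw [AddMonoidHom.comp_apply, hx, hy, hev]
  · intro e' he' he'X
    obtain ⟨y, hy⟩ := exists_eq_eval he'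
    obtain rfl : e' = ev y := LinearMap.ext hy
    obtain ⟨x, rfl⟩ := hker y (hev_inj _ _ (LinearMap.ext fun m => by
      rw [← hevX, he'X, map_zero, LinearMap.zero_apply]))
    -- The division tower of a torsion point $\exp(x)$ is $\exp(\theta^{-n}x)$, convergent to zero
    -- by continuity.
    refine ⟨fun n => ev (f ((θ⁻¹) ^ n • x)), by simp, fun n => ⟨_, rfl⟩, fun n m => rfl,
      fun n m => ?_, fun m => ?_⟩
    · rw [hevX, ← hfθ, pow_succ', mul_smul, smul_inv_smul₀ hθ0]
    · have h1 : Continuous fun y => ev (f y) m := (continuous_addPoly m.2).comp hcont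
      have h2 : Tendsto (fun n : ℕ => (θ⁻¹) ^ n • x) atTop (𝓝 0) := by
        have h3 := (tendsto_pow_atTop_nhds_zero_of_norm_lt_one (x := θ⁻¹) (by
          rw [norm_inv]
          exact inv_lt_one_of_one_lt₀ hθ)).smul_const x
        rwa [zero_smul] at h3
      exact (h1.tendsto' 0 0 (by simp)).comp h2

end ExpSurjective

/-! ### Finite generation of the module of additive polynomials -/

section CurveFinite

open scoped Polynomial

/-- The ring `A` is finite over `F[t]` for every nonconstant `t`. -/
theorem IsCurveFunctionField.exists_span_pow {F K : Type u} [Field F] [Finite F] [Field K]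
    [Algebra F K] (hK : IsCurveFunctionField F K) {infty : ValuationSubring K}
    (t : ringRegularAway F infty) (ht : Transcendental F (t : K)) :
    ∃ G : Set (ringRegularAway F infty), G.Finite ∧
      Submodule.span F {a | ∃ k : ℕ, ∃ g ∈ G, a = t ^ k * g} = ⊤ := by
  obtain ⟨-, -, hft⟩ := hK.dedekind ht t.2
  let : Algebra F[X] (ringRegularAway F infty) := (Polynomial.aeval (R := F) t).toRingHom.toAlgebra
  have hmap : ∀ P : F[X], algebraMap F[X] (ringRegularAway F infty) P = Polynomial.aeval t P :=
    fun _ => rfl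
  have : IsScalarTower F F[X] (ringRegularAway F infty) := IsScalarTower.of_algebraMap_eq fun c => by
    rw [hmap, Polynomial.algebraMap_apply, Algebra.algebraMap_self_apply, Polynomial.aeval_C]
  -- Integrality over `F[t]` together with finite type gives finiteness.
  have hint : Algebra.IsIntegral F[X] (ringRegularAway F infty) := ⟨fun a => by
    obtain ⟨P, hP, hPa⟩ := (mem_ringRegularAway_iff ht t.2 (a : K)).mp a.2
    refine ⟨P, hP, Subtype.coe_injective ?_⟩
    have h1 : ((ringRegularAway F infty).val.toRingHom.comp
        (algebraMap F[X] (ringRegularAway F infty))) = (Polynomial.aeval (R := F) (t : K)).toRingHom := by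
      ext P
      · simp [hmap]
      · simp [hmap]
    have h2 := Polynomial.hom_eval₂ P (algebraMap F[X] (ringRegularAway F infty))
      (ringRegularAway F infty).val.toRingHom a
    rw [h1] at h2
    exact h2.trans hPa⟩
  have : Algebra.FiniteType F[X] (ringRegularAway F infty) :=
    Algebra.FiniteType.of_restrictScalars_finiteType F F[X] _
  obtain ⟨s, hs⟩ := (Algebra.IsIntegral.finite (R := F[X]) (A := ringRegularAway F infty)).fg_top
  refine ⟨s, s.finite_toSet, ?_⟩
  rw [eq_top_iff]
  rintro a -
  have key : ∀ (P : F[X]), ∀ g ∈ s, P • g ∈ Submodule.span F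
      {a | ∃ k : ℕ, ∃ g ∈ (s : Set (ringRegularAway F infty)), a = t ^ k * g} := by
    intro P g hg
    rw [Algebra.smul_def, hmap, Polynomial.aeval_eq_sum_range, Finset.sum_mul]
    refine sum_mem fun i _ => ?_
    rw [smul_mul_assoc]
    exact Submodule.smul_mem _ _ (Submodule.subset_span ⟨i, g, hg, rfl⟩)
  have ha : a ∈ Submodule.span F[X] (s : Set (ringRegularAway F infty)) := hs ▸ trivial
  induction ha using Submodule.span_induction with
  | mem w hw => simpa using key 1 w hw
  | zero => exact zero_mem _
  | add x y _ _ hx hy => exact add_mem hx hy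
  | smul p x hx hx' =>
    clear hx'
    induction hx using Submodule.span_induction generalizing p with
    | mem w hw => exact key p w hw
    | zero => rw [smul_zero]; exact zero_mem _
    | add x y _ _ hx hy => rw [smul_add]; exact add_mem (hx p) (hy p)
    | smul r x _ hx => rw [← mul_smul]; exact hx _

end CurveFinite

/-- The morphism `x ↦ x_i ^ (q ^ j)`. -/
def gaPow (F L : Type u) [Field F] [Finite F] [Field L] [Algebra F L] {d : ℕ} (i : Fin d) (j : ℕ) :
    Ga F L d ⟶ Ga F L 1 where
  app R := ModuleCat.ofHom (X := (Ga F L d).obj R) (Y := (Ga F L 1).obj R)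
    { toFun := fun x => (fun _ => gaCoord (F := F) x i ^ Nat.card F ^ j : Fin 1 → R)
      map_add' := fun x y => by
        let : Algebra F R := ((algebraMap L R).comp (algebraMap F L)).toAlgebra
        exact funext fun _ => add_pow_card F j (gaCoord (F := F) x i) (gaCoord (F := F) y i)
      map_smul' := fun c x => by
        let : Algebra F R := ((algebraMap L R).comp (algebraMap F L)).toAlgebra
        refine funext fun _ => ?_
        change (algebraMap F L c • gaCoord (F := F) x i) ^ Nat.card F ^ j =
          algebraMap F L c • gaCoord (F := F) x i ^ Nat.card F ^ j
        have h1 : ∀ y : R, algebraMap F L c • y = c • y := fun y => by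
          rw [Algebra.smul_def, Algebra.smul_def]
          rfl
        rw [h1, h1, smul_pow_card] }
  naturality R S f := by
    refine ModuleCat.hom_ext (LinearMap.ext fun x => funext fun _ => ?_)
    exact (map_pow f.hom (gaCoord (F := F) x i) _).symm

namespace AndersonModule

variable {F A L : Type u} [Field F] [Finite F] [CommRing A] [Algebra F A] [Field L]
  [Algebra F L] [Algebra A L] {d : ℕ} (E : AndersonModule F A L d) (κ : E.E ≅ Ga F L d)
  (C : Type u) [Field C] [Algebra L C] [Algebra F C]

/-- The additive polynomial given by a morphism to the additive group. -/
def addPolyOfHom (h : E.E ⟶ Ga F L 1) : addPoly F C d :=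
  ⟨fun w => gaCoord (F := F) ((h.app (CommAlgCat.of L C)).hom ((E.pointCoord κ C).symm w)) 0, by
    obtain ⟨N, B, -, hB, -⟩ := exists_frobSum (κ.inv ≫ h) C
    have h1 := comp_frobSum_mem_addPoly (pow_mem_addPoly F (C := C) (0 : Fin 1) 0) (N + 1) B
    convert! h1 using 1
    funext w
    rw [Function.comp_apply, ← hB, pow_zero, pow_one]
    rfl⟩

theorem addPolyOfHom_comp (a : A) (h : E.E ⟶ Ga F L 1) (w : Fin d → C) :
    (E.addPolyOfHom κ C (E.φ a ≫ h)).1 w =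
    gaCoord (F := F) ((h.app (CommAlgCat.of L C)).hom (a • (E.pointCoord κ C).symm w)) 0 := rfl

theorem addPolyOfHom_gaScale (h : E.E ⟶ Ga F L 1) (l : L) :
    E.addPolyOfHom κ C (h ≫ gaScale F l) = algebraMap L C l • E.addPolyOfHom κ C h := by
  ext w
  exact Algebra.smul_def l
    (gaCoord (F := F) ((h.app (CommAlgCat.of L C)).hom ((E.pointCoord κ C).symm w)) 0 : C)

theorem addPolyOfHom_gaPow (i : Fin d) (j : ℕ) :
    E.addPolyOfHom κ C (κ.hom ≫ gaPow F L i j) = ⟨_, pow_mem_addPoly F i j⟩ := by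
  ext w
  exact congrArg (fun w : Fin d → C => w i ^ Nat.card F ^ j)
    ((E.pointCoord κ C).apply_symm_apply w)

/-- The additive polynomials form a finitely generated module under precomposition with `φ_t` if
`E` is abelian and `A` is finite over `F[t]`. -/
theorem exists_addPoly_span (hab : E.IsAbelian) {t : A} {G : Set A} (hG : G.Finite)
    (hspan : Submodule.span F {a | ∃ k : ℕ, ∃ g ∈ G, a = t ^ k * g} = ⊤) {N : ℕ}
    {B : ℕ → Matrix (Fin d) (Fin d) C}
    (ht : ∀ x, E.pointCoord κ C (t • x) = frobSum F (N + 1) B (E.pointCoord κ C x)) :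
    ∃ S : Set (addPoly F C d), S.Finite ∧ Submodule.span C
      {m | ∃ k : ℕ, ∃ s ∈ S, m = ((addPolyComp (F := F) (N + 1) B) ^ k) s} = ⊤ := by
  obtain ⟨S₀, hS₀, hcl⟩ := hab
  refine ⟨Set.image2 (fun g s => E.addPolyOfHom κ C (E.φ g ≫ s)) G S₀, hG.image2 _ hS₀, ?_⟩
  set W := Submodule.span C {m | ∃ k : ℕ, ∃ s ∈ Set.image2
    (fun g s => E.addPolyOfHom κ C (E.φ g ≫ s)) G S₀,
      m = ((addPolyComp (F := F) (N + 1) B) ^ k) s} with hW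
  have hpow : ∀ (k : ℕ) (m : addPoly F C d) (x : E.Points C),
      (((addPolyComp (F := F) (N + 1) B) ^ k) m).1 (E.pointCoord κ C x) =
        m.1 (E.pointCoord κ C (t ^ k • x)) := by
    intro k
    induction k with
    | zero => intro m x; rw [pow_zero, pow_zero, one_smul]; rfl
    | succ k ih =>
      intro m x
      rw [pow_succ, Module.End.mul_apply, ih, addPolyComp_apply, ← ht, pow_succ', mul_smul]
  have h1 : ∀ s ∈ S₀, ∀ a : A, E.addPolyOfHom κ C (E.φ a ≫ s) ∈ W := by
    intro s hs a
    have ha : a ∈ Submodule.span F {a | ∃ k : ℕ, ∃ g ∈ G, a = t ^ k * g} := hspan ▸ trivial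
    induction ha using Submodule.span_induction with
    | mem a ha =>
      obtain ⟨k, g, hg, rfl⟩ := ha
      refine Submodule.subset_span ⟨k, _, ⟨g, hg, s, hs, rfl⟩, ?_⟩
      ext w
      obtain ⟨x, rfl⟩ := (E.pointCoord κ C).surjective w
      rw [hpow, addPolyOfHom_comp, addPolyOfHom_comp, AddEquiv.symm_apply_apply,
        AddEquiv.symm_apply_apply, mul_comm, mul_smul]
    | zero =>
      convert! zero_mem W using 1
      ext w
      rw [addPolyOfHom_comp, zero_smul]
      exact congrArg (fun y => gaCoord (F := F) y 0) (map_zero (s.app (CommAlgCat.of L C)).hom)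
    | add a b _ _ ha hb =>
      convert! add_mem ha hb using 1
      ext w
      rw [addPolyOfHom_comp, add_smul]
      exact congrArg (fun y => gaCoord (F := F) y 0) (map_add (s.app (CommAlgCat.of L C)).hom
        (a • (E.pointCoord κ C).symm w) (b • (E.pointCoord κ C).symm w))
    | smul c a _ ha =>
      convert! Submodule.smul_mem W (algebraMap L C (algebraMap F L c)) ha using 1
      ext w
      rw [addPolyOfHom_comp, smul_assoc_points]
      refine (congrArg (fun y => gaCoord (F := F) y 0) (map_smul (s.app (CommAlgCat.of L C)).hom c
        (a • (E.pointCoord κ C).symm w))).trans ?_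
      exact Algebra.smul_def (algebraMap F L c) (gaCoord (F := F)
        ((s.app (CommAlgCat.of L C)).hom (a • (E.pointCoord κ C).symm w)) 0 : C)
  have h2 : ∀ h : E.E ⟶ Ga F L 1, E.addPolyOfHom κ C h ∈ W := by
    intro h
    have hh : h ∈ AddSubgroup.closure
      {m : E.E ⟶ Ga F L 1 | ∃ (a : A) (l : L), ∃ s ∈ S₀, m = E.φ a ≫ s ≫ gaScale F l} :=
      hcl ▸ trivial
    induction hh using AddSubgroup.closure_induction with
    | mem h hh =>
      obtain ⟨a, l, s, hs, rfl⟩ := hh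
      rw [← Category.assoc, addPolyOfHom_gaScale]
      exact Submodule.smul_mem _ _ (h1 s hs a)
    | zero => exact zero_mem W
    | add h h' _ _ ih ih' => exact add_mem ih ih'
    | neg h _ ih => exact neg_mem ih
  -- The monomials are defined over `L`, so morphisms over `L` span the additive polynomials over
  -- `C`.
  rw [eq_top_iff]
  rintro ⟨m, hm⟩ -
  induction hm using Submodule.span_induction with
  | mem m hm =>
    obtain ⟨⟨i, j⟩, rfl⟩ := hm
    rw [← E.addPolyOfHom_gaPow κ C i j]
    exact h2 _
  | zero => exact zero_mem W
  | add m m' hm hm' h h' => exact add_mem h h'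
  | smul c m hm h => exact Submodule.smul_mem W c h

end AndersonModule

/-! ### Division on the Lie algebra and torsion points -/

namespace AndersonModule

variable {F A L : Type u} [Field F] [CommRing A] [Algebra F A] [Field L]
  [Algebra F L] [Algebra A L] {d : ℕ} (E : AndersonModule F A L d)

/-- In coordinates the action is a nonzero scalar plus a commuting nilpotent matrix, hence
invertible. -/
theorem smul_lie_bijective [Finite F] (C : Type u) [Field C] [Algebra L C] {a : A}
    (ha : algebraMap A L a ≠ 0) : Function.Bijective (fun x : E.Lie C => a • x) := by
  obtain ⟨κ⟩ := E.iso_ga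
  obtain ⟨N, B, -, -, hl, hn⟩ := E.exists_coord κ a C
  have hθ : algebraMap L C (algebraMap A L a) ≠ 0 :=
    (map_ne_zero_iff _ (algebraMap L C).injective).mpr ha
  have hu : IsUnit (B 0) := by
    have h1 : IsUnit (algebraMap L C (algebraMap A L a) • (1 : Matrix (Fin d) (Fin d) C)) := by
      refine IsUnit.of_mul_eq_one ((algebraMap L C (algebraMap A L a))⁻¹ • 1) ?_
      rw [smul_mul_smul_comm, mul_inv_cancel₀ hθ, one_smul, one_mul]
    have h2 := hn.isUnit_add_left_of_commute h1 ((Commute.one_right _).smul_right _)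
    rwa [add_sub_cancel] at h2
  have hu' : Function.Bijective (B 0).mulVec :=
    ⟨Matrix.mulVec_injective_iff_isUnit.mpr hu, Matrix.mulVec_surjective_iff_isUnit.mpr hu⟩
  have h3 : (fun x : E.Lie C => a • x) =
      (E.lieCoord κ C).symm ∘ (B 0).mulVec ∘ E.lieCoord κ C := by
    funext x
    rw [Function.comp_apply, Function.comp_apply, ← hl, AddEquiv.symm_apply_apply]
  rw [h3]
  exact (E.lieCoord κ C).symm.bijective.comp (hu'.comp (E.lieCoord κ C).bijective)

section FracAct

variable {C : Type u} [CommRing C] [Algebra L C] {K : Type u} [Field K] [Algebra A K]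

/-- The action of `r = a / b` is determined by the actions of `a` and `b`. -/
theorem smul_fracAct [FaithfulSMul A K]
    (hbij : ∀ b : A, b ≠ 0 → Function.Bijective (fun x : E.Lie C => b • x)) {a b : A} (hb : b ≠ 0)
    {r : K} (hr : r * algebraMap A K b = algebraMap A K a) (x : E.Lie C) :
    b • E.fracAct C r x = a • x := by
  have hinj := FaithfulSMul.algebraMap_injective A K
  have hb' : algebraMap A K b ≠ 0 := (map_ne_zero_iff _ hinj).mpr hb
  have h : ∃ ab : A × A, algebraMap A K ab.2 ≠ 0 ∧
      r = algebraMap A K ab.1 / algebraMap A K ab.2 := ⟨(a, b), hb', by rw [← hr]; field_simp⟩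
  obtain ⟨h1, h2⟩ := h.choose_spec
  have h3 : E.fracAct C r x =
      (Ring.inverse (E.lieAct C h.choose.2) * E.lieAct C h.choose.1) x := by
    -- The fraction selected by choice need not be `a / b`; the two are compared after
    -- multiplication by the chosen denominator.
    rw [fracAct, dif_pos h]
  set a' := h.choose.1
  set b' := h.choose.2
  have hb'0 : b' ≠ 0 := fun h0 => h1 (by rw [h0, map_zero])
  have hunit : IsUnit (E.lieAct C b') := (Module.End.isUnit_iff _).mpr (hbij b' hb'0)
  have h4 : b' • E.fracAct C r x = a' • x := by
    rw [h3, smul_lie_def, ← Module.End.mul_apply, ← mul_assoc, Ring.mul_inverse_cancel _ hunit,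
      one_mul, smul_lie_def]
  refine (hbij b' hb'0).1 ?_
  change b' • b • _ = b' • a • x
  rw [smul_comm b', h4, ← mul_smul, ← mul_smul]
  congr 1
  refine hinj ?_
  rw [map_mul, map_mul, ← hr, h2]
  field_simp

end FracAct

end AndersonModule

section Torsion

variable {A V W : Type*} [CommRing A] [AddCommGroup V] [Module A V] [AddCommGroup W] [Module A W]
  {p : Ideal A}

theorem smul_eq_of_mk_eq {e : W} (he : ∀ b ∈ p, b • e = 0) {a b : A}
    (h : Ideal.Quotient.mk p a = Ideal.Quotient.mk p b) : a • e = b • e := by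
  rw [← sub_eq_zero, ← sub_smul]
  exact he _ (Ideal.Quotient.eq.mp h)

/-- If `u` acts injectively on `V` and `u z = 1 + c`, a submodule which is the image of a linear map
from `V` and contains the `𝔭`-torsion contains every element whose multiples by `𝔭` it contains. -/
theorem mem_range_of_forall_smul_mem (f : V →ₗ[A] W) {u c : A} (hu : u ∈ p) (hc : c ∈ p)
    (hbij : Function.Bijective (fun x : V => u • x))
    (hz : ∀ b ∈ p, ∃ b' : A, b' * u = b * (1 + c))
    (htor : ∀ e : W, (∀ b ∈ p, b • e = 0) → e ∈ LinearMap.range f) {e : W}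
    (he : ∀ b ∈ p, b • e ∈ LinearMap.range f) : e ∈ LinearMap.range f := by
  obtain ⟨y, hy⟩ := he u hu
  obtain ⟨y', hy'⟩ := he c hc
  -- With $ue=f(y)$, this `w` stands for $zy$: on $\mathfrak p$ its image acts like $(1+c)e$. Adding
  -- $f(y')=ce$ to `e` then leaves a difference killed by $\mathfrak p$.
  obtain ⟨w, hw⟩ := hbij.2 ((1 + c) • y)
  have hw' : ∀ b ∈ p, b • f w = (b * (1 + c)) • e := by
    intro b hb
    obtain ⟨b', hb'⟩ := hz b hb
    have h1 : b • w = b' • y := by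
      refine hbij.1 ?_
      change u • b • w = u • b' • y
      rw [smul_comm u b, show u • w = (1 + c) • y from hw, ← mul_smul, ← mul_smul, ← hb', mul_comm]
    rw [← map_smul, h1, map_smul, hy, ← mul_smul, hb']
  have h2 : e + f y' - f w ∈ LinearMap.range f := by
    refine htor _ fun b hb => ?_
    rw [smul_sub, smul_add, hw' b hb, hy', mul_add, add_smul, mul_one, ← mul_smul, sub_self]
  have h3 : e = (e + f y' - f w) - f y' + f w := by abel
  rw [h3]
  exact add_mem (sub_mem h2 ⟨y', rfl⟩) ⟨w, rfl⟩

/-- Multiples by $\mathfrak p$ of a $\mathfrak p^{n+1}$-torsion element are $\mathfrak p^n$-torsion,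
so one division step raises the exponent by one. -/
theorem mem_range_of_pow_torsion (f : V →ₗ[A] W) {u c : A} (hu : u ∈ p) (hc : c ∈ p)
    (hbij : Function.Bijective (fun x : V => u • x))
    (hz : ∀ b ∈ p, ∃ b' : A, b' * u = b * (1 + c))
    (htor : ∀ e : W, (∀ b ∈ p, b • e = 0) → e ∈ LinearMap.range f) (n : ℕ) {e : W}
    (he : ∀ b ∈ p ^ n, b • e = 0) : e ∈ LinearMap.range f := by
  induction n generalizing e with
  | zero =>
    rw [← one_smul A e, he 1 (by simp)]
    exact zero_mem _
  | succ n ih =>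
    refine mem_range_of_forall_smul_mem f hu hc hbij hz htor fun b hb => ih fun a ha => ?_
    rw [← mul_smul]
    exact he _ (by rw [pow_succ]; exact Ideal.mul_mem_mul ha hb)

end Torsion

/-! ### Gauss-Thakur sums of torsion points -/

namespace AndersonModule

section GaussThakur

variable {F A L : Type u} [Field F] [CommRing A] [Algebra F A] [Field L]
  [Algebra F L] [Algebra A L] {d : ℕ} (E : AndersonModule F A L d) (R : Type u) [CommRing R]
  [Algebra L R] {p : Ideal A} (χ : (A ⧸ p)ˣ →* (A ⧸ p)ˣ)

theorem charLift_of_mem {A : Type u} [CommRing A] {p : Ideal A} (χ : (A ⧸ p)ˣ →* (A ⧸ p)ˣ)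
    [Nontrivial (A ⧸ p)] {a : A} (ha : a ∈ p) : charLift χ a = 0 := by
  rw [charLift, Ideal.Quotient.eq_zero_iff_mem.mpr ha]
  exact MulChar.map_nonunit _ not_isUnit_zero

theorem charLift_eq {A : Type u} [CommRing A] {p : Ideal A} (χ : (A ⧸ p)ˣ →* (A ⧸ p)ˣ)
    (x : (A ⧸ p)ˣ) {a : A} (ha : Ideal.Quotient.mk p a = x) : charLift χ a = χ x := by
  rw [charLift, ha, MulChar.ofUnitHom_coe]

theorem exists_unit_eq_mk {A : Type u} [CommRing A] {p : Ideal A} (hp : p.IsMaximal) {a : A}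
    (ha : a ∉ p) : ∃ x : (A ⧸ p)ˣ, (x : A ⧸ p) = Ideal.Quotient.mk p a := by
  obtain ⟨b, hb⟩ := ((Ideal.Quotient.maximal_ideal_iff_isField_quotient p).mp hp).mul_inv_cancel
    (mt Ideal.Quotient.eq_zero_iff_mem.mp ha)
  exact ⟨Units.mkOfMulEqOne _ b hb, rfl⟩

variable [Fintype (A ⧸ p)ˣ]

/-- The Gauss-Thakur sum of the map `x ↦ x e`. -/
def torsionSum : E.Points R →+ (A ⧸ p) ⊗[F] E.Points R where
  toFun e := -∑ x : (A ⧸ p)ˣ, (((χ x)⁻¹ : (A ⧸ p)ˣ) : A ⧸ p) ⊗ₜ[F] ((x : A ⧸ p).out • e)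
  map_zero' := by simp
  map_add' e e' := by
    simp only [smul_add, TensorProduct.tmul_add, Finset.sum_add_distrib, neg_add]

theorem torsionSum_apply (e : E.Points R) : E.torsionSum R χ e =
    -∑ x : (A ⧸ p)ˣ, (((χ x)⁻¹ : (A ⧸ p)ˣ) : A ⧸ p) ⊗ₜ[F] ((x : A ⧸ p).out • e) := rfl

theorem gaussThakurSum_eq_torsionSum {ψ : A ⧸ p → E.Points R} {e : E.Points R}
    (hψ : ∀ x, ψ x = x.out • e) : E.gaussThakurSum R χ ψ = E.torsionSum R χ e := by
  rw [gaussThakurSum, finsum_eq_sum_of_fintype, torsionSum_apply]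
  simp only [hψ]

theorem baseChange_torsionSum (a : A) (e : E.Points R) :
    (E.pointsAct R a).baseChange (A ⧸ p) (E.torsionSum R χ e) = E.torsionSum R χ (a • e) := by
  simp only [torsionSum_apply, map_neg, map_sum, LinearMap.baseChange_tmul, ← smul_points_def]
  simp only [smul_comm a]

/-- For `a` outside `p` substitute $x\mapsto xa$ in the sum over the unit group; for `a` in `p` both
sides vanish. -/
theorem torsionSum_smul (hp : p.IsMaximal) {e : E.Points R} (he : ∀ b ∈ p, b • e = 0) (a : A) :
    E.torsionSum R χ (a • e) = charLift χ a • E.torsionSum R χ e := by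
  have : Nontrivial (A ⧸ p) := Ideal.Quotient.nontrivial_iff.mpr hp.ne_top
  by_cases ha : a ∈ p
  · rw [he a ha, map_zero, charLift_of_mem χ ha, zero_smul]
  obtain ⟨y, hy⟩ := exists_unit_eq_mk hp ha
  rw [charLift_eq χ y hy.symm, torsionSum_apply, torsionSum_apply, smul_neg, Finset.smul_sum]
  congr 1
  refine Fintype.sum_equiv (Equiv.mulRight y) _ _ fun x => ?_
  rw [TensorProduct.smul_tmul', smul_eq_mul, ← Units.val_mul, Equiv.coe_mulRight, map_mul, mul_inv,
    mul_comm (χ x)⁻¹, mul_inv_cancel_left, ← mul_smul]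
  congr 1
  refine smul_eq_of_mk_eq he ?_
  rw [map_mul, Ideal.Quotient.mk_out, Ideal.Quotient.mk_out, Units.val_mul, hy]

theorem torsionSum_mem_gaussSpace (hp : p.IsMaximal) {e : E.Points R} (he : ∀ b ∈ p, b • e = 0) :
    E.torsionSum R χ e ∈ E.gaussSpace R χ := fun a => by
  rw [baseChange_torsionSum, E.torsionSum_smul R χ hp he]

variable [Finite (A ⧸ p)]

/-- The order of the residue field is zero in it, and there is one more element than there are
units. -/
theorem neg_card_units (hp : p.IsMaximal) : -(Fintype.card (A ⧸ p)ˣ : A ⧸ p) = 1 := by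
  classical
  let := Fintype.ofFinite (A ⧸ p)
  let := Ideal.Quotient.field p
  have h1 := Nat.cast_card_eq_zero (A ⧸ p)
  have h2 : Fintype.card (A ⧸ p) = Fintype.card (A ⧸ p)ˣ + 1 := by
    have h3 := Fintype.card_pos (α := A ⧸ p)
    have := Nat.card_units (A ⧸ p)
    rw [Nat.card_eq_fintype_card, Nat.card_eq_fintype_card] at this
    lia
  rw [h2, Nat.cast_add, Nat.cast_one] at h1
  exact neg_eq_of_add_eq_zero_right h1

/-- The space of Gauss-Thakur sums is generated by the sums of torsion points. -/
theorem span_torsionSum (hp : p.IsMaximal) :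
    Submodule.span (A ⧸ p) (E.torsionSum R χ '' {e | ∀ b ∈ p, b • e = 0}) = E.gaussSpace R χ := by
  have : Nontrivial (A ⧸ p) := Ideal.Quotient.nontrivial_iff.mpr hp.ne_top
  refine le_antisymm (Submodule.span_le.mpr ?_) fun g hg => ?_
  · rintro _ ⟨e, he, rfl⟩
    exact E.torsionSum_mem_gaussSpace R χ hp he
  classical
  have : Module.Finite F (A ⧸ p) := Module.Finite.of_finite
  -- Coordinates with respect to a basis of the residue field commute with the action on points, so
  -- each coordinate of `g` is a $\mathfrak p$-torsion point.
  let β := Module.finBasis F (A ⧸ p)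
  let ε := TensorProduct.equivFinsuppOfBasisLeft (N := E.Points R) β
  have hε : ∀ (h : Module.End F (E.Points R)) (g : (A ⧸ p) ⊗[F] E.Points R) j,
      ε (h.baseChange (A ⧸ p) g) j = h (ε g j) := by
    intro h g j
    induction g using TensorProduct.induction_on with
    | zero => simp
    | tmul c w => simp [ε]
    | add x y hx hy => rw [map_add, map_add, map_add, Finsupp.add_apply, Finsupp.add_apply, map_add,
        hx, hy]
  have htor : ∀ j, ∀ b ∈ p, b • ε g j = 0 := by
    intro j b hb
    rw [smul_points_def, ← hε, hg b, charLift_of_mem χ hb, zero_smul, map_zero, Finsupp.zero_apply]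
  have hgsum : g = ∑ j, β j ⊗ₜ[F] ε g j := by
    conv_lhs => rw [← ε.symm_apply_apply g, TensorProduct.equivFinsuppOfBasisLeft_symm_apply]
    exact Finsupp.sum_fintype _ _ fun j => TensorProduct.tmul_zero _ _
  -- Each summand equals `g` by the defining property of the space, and minus the number of units is
  -- one.
  have h1 : g = -∑ x : (A ⧸ p)ˣ, (((χ x)⁻¹ : (A ⧸ p)ˣ) : A ⧸ p) •
      (E.pointsAct R (x : A ⧸ p).out).baseChange (A ⧸ p) g := by
    have h2 : ∀ x : (A ⧸ p)ˣ, (((χ x)⁻¹ : (A ⧸ p)ˣ) : A ⧸ p) •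
        (E.pointsAct R (x : A ⧸ p).out).baseChange (A ⧸ p) g = g := fun x => by
      rw [hg, charLift_eq χ x (Ideal.Quotient.mk_out _), smul_smul, Units.inv_mul, one_smul]
    simp only [h2]
    rw [Finset.sum_const, Finset.card_univ, ← Nat.cast_smul_eq_nsmul (A ⧸ p), ← neg_smul,
      neg_card_units hp, one_smul]
  have h3 : g = ∑ j, β j • E.torsionSum R χ (ε g j) := by
    conv_lhs => rw [h1, hgsum]
    simp only [torsionSum_apply, map_sum, LinearMap.baseChange_tmul, Finset.smul_sum, smul_neg,
      Finset.sum_neg_distrib, TensorProduct.smul_tmul', smul_eq_mul, ← smul_points_def]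
    rw [Finset.sum_comm]
    simp only [mul_comm]
  rw [h3]
  exact sum_mem fun j _ => Submodule.smul_mem _ _ (Submodule.subset_span ⟨_, htor j, rfl⟩)

/-- For an evaluative character a torsion point can be recovered from its Gauss-Thakur sum. -/
theorem mem_of_torsionSum_mem_span (hp : p.IsMaximal) (hχ : IsEvaluative F χ)
    (H : Submodule A (E.Points R)) {e : E.Points R} (he : ∀ b ∈ p, b • e = 0)
    (h : E.torsionSum R χ e ∈ Submodule.span (A ⧸ p) (E.torsionSum R χ '' H)) : e ∈ H := by
  have : Nontrivial (A ⧸ p) := Ideal.Quotient.nontrivial_iff.mpr hp.ne_top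
  obtain ⟨f, hf⟩ := hχ
  -- Evaluativity makes `χ` an endomorphism of the finite residue field, hence an automorphism.
  let σ₀ : (A ⧸ p) →ₐ[F] (A ⧸ p) := Ideal.Quotient.liftₐ p f fun a ha => by
    rw [hf, charLift_of_mem χ ha]
  have hσ₀ : ∀ a, σ₀ (Ideal.Quotient.mk p a) = charLift χ a := fun a => hf a
  have hinj : Function.Injective σ₀ := by
    rw [injective_iff_map_eq_zero]
    intro x hx
    obtain ⟨a, rfl⟩ := Ideal.Quotient.mk_surjective x
    by_contra h0
    obtain ⟨y, hy⟩ := exists_unit_eq_mk hp (mt Ideal.Quotient.eq_zero_iff_mem.mpr h0)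
    rw [hσ₀, charLift_eq χ y hy.symm] at hx
    exact (χ y).ne_zero hx
  let σ : (A ⧸ p) ≃ₐ[F] (A ⧸ p) := AlgEquiv.ofBijective σ₀ (Finite.injective_iff_bijective.mp hinj)
  obtain ⟨s, hs⟩ := LinearMap.exists_rightInverse_of_surjective (Ideal.Quotient.mkₐ F p).toLinearMap
    (LinearMap.range_eq_top.mpr (Ideal.Quotient.mkₐ_surjective F p))
  have hs' : ∀ x, Ideal.Quotient.mk p (s x) = x := fun x => LinearMap.congr_fun hs x
  let act : A →ₗ[F] Module.End F (E.Points R) :=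
    { toFun := E.pointsAct R
      map_add' := map_add _
      map_smul' := fun c a => LinearMap.ext fun x => E.smul_assoc_points R c a x }
  -- Contraction $c\otimes w\mapsto\sigma^{-1}(c)w$, through an `F`-linear section `s` of the
  -- quotient. On the sum of a torsion point every term gives back `e`, as
  -- $\sigma^{-1}(\chi(x)^{-1})x=1$.
  let ρ : (A ⧸ p) ⊗[F] E.Points R →ₗ[F] E.Points R :=
    TensorProduct.lift (act ∘ₗ s ∘ₗ σ.symm.toLinearMap)
  have hρ : ∀ c w, ρ (c ⊗ₜ[F] w) = s (σ.symm c) • w := fun c w => rfl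
  have h1 : ρ (E.torsionSum R χ e) = e := by
    have h2 : ∀ x : (A ⧸ p)ˣ, s (σ.symm ((χ x)⁻¹ : (A ⧸ p)ˣ)) • (x : A ⧸ p).out • e = e := by
      intro x
      rw [← mul_smul]
      refine (smul_eq_of_mk_eq he ?_).trans (one_smul A e)
      have h3 : ((χ x : (A ⧸ p)ˣ) : A ⧸ p) = σ (x : A ⧸ p) := by
        obtain ⟨a, ha⟩ := Ideal.Quotient.mk_surjective (x : A ⧸ p)
        rw [← charLift_eq χ x ha, ← hσ₀, ha]
        rfl
      have h4 : σ.symm ((χ x)⁻¹ : (A ⧸ p)ˣ) * (x : A ⧸ p) = 1 := by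
        rw [← σ.symm_apply_apply (x : A ⧸ p), ← h3, ← map_mul, Units.inv_mul, map_one]
      rw [map_mul, hs', Ideal.Quotient.mk_out, h4, map_one]
    rw [torsionSum_apply, map_neg, map_sum]
    simp only [hρ, h2]
    rw [Finset.sum_const, Finset.card_univ, ← Nat.cast_smul_eq_nsmul A, ← neg_smul]
    refine (smul_eq_of_mk_eq he ?_).trans (one_smul A e)
    rw [map_neg, map_natCast, neg_card_units hp, map_one]
  -- The factor `c` is built into the induction because `ρ` is not linear over the residue field.
  have h2 : ∀ g ∈ Submodule.span (A ⧸ p) (E.torsionSum R χ '' H), ∀ c : A ⧸ p, ρ (c • g) ∈ H := by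
    intro g hg
    induction hg using Submodule.span_induction with
    | mem g hg =>
      obtain ⟨w, hw, rfl⟩ := hg
      intro c
      rw [torsionSum_apply, smul_neg, Finset.smul_sum, map_neg, map_sum]
      refine neg_mem (sum_mem fun x _ => ?_)
      rw [TensorProduct.smul_tmul', hρ]
      exact H.smul_mem _ (H.smul_mem _ hw)
    | zero => intro c; rw [smul_zero, map_zero]; exact zero_mem H
    | add x y _ _ hx hy => intro c; rw [smul_add, map_add]; exact add_mem (hx c) (hy c)
    | smul a x _ hx => intro c; rw [smul_smul]; exact hx _
  rw [← h1, ← one_smul (A ⧸ p) (E.torsionSum R χ e)]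
  exact h2 _ h 1

end GaussThakur

end AndersonModule

/-! ### Surjectivity of the exponential function -/

namespace AndersonModule

section Exponential

variable {F A L : Type u} [Field F] [Finite F] [CommRing A] [Algebra F A] [Field L]
  [Algebra F L] [Algebra A L] {d : ℕ} (E : AndersonModule F A L d)
  {C : Type u} [NormedField C] [CompleteSpace C] [IsUltrametricDist C] [IsAlgClosed C] [Algebra L C]

/-- The exponential function of an abelian Anderson module is surjective as soon as its image
contains all torsion by powers of some `t` of absolute value `> 1`. -/
theorem surjective_of_torsion_subset_range (hd : 0 < d) (hab : E.IsAbelian)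
    {f : E.Lie C →ₗ[A] E.Points C} (hf : E.IsExponential C f) {t : A}
    (ht : 1 < ‖algebraMap L C (algebraMap A L t)‖)
    (hspan : ∀ m, 0 < m → ∃ G : Set A, G.Finite ∧
      Submodule.span F {a | ∃ k : ℕ, ∃ g ∈ G, a = (t ^ m) ^ k * g} = ⊤)
    (htor : ∀ (m : ℕ) (e : E.Points C), t ^ m • e = 0 → e ∈ LinearMap.range f) :
    Function.Surjective f := by
  let : Algebra F C := ((algebraMap L C).comp (algebraMap F L)).toAlgebra
  obtain ⟨κ⟩ := E.iso_ga
  -- From here on `t ^ m` replaces `t`, since its linear part is scalar.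
  obtain ⟨m, hm, N, B, -, hB0, hpt, hlie⟩ := E.exists_coord_pow hd κ t C
  obtain ⟨G, hG, hspan⟩ := hspan m hm
  obtain ⟨e, he0, he⟩ := hf κ
  have hθ : 1 < ‖algebraMap L C (algebraMap A L t) ^ m‖ := by
    rw [norm_pow]
    exact one_lt_pow₀ ht hm.ne'
  let f₀ : (Fin d → C) →+ (Fin d → C) := (E.pointCoord κ C).toAddMonoidHom.comp
    (f.toAddMonoidHom.comp (E.lieCoord κ C).symm.toAddMonoidHom)
  have hf₀ : ∀ x, f₀ x = E.pointCoord κ C (f ((E.lieCoord κ C).symm x)) := fun x => rfl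
  have hsurj : Function.Surjective f₀ := by
    refine surjective_of_ker_subset_range (F := F) hθ hB0
      (E.exists_addPoly_span κ C hab hG hspan hpt) he0 ?_ ?_ ?_
    · intro x
      have h1 := he ((E.lieCoord κ C).symm x)
      rw [← lieCoord_apply, AddEquiv.apply_symm_apply] at h1
      exact h1
    · intro x
      rw [hf₀, hf₀, ← hpt, ← map_smul]
      congr 2
      rw [AddEquiv.symm_apply_eq, hlie, AddEquiv.apply_symm_apply]
    · intro w hw
      obtain ⟨y, hy⟩ := htor m ((E.pointCoord κ C).symm w) (by
        rw [← map_eq_zero_iff _ (E.pointCoord κ C).injective, hpt, AddEquiv.apply_symm_apply, hw])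
      refine ⟨E.lieCoord κ C y, ?_⟩
      rw [hf₀, AddEquiv.symm_apply_apply, hy, AddEquiv.apply_symm_apply]
  intro w
  obtain ⟨x, hx⟩ := hsurj (E.pointCoord κ C w)
  exact ⟨_, (E.pointCoord κ C).injective hx⟩

end Exponential

/-! ### Gauss-Thakur sums of periods -/

section Periods

variable {F A L : Type u} [Field F] [CommRing A] [Algebra F A] [Field L]
  [Algebra F L] [Algebra A L] {d : ℕ} (E : AndersonModule F A L d)
  {C : Type u} [NormedField C] [Algebra L C] {K : Type u} [Field K] [Algebra A K] [FaithfulSMul A K]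
  {p : Ideal A} [Fintype (A ⧸ p)ˣ] (χ : (A ⧸ p)ˣ →* (A ⧸ p)ˣ)

/-- The Gauss-Thakur sums of a set of generators of the period lattice span the same space as those
of the torsion points in the image of the exponential function. -/
theorem span_gaussThakurSum_periodChar (hp : p.IsMaximal)
    (hbij : ∀ b : A, b ≠ 0 → Function.Bijective (fun x : E.Lie C => b • x)) {u c : A} {z : K}
    (hu : u ∈ p) (hu0 : u ≠ 0) (hc : c ∈ p) (huz : algebraMap A K u * z = algebraMap A K (1 + c))
    (hz : ∀ b ∈ p, ∃ b', algebraMap A K b' = algebraMap A K b * z) {S : Set (E.Lie C)}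
    (hS : Submodule.span A S = E.periodLattice C) :
    Submodule.span (A ⧸ p) ((fun lam => E.gaussThakurSum C χ (E.periodChar p z C lam)) '' S) =
      Submodule.span (A ⧸ p) (E.torsionSum C χ ''
        {e | (∀ b ∈ p, b • e = 0) ∧ e ∈ LinearMap.range (E.exp C)}) := by
  have hinj := FaithfulSMul.algebraMap_injective A K
  -- Since $uz=1+c$, the vector `w x` is $\partial z\,x$.
  choose w hw using fun x : E.Lie C => (hbij u hu0).2 ((1 + c) • x)
  replace hw : ∀ x, u • w x = (1 + c) • x := hw
  have hker : ∀ {x}, x ∈ E.periodLattice C ↔ E.exp C x = 0 := LinearMap.mem_ker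
  have hwtor : ∀ x ∈ E.periodLattice C, ∀ b ∈ p, b • E.exp C (w x) = 0 := by
    intro x hx b hb
    obtain ⟨b', hb'⟩ := hz b hb
    have h1 : b • w x = b' • x := by
      refine (hbij u hu0).1 ?_
      change u • b • w x = u • b' • x
      rw [smul_comm u b, hw, ← mul_smul, ← mul_smul]
      congr 1
      refine hinj ?_
      rw [map_mul, map_mul, hb', ← huz]
      ring
    rw [← map_smul, h1, map_smul, hker.mp hx, smul_zero]
  have hψ : ∀ x, E.gaussThakurSum C χ (E.periodChar p z C x) =
      E.torsionSum C χ (E.exp C (w x)) := by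
    intro x
    refine E.gaussThakurSum_eq_torsionSum C χ fun y => ?_
    rw [periodChar, ← map_smul]
    congr 1
    refine (hbij u hu0).1 ?_
    change u • _ = u • y.out • w x
    rw [E.smul_fracAct hbij (a := y.out * (1 + c)) hu0, smul_comm u, hw, mul_smul]
    rw [map_mul, ← huz]
    ring
  have hwadd : ∀ x y, w (x + y) = w x + w y := fun x y => (hbij u hu0).1 (by
    change u • _ = u • _
    rw [smul_add, hw, hw, hw, smul_add])
  have hwsmul : ∀ (a : A) x, w (a • x) = a • w x := fun a x => (hbij u hu0).1 (by
    change u • _ = u • _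
    rw [smul_comm u, hw, hw, smul_comm a])
  simp only [hψ]
  refine le_antisymm (Submodule.span_mono ?_) (Submodule.span_le.mpr ?_)
  · rintro _ ⟨x, hx, rfl⟩
    exact ⟨_, ⟨hwtor x (hS ▸ Submodule.subset_span hx), _, rfl⟩, rfl⟩
  · rintro _ ⟨_, ⟨htor, y, rfl⟩, rfl⟩
    have h1 : ∀ x ∈ Submodule.span A S, E.torsionSum C χ (E.exp C (w x)) ∈
        Submodule.span (A ⧸ p) ((fun x => E.torsionSum C χ (E.exp C (w x))) '' S) := by
      intro x hx
      induction hx using Submodule.span_induction with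
      | mem x hx => exact Submodule.subset_span ⟨x, hx, rfl⟩
      | zero =>
        have h0 : w 0 = 0 := by simpa using hwsmul 0 0
        rw [h0, map_zero, map_zero]
        exact zero_mem _
      | add x y _ _ hx hy => rw [hwadd, map_add, map_add]; exact add_mem hx hy
      | smul a x hxS hx =>
        rw [hwsmul, map_smul, E.torsionSum_smul C χ hp (hwtor x (hS ▸ hxS))]
        exact Submodule.smul_mem _ _ hx
    -- If $\exp y$ is $\mathfrak p$-torsion then $uy$ is a period, and
    -- $\exp(\partial(zu)y)=\exp(y+\partial c\,y)=\exp y$ because $c\in\mathfrak p$.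
    have h2 : u • y ∈ Submodule.span A S := by
      rw [hS, hker, map_smul, htor u hu]
    have h3 : w (u • y) = (1 + c) • y := by
      rw [hwsmul, hw]
    have h4 := h1 _ h2
    rwa [h3, map_smul, add_smul, one_smul, htor c hc, add_zero] at h4

end Periods

end AndersonModule

end

/-! ### The main theorem -/

theorem proposition4p10
    (F K Kbar L : Type u)
    [Field F] [Finite F] [Field K] [Algebra F K]
    -- the curve, given by its function field `K`, and the point at infinity
    (hK : IsCurveFunctionField F K)
    (infty : ValuationSubring K) (hinfty : IsClosedPoint F infty)
    -- an algebraic closure of `K` with an absolute value above infinity; `C_∞` is its completion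
    [NormedField Kbar] [IsUltrametricDist Kbar] [Algebra K Kbar] [IsAlgClosure K Kbar]
    (hnorm : ∀ x : K, x ∈ infty ↔ ‖algebraMap K Kbar x‖ ≤ 1)
    -- an intermediate field `K ⊆ L ⊆ C_∞`
    [Field L] [Algebra F L] [Algebra K L] [IsScalarTower F K L]
    [Algebra L (UniformSpace.Completion Kbar)]
    (hL : ∀ x : K, algebraMap L (UniformSpace.Completion Kbar) (algebraMap K L x) =
      ((algebraMap K Kbar x : Kbar) : UniformSpace.Completion Kbar))
    -- an Anderson module over `L`
    (d : ℕ) (hd : 0 < d) (E : AndersonModule F (ringRegularAway F infty) L d)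
    -- a maximal ideal `𝔭`, a uniformizer `u` at `𝔭`, and `z ∈ 𝔭⁻¹` with `u z ≡ 1` modulo `𝔭`
    (p : Ideal (ringRegularAway F infty)) (hp : p.IsMaximal)
    (u : ringRegularAway F infty) (hu : u ∈ p) (hu2 : u ∉ p ^ 2)
    (z : K) (hz : ∀ a ∈ p, (a : K) * z ∈ ringRegularAway F infty)
    (huz : ∃ c ∈ p, (u : K) * z - 1 = (c : K))
    -- a multiplicative character `χ`
    (χ : (ringRegularAway F infty ⧸ p)ˣ →* (ringRegularAway F infty ⧸ p)ˣ)
    -- a set of generators of the period lattice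
    (S : Set (E.Lie (UniformSpace.Completion Kbar)))
    (hS : Submodule.span (ringRegularAway F infty) S =
      E.periodLattice (UniformSpace.Completion Kbar)) :
    (E.IsUniformizable (UniformSpace.Completion Kbar) →
      E.PeriodSumsGenerate χ z (UniformSpace.Completion Kbar) S) ∧
    (E.IsAbelian → IsEvaluative F χ →
      (E.IsUniformizable (UniformSpace.Completion Kbar) ↔
        E.PeriodSumsGenerate χ z (UniformSpace.Completion Kbar) S)) := by
  set C := UniformSpace.Completion Kbar
  have hu0 : u ≠ 0 := fun h => hu2 (h ▸ zero_mem _)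
  have hp0 : p ≠ ⊥ := fun h => hu0 (by rwa [h] at hu)
  obtain ⟨hfin, t, htp, ht0, n, hpn⟩ := hK.finite_quotient_and_exists_pow_eq_span p hp hp0
  have : FaithfulSMul (ringRegularAway F infty) K :=
    (faithfulSMul_iff_algebraMap_injective _ _).mpr Subtype.val_injective
  have hnorm_mem : ∀ a ∈ p, a ≠ 0 → 1 < ‖algebraMap K Kbar a‖ := fun a ha ha0 => by
    have h1 := notMem_infty_of_transcendental (hK.transcendental_of_mem hp.ne_top ha ha0) a.2
    rwa [hnorm, not_le] at h1
  have : IsAlgClosed Kbar := IsAlgClosure.isAlgClosed K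
  have : IsUltrametricDist C := isUltrametricDist_completion Kbar
  have : IsAlgClosed C := isAlgClosed_completion Kbar (hnorm_mem u hu hu0)
  -- Nonzero elements of `p` are nonconstant, so they have a pole at infinity and absolute value
  -- greater than one.
  have ht : 1 < ‖algebraMap L C (algebraMap (ringRegularAway F infty) L t)‖ := by
    have h1 := hnorm_mem t htp ht0
    rwa [← UniformSpace.Completion.norm_coe, ← hL] at h1
  -- Existence is what gives the function selected by `Classical.epsilon` its defining property.
  have hexp : E.IsExponential C (E.exp C) := Classical.epsilon_spec (E.exists_isExponential hd t ht)
  have hbij : ∀ b : ringRegularAway F infty, b ≠ 0 →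
      Function.Bijective (fun x : E.Lie C => b • x) := fun b hb => by
    refine E.smul_lie_bijective C fun h => hb (Subtype.ext ?_)
    exact (algebraMap K L).injective (h.trans (map_zero _).symm)
  let := Fintype.ofFinite (ringRegularAway F infty ⧸ p)ˣ
  obtain ⟨c, hc, huz⟩ := huz
  have huz' : algebraMap (ringRegularAway F infty) K u * z =
      algebraMap (ringRegularAway F infty) K (1 + c) := by
    rw [map_add, map_one]
    exact sub_eq_iff_eq_add'.mp huz
  rw [AndersonModule.PeriodSumsGenerate, E.span_gaussThakurSum_periodChar χ hp hbij hu hu0 hc huz'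
    (fun b hb => ⟨⟨_, hz b hb⟩, rfl⟩) hS, ← E.span_torsionSum C χ hp]
  have h1 : E.IsUniformizable C →
      {e | (∀ b ∈ p, b • e = 0) ∧ e ∈ LinearMap.range (E.exp C)} =
        {e : E.Points C | ∀ b ∈ p, b • e = 0} := fun h =>
    Set.ext fun e => and_iff_left (h e)
  refine ⟨fun h => by rw [h1 h], fun hab hχ => ⟨fun h => by rw [h1 h], fun h => ?_⟩⟩
  -- The sum of a torsion point lies in the span of sums from the image of `exp`; evaluativity
  -- brings the point itself into that image.
  have htor : ∀ e : E.Points C, (∀ b ∈ p, b • e = 0) → e ∈ LinearMap.range (E.exp C) := by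
    intro e he
    refine E.mem_of_torsionSum_mem_span C χ hp hχ _ he ?_
    refine Submodule.span_mono (Set.image_mono fun e he => he.2) (h.ge ?_)
    exact Submodule.subset_span ⟨e, he, rfl⟩
  refine E.surjective_of_torsion_subset_range hd hab hexp ht (fun m hm => ?_) fun m e he => ?_
  · exact hK.exists_span_pow _ (hK.transcendental_of_mem hp.ne_top (p.pow_mem_of_mem htp m hm)
      (pow_ne_zero m ht0))
  · refine mem_range_of_pow_torsion (E.exp C) hu hc (hbij u hu0) (fun b hb => ?_) htor (n * m)
      fun b hb => ?_
    · refine ⟨⟨_, hz b hb⟩, Subtype.ext ?_⟩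
      change (b : K) * z * u = b * _
      rw [mul_assoc, mul_comm z]
      exact congrArg (_ * ·) huz'
    -- As $\mathfrak p^{nm}=(t^m)$, being killed by `t ^ m` is the same as being $\mathfrak
    -- p^{nm}$-torsion.
    · rw [pow_mul, hpn, Ideal.span_singleton_pow, Ideal.mem_span_singleton'] at hb
      obtain ⟨a, rfl⟩ := hb
      rw [mul_smul, he, smul_zero]
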